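/- Let $F\subseteq K\subseteq M$ be fields with $[K:F]=2$, $K/F$ Galois, and $M$ finite Galois over $F$; put $G=\operatorname{Gal}(M/F)$, $H=\operatorname{Gal}(M/K)$. Assume that $M$ is $K/F$-generalized dihedral, i.e. some $\theta_0\in G\setminus H$ satisfies $\theta_0^2=1$ and $\theta_0h\theta_0^{-1}=h^{-1}$ for all $h\in H$. Assume that $M=L_1\otimes_KL_2$ for subfields $L_1,L_2$ of $M$ that are cyclic Galois over $K$. Fix any $\theta\in G\setminus H$, a generator $\sigma$ of $\operatorname{Gal}(M/L_2)$, of order $n=[L_1:K]$, and a generator $\rho$ of $\operatorname{Gal}(M/L_1)$, of order $\ell=[L_2:K]$. A unitary $K/F$-involution on a central simple $K$-algebra $A$ is a ring antiautomorphism $\tau$ with $\tau^2=\mathrm{id}$, $\tau|_K\neq\mathrm{id}$ and $K^\tau=F$. Let $\operatorname{Br}(M/K;F)\subseteq\operatorname{Br}(K)$ be the subgroup of the classes $[A]$ of central simple $K$-algebras $A$ split by $M$ and having a unitary $K/F$-involution. For $s$ a generator of $\operatorname{Gal}(L/K)$ and $b \in K^*$, let $(L/K,s,b)$ denote the cyclic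 algebra $\bigoplus_{i<[L:K]}Lz^i$ with $zcz^{-1}=s(c)$ for $c\in L$ and $z^{[L:K]}=b$. Let $$\operatorname{Dec}(M/K;F)=\{[(L_1/K,\sigma|_{L_1},b_1)\otimes_K(L_2/K,\rho|_{L_2},b_2)]\mid b_1,b_2\in F^*\}.$$ Let $\ker(\widetilde N)=\{m\in M^*\mid N_{M/K}(m)\in F^*\}$ and $\Pi=\prod_{h\in H}M^{*h\theta}$, where $M^{*h\theta}=\{m\in M^*\mid h\theta(m)=m\}$. For $u,b_1,b_2\in M^*$ let $A(u,b_1,b_2)$ be the central simple $K$-algebra $\bigoplus_{i<n,\,j<\ell}Mx^iy^j$ with $xcx^{-1}=\sigma(c)$ and $ycy^{-1}=\rho(c)$ for $c\in M$, $x^n=b_1$, $y^\ell=b_2$ and $xyx^{-1}y^{-1}=u$. Call $(u,b_1,b_2)$ admissible if $$b_1\in L_2,\quad b_2\in L_1,\quad N_{M/L_2}(u)=b_1/\rho(b_1),\quad N_{M/L_1}(u)=\sigma(b_2)/b_2,\quad \theta(b_1)=b_1,\quad \theta(b_2)=b_2,\quad u\cdot\rho\sigma\theta(u)=1.$$ Then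 $\operatorname{Dec}(M/K;F)$ is a subgroup of $\operatorname{Br}(M/K;F)$, $\Pi$ is a subgroup of $\ker(\widetilde N)$, and there is a group isomorphism $$\Phi\colon\ \operatorname{Br}(M/K;F)/\operatorname{Dec}(M/K;F)\ \xrightarrow{\ \cong\ }\ \ker(\widetilde N)/\Pi,$$ given explicitly as follows. Every class in $\operatorname{Br}(M/K;F)$ equals $[A(u,b_1,b_2)]$ for some admissible $(u,b_1,b_2)$. For every admissible $(u,b_1,b_2)$ the algebra $A(u,b_1,b_2)$ exists, there is $q\in M^*$ with $u=q/\rho\sigma\theta(q)$, and, for every such $q$, we have $[A(u,b_1,b_2)]\in\operatorname{Br}(M/K;F)$, $q\in\ker(\widetilde N)$, and $\Phi$ sends the coset of $[A(u,b_1,b_2)]$ to $q\,\Pi$. -/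

import Mathlib

open scoped TensorProduct

universe u

namespace CentralSimple

variable (K : Type u) [Field K]

theorem mulLeftRight_surjective (A : Type u) [Ring A] [Algebra K A] [Algebra.IsCentral K A]
    [IsSimpleRing A] [FiniteDimensional K A] :
    Function.Surjective (AlgHom.mulLeftRight K A) := by
  let _ : Module (A ⊗[K] Aᵐᵒᵖ) A := instModuleTensorProductMop K A
  have hsm : ∀ (a : A) (b : Aᵐᵒᵖ) (x : A), (a ⊗ₜ[K] b) • x = a * x * b.unop := fun a b x =>
    AlgHom.mulLeftRight_apply K A a b x
  have hsimple : IsSimpleModule (A ⊗[K] Aᵐᵒᵖ) A := by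
    refine { eq_bot_or_eq_top := fun N => ?_ }
    by_cases hN : N = ⊥
    · exact Or.inl hN
    refine Or.inr ?_
    obtain ⟨x, hx, hx0⟩ := (Submodule.ne_bot_iff N).1 hN
    let I : TwoSidedIdeal A := .mk' (N : Set A) N.zero_mem (fun h h' => N.add_mem h h')
      (fun h => N.neg_mem h)
      (fun {a b} h => by simpa [hsm] using N.smul_mem (a ⊗ₜ[K] (1 : Aᵐᵒᵖ)) h)
      (fun {a b} h => by simpa [hsm] using N.smul_mem ((1 : A) ⊗ₜ[K] (MulOpposite.op b)) h)
    have h1 : (1 : A) ∈ I := IsSimpleRing.one_mem_of_ne_zero_mem I hx0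
      (by simpa [I, TwoSidedIdeal.mem_mk'] using hx)
    have h1' : (1 : A) ∈ N := by simpa [I, TwoSidedIdeal.mem_mk'] using h1
    refine eq_top_iff.2 fun a _ => ?_
    simpa [hsm] using N.smul_mem (a ⊗ₜ[K] (1 : Aᵐᵒᵖ)) h1'
  intro f
  have hend : ∀ g : Module.End (A ⊗[K] Aᵐᵒᵖ) A, ∃ k : K, ∀ a, g a = k • a := by
    intro g
    have hl : ∀ a x, g (a * x) = a * g x := fun a x => by
      simpa [hsm] using g.map_smul (a ⊗ₜ[K] (1 : Aᵐᵒᵖ)) x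
    have hr : ∀ a x, g (x * a) = g x * a := fun a x => by
      simpa [hsm] using g.map_smul ((1 : A) ⊗ₜ[K] (MulOpposite.op a)) x
    have hc : g 1 ∈ Subalgebra.center K A := Subalgebra.mem_center_iff.2 fun b => by
      rw [← hl, ← hr, mul_one, one_mul]
    obtain ⟨k, hk⟩ := Algebra.mem_bot.1 (Algebra.IsCentral.out hc)
    refine ⟨k, fun a => ?_⟩
    rw [← mul_one a, hl, ← hk, mul_one, Algebra.smul_def, Algebra.commutes]
  let f' : Module.End (Module.End (A ⊗[K] Aᵐᵒᵖ) A) A :=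
    { toFun := f
      map_add' := map_add f
      map_smul' := fun g a => by
        obtain ⟨k, hk⟩ := hend g
        simp [hk] }
  obtain ⟨s, hs⟩ := Module.Finite.fg_top (R := K) (M := A)
  obtain ⟨r, hr⟩ := jacobson_density f' s
  refine ⟨r, LinearMap.ext_on (s := (s : Set A)) hs fun a ha => ?_⟩
  exact (hr a ha).symm

theorem isAzumaya (A : Type u) [Ring A] [Algebra K A] [Algebra.IsCentral K A]
    [IsSimpleRing A] [FiniteDimensional K A] :
    Function.Bijective (AlgHom.mulLeftRight K A) := by
  have hs := mulLeftRight_surjective K A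
  refine ⟨?_, hs⟩
  have : Module.finrank K (A ⊗[K] Aᵐᵒᵖ) = Module.finrank K (Module.End K A) := by
    rw [Module.finrank_tensorProduct, Module.finrank_linearMap,
      (MulOpposite.opLinearEquiv K (M := A)).finrank_eq]
  exact (LinearMap.injective_iff_surjective_of_finrank_eq_finrank
    (f := (AlgHom.mulLeftRight K A).toLinearMap) this).2 hs

theorem isSimpleRing_tensorProduct (A B : Type u) [Ring A] [Algebra K A] [Algebra.IsCentral K A]
    [IsSimpleRing A] [FiniteDimensional K A] [Ring B] [Algebra K B] [IsSimpleRing B] :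
    IsSimpleRing (A ⊗[K] B) := by
  have : Nontrivial (A ⊗[K] B) := inferInstance
  refine IsSimpleRing.of_eq_bot_or_eq_top fun I => ?_
  by_cases hI : I = ⊥
  · exact Or.inl hI
  refine Or.inr ?_
  obtain ⟨t, ht, ht0⟩ : ∃ t ∈ I, t ≠ 0 := by
    by_contra! h
    exact hI (le_antisymm (fun x hx => by simpa [TwoSidedIdeal.mem_bot] using h x hx) bot_le)
  have key : ∀ (f : Module.End K A) (x : A ⊗[K] B), x ∈ I → f.rTensor B x ∈ I := by
    intro f x hx
    obtain ⟨r, rfl⟩ := mulLeftRight_surjective K A f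
    induction r using TensorProduct.induction_on with
    | zero => simp
    | add r s hr hs =>
      rw [map_add, LinearMap.rTensor_add]
      exact I.add_mem hr hs
    | tmul a b =>
      have h : ∀ y, (AlgHom.mulLeftRight K A (a ⊗ₜ b)).rTensor B y
          = (a ⊗ₜ[K] (1 : B)) * y * (b.unop ⊗ₜ[K] (1 : B)) := by
        intro y
        induction y using TensorProduct.induction_on with
        | zero => simp
        | add y z hy hz => rw [map_add, mul_add, add_mul, hy, hz]
        | tmul c d => simp
      rw [h]
      exact I.mul_mem_right _ _ (I.mul_mem_left _ _ hx)
  let v := Module.finBasis K A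
  let φ (j) : A ⊗[K] B →ₗ[K] B := (TensorProduct.lid K B).toLinearMap ∘ₗ (v.coord j).rTensor B
  have hsum : ∀ y, y = ∑ j, v j ⊗ₜ[K] φ j y := by
    intro y
    induction y using TensorProduct.induction_on with
    | zero => simp
    | add y z hy hz =>
      simp only [map_add, TensorProduct.tmul_add, Finset.sum_add_distrib]
      rw [← hy, ← hz]
    | tmul c d =>
      simp only [φ, LinearMap.comp_apply, LinearMap.rTensor_tmul, LinearEquiv.coe_coe,
        TensorProduct.lid_tmul, ← TensorProduct.smul_tmul, ← TensorProduct.sum_tmul]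
      simp
  have hone : ∀ j y, ((v.coord j).smulRight (1 : A)).rTensor B y = 1 ⊗ₜ[K] φ j y := by
    intro j y
    induction y using TensorProduct.induction_on with
    | zero => simp
    | add y z hy hz => rw [map_add, map_add, hy, hz, TensorProduct.tmul_add]
    | tmul c d => simp [φ, TensorProduct.smul_tmul]
  obtain ⟨j, hj⟩ : ∃ j, φ j t ≠ 0 := by
    by_contra! h
    exact ht0 (by rw [hsum t]; simp [h])
  have hb : (1 : A) ⊗ₜ[K] φ j t ∈ I := by rw [← hone]; exact key _ _ ht
  let J : TwoSidedIdeal B := I.comap (Algebra.TensorProduct.includeRight : B →ₐ[K] A ⊗[K] B)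
  have hJ : (1 : B) ∈ J := IsSimpleRing.one_mem_of_ne_zero_mem J hj
    (by simpa [J, TwoSidedIdeal.mem_comap] using hb)
  have hI1 : (1 : A ⊗[K] B) ∈ I := by
    simpa [J, TwoSidedIdeal.mem_comap, Algebra.TensorProduct.one_def] using hJ
  exact eq_top_iff.2 fun x _ => by simpa using I.mul_mem_left x 1 hI1

theorem isCentral_tensorProduct (A B : Type u) [Ring A] [Nontrivial A] [Algebra K A] [Algebra.IsCentral K A]
    [Ring B] [Algebra K B] [Algebra.IsCentral K B] : Algebra.IsCentral K (A ⊗[K] B) := by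
  refine ⟨fun x hx => ?_⟩
  have h1 : x ∈ Subalgebra.centralizer K
      ((Algebra.TensorProduct.includeLeft : A →ₐ[K] A ⊗[K] B).range : Set (A ⊗[K] B)) :=
    fun y _ => (Subalgebra.mem_center_iff.1 hx y)
  rw [Subalgebra.centralizer_coe_range_includeLeft_eq_center_tensorProduct] at h1
  have h2 : ∀ y : Subalgebra.center K A ⊗[K] B, ∃ b : B,
      Algebra.TensorProduct.map (Subalgebra.center K A).val (AlgHom.id K B) y = 1 ⊗ₜ[K] b := by
    intro y
    induction y using TensorProduct.induction_on with
    | zero => exact ⟨0, by simp⟩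
    | add y z hy hz =>
      obtain ⟨b, hb⟩ := hy
      obtain ⟨c, hc⟩ := hz
      exact ⟨b + c, by rw [map_add, hb, hc, TensorProduct.tmul_add]⟩
    | tmul c d =>
      obtain ⟨k, hk⟩ := Algebra.mem_bot.1 (Algebra.IsCentral.out c.2)
      refine ⟨k • d, ?_⟩
      rw [← TensorProduct.smul_tmul, ← Algebra.algebraMap_eq_smul_one, hk]
      simp
  obtain ⟨y, rfl⟩ := h1
  obtain ⟨b, hb⟩ := h2 y
  have hinj : Function.Injective (Algebra.TensorProduct.includeRight : B →ₐ[K] A ⊗[K] B) :=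
    Algebra.TensorProduct.includeRight_injective (FaithfulSMul.algebraMap_injective K A)
  have hbc : b ∈ Subalgebra.center K B := Subalgebra.mem_center_iff.2 fun c => hinj (by
    have h := Subalgebra.mem_center_iff.1 hx (1 ⊗ₜ[K] c)
    simp only [AlgHom.toRingHom_eq_coe, RingHom.coe_coe, hb] at h
    simpa using h)
  obtain ⟨k, hk⟩ := Algebra.mem_bot.1 (Algebra.IsCentral.out hbc)
  refine Algebra.mem_bot.2 ⟨k, ?_⟩
  simp only [AlgHom.toRingHom_eq_coe, RingHom.coe_coe, hb, ← hk]
  rw [Algebra.TensorProduct.algebraMap_apply, Algebra.algebraMap_eq_smul_one,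
    Algebra.algebraMap_eq_smul_one, TensorProduct.smul_tmul]

end CentralSimple

namespace CSA

variable {K : Type u} [Field K]

/-- The tensor product over `K` of two central simple `K`-algebras. -/
noncomputable def tensor (A B : CSA.{u, u} K) : CSA.{u, u} K where
  toAlgCat := AlgCat.of K (A ⊗[K] B)
  isCentral := CentralSimple.isCentral_tensorProduct K A B
  isSimple := CentralSimple.isSimpleRing_tensorProduct K A B
  fin_dim := inferInstanceAs (FiniteDimensional K (A ⊗[K] B))

/-- The opposite of a central simple `K`-algebra. -/
def op (A : CSA.{u, u} K) : CSA.{u, u} K where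
  toAlgCat := AlgCat.of K Aᵐᵒᵖ
  isCentral := inferInstanceAs (Algebra.IsCentral K Aᵐᵒᵖ)
  isSimple := inferInstanceAs (IsSimpleRing Aᵐᵒᵖ)
  fin_dim := inferInstanceAs (FiniteDimensional K Aᵐᵒᵖ)

variable (K) in
/-- The field `K` as a central simple `K`-algebra. -/
def base : CSA.{u, u} K where
  toAlgCat := AlgCat.of K K
  isCentral := inferInstanceAs (Algebra.IsCentral K K)
  isSimple := inferInstanceAs (IsSimpleRing K)
  fin_dim := inferInstanceAs (FiniteDimensional K K)

theorem isBrauerEquivalent_of_algEquiv {A B : CSA.{u, u} K} (e : A ≃ₐ[K] B) :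
    IsBrauerEquivalent A B :=
  ⟨1, 1, one_ne_zero, one_ne_zero, ⟨e.mapMatrix⟩⟩

open Matrix in
theorem isBrauerEquivalent_tensor {A A' B B' : CSA.{u, u} K} (hA : IsBrauerEquivalent A A')
    (hB : IsBrauerEquivalent B B') : IsBrauerEquivalent (A.tensor B) (A'.tensor B') := by
  obtain ⟨n, m, hn, hm, ⟨e⟩⟩ := hA
  obtain ⟨p, q, hp, hq, ⟨f⟩⟩ := hB
  exact ⟨n * p, m * q, by simp_all, by simp_all,
    ⟨(reindexAlgEquiv K (A ⊗[K] B) finProdFinEquiv).symm.trans <|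
      (kroneckerTMulAlgEquiv (Fin n) (Fin p) K K A B).symm.trans <|
      (Algebra.TensorProduct.congr e f).trans <|
      (kroneckerTMulAlgEquiv (Fin m) (Fin q) K K A' B').trans <|
      reindexAlgEquiv K (A' ⊗[K] B') finProdFinEquiv⟩⟩

theorem isBrauerEquivalent_op {A B : CSA.{u, u} K} (h : IsBrauerEquivalent A B) :
    IsBrauerEquivalent A.op B.op := by
  obtain ⟨n, m, hn, hm, ⟨e⟩⟩ := h
  exact ⟨n, m, hn, hm, ⟨(AlgEquiv.mopMatrix (R := K) (α := A) (m := Fin n)).trans <|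
    (AlgEquiv.op e).trans (AlgEquiv.mopMatrix (R := K) (α := B) (m := Fin m)).symm⟩⟩

theorem op_tensor_self (A : CSA.{u, u} K) : IsBrauerEquivalent (A.op.tensor A) (base K) := by
  have hn : Module.finrank K A ≠ 0 := Module.finrank_pos.ne'
  exact ⟨1, 1 * Module.finrank K A, one_ne_zero, by simpa using hn,
    ⟨(AlgEquiv.mapMatrix <| (Algebra.TensorProduct.comm K Aᵐᵒᵖ A).trans <|
      (AlgEquiv.ofBijective (AlgHom.mulLeftRight K A) (CentralSimple.isAzumaya K A)).trans <|
      algEquivMatrix (Module.finBasis K A)).trans <|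
      (Matrix.compAlgEquiv _ _ _ _).trans <|
      Matrix.reindexAlgEquiv K K finProdFinEquiv⟩⟩

end CSA

/-- The Brauer group of `K`, with `[A] * [B] = [A ⊗ B]` and `[A]⁻¹ = [Aᵒᵖ]`. -/
noncomputable instance BrauerGroup.instCommGroup (K : Type u) [Field K] :
    CommGroup (BrauerGroup.{u, u} K) where
  mul := Quotient.map₂ CSA.tensor fun _ _ hA _ _ hB => CSA.isBrauerEquivalent_tensor hA hB
  one := ⟦CSA.base K⟧
  inv := Quotient.map CSA.op fun _ _ h => CSA.isBrauerEquivalent_op h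
  mul_assoc := by
    rintro ⟨A⟩ ⟨B⟩ ⟨C⟩
    exact Quotient.sound (CSA.isBrauerEquivalent_of_algEquiv
      (Algebra.TensorProduct.assoc K K K A B C))
  one_mul := by
    rintro ⟨A⟩
    exact Quotient.sound (CSA.isBrauerEquivalent_of_algEquiv (Algebra.TensorProduct.lid K A))
  mul_one := by
    rintro ⟨A⟩
    exact Quotient.sound (CSA.isBrauerEquivalent_of_algEquiv (Algebra.TensorProduct.rid K K A))
  mul_comm := by
    rintro ⟨A⟩ ⟨B⟩
    exact Quotient.sound (CSA.isBrauerEquivalent_of_algEquiv (Algebra.TensorProduct.comm K A B))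
  inv_mul_cancel := by
    rintro ⟨A⟩
    exact Quotient.sound (CSA.op_tensor_self A)

/-- `L` splits the `K`-algebra `A`. -/
def IsSplitBy (K L A : Type u) [Field K] [Field L] [Algebra K L] [Ring A] [Algebra K A] : Prop :=
  ∃ n : ℕ, Nonempty (L ⊗[K] A ≃ₐ[L] Matrix (Fin n) (Fin n) L)

/-- A unitary `K/F`-involution on a `K`-algebra `A`: a ring antiautomorphism `τ` of `A` with
`τ² = id` and `τ|_K ≠ id`, such that `F` is the field of elements of `K` fixed by `τ`. -/
structure IsUnitaryInvolution (F K : Type u) {A : Type u} [Field F] [Field K] [Algebra F K]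
    [Ring A] [Algebra K A] (τ : A → A) : Prop where
  map_add : ∀ a b, τ (a + b) = τ a + τ b
  map_mul : ∀ a b, τ (a * b) = τ b * τ a
  involutive : Function.Involutive τ
  nontrivial : ∃ c : K, τ (algebraMap K A c) ≠ algebraMap K A c
  fixed_iff : ∀ c : K, τ (algebraMap K A c) = algebraMap K A c ↔ c ∈ (algebraMap F K).range

section Split

variable {K L : Type u} [Field K] [Field L] [Algebra K L]

theorem IsSplitBy.tensor {A B : Type u} [Ring A] [Algebra K A] [Ring B] [Algebra K B]
    (hA : IsSplitBy K L A) (hB : IsSplitBy K L B) : IsSplitBy K L (A ⊗[K] B) := by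
  obtain ⟨n, ⟨e⟩⟩ := hA
  obtain ⟨m, ⟨f⟩⟩ := hB
  exact ⟨n * m, ⟨(Algebra.TensorProduct.congr (Algebra.TensorProduct.lid L L).symm
      (AlgEquiv.refl : A ⊗[K] B ≃ₐ[K] A ⊗[K] B)).trans <|
    (Algebra.TensorProduct.tensorTensorTensorComm K L K L L L A B).trans <|
    (Algebra.TensorProduct.congr e f).trans <|
    (Matrix.kroneckerAlgEquiv (Fin n) (Fin m) L).trans <|
    Matrix.reindexAlgEquiv L L finProdFinEquiv⟩⟩

theorem IsSplitBy.op {A : Type u} [Ring A] [Algebra K A] (hA : IsSplitBy K L A) :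
    IsSplitBy K L Aᵐᵒᵖ := by
  obtain ⟨n, ⟨e⟩⟩ := hA
  exact ⟨n, ⟨(Algebra.TensorProduct.congr (AlgEquiv.toOpposite L L) AlgEquiv.refl).trans <|
    (Algebra.TensorProduct.opAlgEquiv K L L A).trans <|
    (AlgEquiv.op e).trans (Matrix.transposeAlgEquiv (Fin n) L L).symm⟩⟩

theorem IsSplitBy.base : IsSplitBy K L K :=
  ⟨1, ⟨(Algebra.TensorProduct.rid K L L).trans <| (AlgEquiv.toOpposite L L).trans <|
    (AlgEquiv.moduleEndSelf L).trans <| algEquivMatrix (Module.Basis.singleton (Fin 1) L)⟩⟩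

end Split

section Unitary

variable {F K : Type u} [Field F] [Field K] [Algebra F K]

theorem IsUnitaryInvolution.exists_conj (F K : Type u) [Field F] [Field K] [Algebra F K]
    [Algebra.IsQuadraticExtension F K] [IsGalois F K] :
    ∃ s : K ≃ₐ[F] K, s ≠ 1 ∧ ∀ t : K ≃ₐ[F] K, t ≠ 1 → t = s := by
  have hc : Nat.card (K ≃ₐ[F] K) = 2 := by
    rw [IsGalois.card_aut_eq_finrank, Algebra.IsQuadraticExtension.finrank_eq_two]
  obtain ⟨s, h1, h2⟩ := (Nat.card_eq_two_iff' (1 : K ≃ₐ[F] K)).1 hc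
  exact ⟨s, h1, h2⟩

theorem IsUnitaryInvolution.conj_fixed [Algebra.IsQuadraticExtension F K] [IsGalois F K] {s : K ≃ₐ[F] K}
    (hs : ∀ t : K ≃ₐ[F] K, t ≠ 1 → t = s) (c : K) : s c = c ↔ c ∈ (algebraMap F K).range := by
  constructor
  · intro h
    refine (IsGalois.mem_range_algebraMap_iff_fixed c).2 fun t => ?_
    by_cases ht : t = 1
    · simp [ht]
    · rw [hs t ht, h]
  · rintro ⟨a, rfl⟩
    exact s.commutes a

theorem IsUnitaryInvolution.apply_algebraMap [Algebra.IsQuadraticExtension F K]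
    {A : Type u} [Ring A] [Nontrivial A] [Algebra K A] [Algebra.IsCentral K A] {τ : A → A}
    (h : IsUnitaryInvolution F K τ) {s : K ≃ₐ[F] K} (hs : ∀ t : K ≃ₐ[F] K, t ≠ 1 → t = s)
    (c : K) : τ (algebraMap K A c) = algebraMap K A (s c) := by
  have : FiniteDimensional F K := inferInstance
  have hinj : Function.Injective (algebraMap K A) := FaithfulSMul.algebraMap_injective K A
  have hc : ∀ c : K, ∃ d : K, algebraMap K A d = τ (algebraMap K A c) := by
    intro c
    have : τ (algebraMap K A c) ∈ Subalgebra.center K A := Subalgebra.mem_center_iff.2 fun b => by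
      rw [← h.involutive b, ← h.map_mul, ← h.map_mul, Algebra.commutes]
    obtain ⟨d, hd⟩ := Algebra.mem_bot.1 (Algebra.IsCentral.out this)
    exact ⟨d, hd⟩
  choose g hg using hc
  have hF : ∀ a : F, g (algebraMap F K a) = algebraMap F K a := fun a => hinj (by
    rw [hg]
    exact (h.fixed_iff _).2 ⟨a, rfl⟩)
  have hmul : ∀ a b, g (a * b) = g a * g b := fun a b => hinj (by
    rw [hg, _root_.map_mul, h.map_mul, ← hg, ← hg, ← _root_.map_mul, mul_comm])
  have hadd : ∀ a b, g (a + b) = g a + g b := fun a b => hinj (by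
    rw [hg, _root_.map_add, h.map_add, _root_.map_add, hg, hg])
  let φ : K →ₐ[F] K :=
    { toFun := g
      map_one' := by simpa using hF 1
      map_mul' := hmul
      map_zero' := by simpa using hF 0
      map_add' := hadd
      commutes' := hF }
  let t : K ≃ₐ[F] K := AlgEquiv.ofBijective φ φ.bijective
  have ht : t ≠ 1 := by
    intro ht
    obtain ⟨c, hc⟩ := h.nontrivial
    refine hc ?_
    rw [← hg]
    exact congrArg _ (DFunLike.congr_fun ht c)
  rw [← hs t ht, ← hg]
  rfl

theorem IsUnitaryInvolution.tensor [Algebra.IsQuadraticExtension F K] [IsGalois F K]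
    {A B : Type u} [Ring A] [Nontrivial A] [Algebra K A] [Algebra.IsCentral K A]
    [Ring B] [Nontrivial B] [Algebra K B] [Algebra.IsCentral K B]
    {τ : A → A} {υ : B → B} (h : IsUnitaryInvolution F K τ) (h' : IsUnitaryInvolution F K υ) :
    ∃ ω : A ⊗[K] B → A ⊗[K] B, IsUnitaryInvolution F K ω := by
  obtain ⟨s, hs1, hs⟩ := IsUnitaryInvolution.exists_conj F K
  have hτ := h.apply_algebraMap hs
  have hυ := h'.apply_algebraMap hs
  let f : A →+ B →+ A ⊗[K] B := AddMonoidHom.mk' (fun a => AddMonoidHom.mk'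
    (fun b => τ a ⊗ₜ[K] υ b) (fun b c => by rw [h'.map_add, TensorProduct.tmul_add]))
    (fun a b => by
      ext c
      simp [h.map_add, TensorProduct.add_tmul])
  let ω : A ⊗[K] B →+ A ⊗[K] B := TensorProduct.liftAddHom f (fun r a b => by
    simp only [f, AddMonoidHom.mk'_apply, Algebra.smul_def, h.map_mul, h'.map_mul, hτ, hυ]
    rw [← Algebra.commutes, ← Algebra.commutes, ← Algebra.smul_def, ← Algebra.smul_def,
      TensorProduct.smul_tmul])
  have hω : ∀ a b, ω (a ⊗ₜ b) = τ a ⊗ₜ υ b := fun a b => rfl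
  have hone : υ 1 = 1 := by simpa using hυ 1
  have hωK : ∀ c : K, ω (algebraMap K (A ⊗[K] B) c) = algebraMap K (A ⊗[K] B) (s c) := fun c => by
    rw [Algebra.TensorProduct.algebraMap_apply, Algebra.TensorProduct.algebraMap_apply, hω, hτ,
      hone]
  have hinj : Function.Injective (algebraMap K (A ⊗[K] B)) :=
    FaithfulSMul.algebraMap_injective K _
  refine ⟨ω, _root_.map_add ω, fun x y => ?_, fun x => ?_, ?_, fun c => ?_⟩
  · induction x using TensorProduct.induction_on with
    | zero => simp
    | add x z hx hz => simp only [add_mul, mul_add, _root_.map_add, hx, hz]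
    | tmul a b =>
      induction y using TensorProduct.induction_on with
      | zero => simp
      | add x z hx hz => simp only [add_mul, mul_add, _root_.map_add, hx, hz]
      | tmul c d =>
        simp only [Algebra.TensorProduct.tmul_mul_tmul, hω, h.map_mul, h'.map_mul]
  · induction x using TensorProduct.induction_on with
    | zero => simp
    | add x z hx hz => simp only [_root_.map_add, hx, hz]
    | tmul a b => rw [hω, hω, h.involutive, h'.involutive]
  · by_contra! hcon
    refine hs1 (AlgEquiv.ext fun c => hinj ?_)
    rw [← hωK, hcon]
    rfl
  · rw [hωK, hinj.eq_iff, IsUnitaryInvolution.conj_fixed hs]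

theorem IsUnitaryInvolution.op {A : Type u} [Ring A] [Algebra K A] {τ : A → A}
    (h : IsUnitaryInvolution F K τ) :
    IsUnitaryInvolution F K fun a : Aᵐᵒᵖ => MulOpposite.op (τ a.unop) where
  map_add a b := by simp [h.map_add]
  map_mul a b := by simp [h.map_mul]
  involutive a := by simp [h.involutive a.unop]
  nontrivial := by
    obtain ⟨c, hc⟩ := h.nontrivial
    exact ⟨c, by simpa using hc⟩
  fixed_iff c := by simpa using h.fixed_iff c

theorem IsUnitaryInvolution.base [Algebra.IsQuadraticExtension F K] [IsGalois F K] :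
    ∃ τ : K → K, IsUnitaryInvolution F K τ := by
  obtain ⟨s, hs1, hs⟩ := IsUnitaryInvolution.exists_conj F K
  refine ⟨s, _root_.map_add s, fun a b => by rw [_root_.map_mul, mul_comm], fun a => ?_, ?_, IsUnitaryInvolution.conj_fixed hs⟩
  · by_cases h : s * s = 1
    · exact DFunLike.congr_fun h a
    · exact absurd (hs _ h) (by simpa using hs1)
  · by_contra! hcon
    exact hs1 (AlgEquiv.ext hcon)

end Unitary

/-- `Br(M/K; F)`: the group of Brauer classes `[A]` of central simple `K`-algebras `A` that are
split by `M` and have a unitary `K/F`-involution. -/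
noncomputable def unitaryRelBrauer (F K M : Type u) [Field F] [Field K] [Field M] [Algebra F K]
    [Algebra K M] [Algebra.IsQuadraticExtension F K] [IsGalois F K] :
    Subgroup (BrauerGroup.{u, u} K) where
  carrier := {x | ∃ A : CSA.{u, u} K, (⟦A⟧ : BrauerGroup.{u, u} K) = x ∧ IsSplitBy K M A ∧
    ∃ τ : A → A, IsUnitaryInvolution F K τ}
  mul_mem' := by
    rintro _ _ ⟨A, rfl, hA, τ, hτ⟩ ⟨B, rfl, hB, υ, hυ⟩
    exact ⟨A.tensor B, rfl, hA.tensor hB, hτ.tensor hυ⟩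
  one_mem' := ⟨CSA.base K, rfl, IsSplitBy.base (K := K), IsUnitaryInvolution.base (K := K)⟩
  inv_mem' := by
    rintro _ ⟨A, rfl, hA, τ, hτ⟩
    exact ⟨A.op, rfl, hA.op, _, hτ.op⟩

/-- A group `G` is generalized dihedral with respect to a subgroup `H`. -/
def IsGeneralizedDihedral {G : Type u} [Group G] (H : Subgroup G) : Prop :=
  H.index = 2 ∧ ∃ θ : G, θ ∉ H ∧ θ ^ 2 = 1 ∧ ∀ h ∈ H, θ * h * θ⁻¹ = h⁻¹

section Tower

variable (F K M : Type u) [Field F] [Field K] [Field M] [Algebra F K] [Algebra K M] [Algebra F M]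
  [IsScalarTower F K M]

/-- `Gal(M/K)` as a subgroup of `Gal(M/F)`. -/
def galSubgroup : Subgroup (M ≃ₐ[F] M) :=
  (AlgEquiv.restrictScalarsHom F : (M ≃ₐ[K] M) →* (M ≃ₐ[F] M)).range

/-- `M` is `K/F`-generalized dihedral: `M/F` is finite Galois and `Gal(M/F)` is generalized
dihedral with respect to `Gal(M/K)`. -/
structure IsGeneralizedDihedralExtension : Prop where
  finiteDimensional : FiniteDimensional F M
  isGalois : IsGalois F M
  isGeneralizedDihedral : IsGeneralizedDihedral (galSubgroup F K M)

/-- `ker(Ñ)`, the group of all `m` in `Mˣ` with `N_{M/K}(m)` in `Fˣ`. -/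
noncomputable def kerNormTilde : Subgroup Mˣ :=
  (Units.map (algebraMap F K : F →* K)).range.comap (Units.map (Algebra.norm K : M →* K))

variable {F M} in
/-- The group of elements of `Mˣ` fixed by the automorphism `g`. -/
def fixedUnits (g : M ≃ₐ[F] M) : Subgroup Mˣ where
  carrier := {m | g (m : M) = m}
  mul_mem' {a b} ha hb := by
    change g (a * b : Mˣ) = (a * b : Mˣ)
    rw [Units.val_mul, map_mul, show g a = a from ha, show g b = b from hb]
  one_mem' := by simp
  inv_mem' {a} ha := by
    change g (a⁻¹ : Mˣ) = (a⁻¹ : Mˣ)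
    rw [Units.val_inv_eq_inv_val, map_inv₀, show g a = a from ha]

variable {F M} in
/-- `Π`, the product of the groups of units fixed by `hθ`, over all `h` in `Gal(M/K)`. -/
def fixedProduct (θ : M ≃ₐ[F] M) : Subgroup Mˣ :=
  ⨆ h : M ≃ₐ[K] M, fixedUnits (h.restrictScalars F * θ)

end Tower

/-- The `K`-algebra `A` is the cyclic algebra `(L/K, s, b)`: it has dimension `[L:K]²`, and it
contains `L` and a unit `z` with `z c z⁻¹ = s c` for `c` in `L` and `z ^ [L:K] = b`. -/
def IsCyclicAlgebra (K L : Type u) [Field K] [Field L] [Algebra K L] (s : L ≃ₐ[K] L) (b : K)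
    (A : Type u) [Ring A] [Algebra K A] : Prop :=
  Module.finrank K A = Module.finrank K L ^ 2 ∧
    ∃ (i : L →ₐ[K] A) (z : Aˣ), (∀ c : L, (z : A) * i c = i (s c) * z) ∧
      (z : A) ^ Module.finrank K L = algebraMap K A b

section Bicyclic

variable {F K M : Type u} [Field F] [Field K] [Field M] [Algebra F K] [Algebra K M] [Algebra F M]

/-- The classes `[(L₁/K, σ, b₁) ⊗ (L₂/K, ρ, b₂)]` with `b₁`, `b₂` in `Fˣ`. -/
def decSet (F : Type u) [Field F] [Algebra F K] (L₁ L₂ : IntermediateField K M) [Normal K L₁]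
    [Normal K L₂] (σ ρ : M ≃ₐ[K] M) : Set (BrauerGroup.{u, u} K) :=
  {x | ∃ (b₁ b₂ : Fˣ) (A₁ A₂ : CSA.{u, u} K),
    IsCyclicAlgebra K L₁ (σ.restrictNormal L₁) (algebraMap F K b₁) A₁ ∧
    IsCyclicAlgebra K L₂ (ρ.restrictNormal L₂) (algebraMap F K b₂) A₂ ∧
    x = ⟦A₁.tensor A₂⟧}

/-- `Dec(M/K; F)`, as the group generated by the classes in `decSet`. -/
noncomputable def unitaryDec (F : Type u) [Field F] [Algebra F K] (L₁ L₂ : IntermediateField K M) [Normal K L₁]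
    [Normal K L₂] (σ ρ : M ≃ₐ[K] M) : Subgroup (BrauerGroup.{u, u} K) :=
  Subgroup.closure (decSet F L₁ L₂ σ ρ)

/-- The `K`-algebra `A` is the abelian crossed product `A(u, b₁, b₂)`: it has dimension `[M:K]²`,
and it contains `M` and units `x`, `y` that induce `σ`, `ρ` on `M` by conjugation, with
`x ^ n = b₁`, `y ^ ℓ = b₂` and `x y x⁻¹ y⁻¹ = u`, where `n`, `ℓ` are the orders of `σ`, `ρ`. -/
def IsAbelianCrossedProduct (σ ρ : M ≃ₐ[K] M) (u b₁ b₂ : Mˣ) (A : Type u) [Ring A]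
    [Algebra K A] : Prop :=
  Module.finrank K A = Module.finrank K M ^ 2 ∧
    ∃ (i : M →ₐ[K] A) (x y : Aˣ),
      (∀ c : M, (x : A) * i c = i (σ c) * x) ∧ (∀ c : M, (y : A) * i c = i (ρ c) * y) ∧
      (x : A) ^ orderOf σ = i b₁ ∧ (y : A) ^ orderOf ρ = i b₂ ∧
      ((x * y * x⁻¹ * y⁻¹ : Aˣ) : A) = i u

/-- The conditions on `u, b₁, b₂` under which `A(u, b₁, b₂)` exists and has a unitary
`K/F`-involution that extends `θ` and fixes the standard generators `x`, `y`. -/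
structure IsUnitaryData (L₁ L₂ : IntermediateField K M) (σ ρ : M ≃ₐ[K] M) (θ : M ≃ₐ[F] M)
    (u b₁ b₂ : Mˣ) : Prop where
  mem₁ : (b₁ : M) ∈ L₂
  mem₂ : (b₂ : M) ∈ L₁
  norm₁ : algebraMap L₂ M (Algebra.norm L₂ (u : M)) = b₁ / ρ b₁
  norm₂ : algebraMap L₁ M (Algebra.norm L₁ (u : M)) = σ b₂ / b₂
  fixed₁ : θ b₁ = b₁
  fixed₂ : θ b₂ = b₂
  mul_eq_one : (u : M) * ρ (σ (θ u)) = 1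

end Bicyclic

/-! The admissible triples $(u,b_1,b_2)$ form a group under componentwise multiplication
(`unitaryCocycles`), and this group is compared with both sides.

On the Brauer side, $(u,b_1,b_2)\mapsto[A(u,b_1,b_2)]$ is a homomorphism
(`IsBicyclicGal.mk_mul_mk`). Its image lies in $\operatorname{Br}(M/K;F)$, since $\theta$ on $M$
with $x\mapsto x$, $y\mapsto y$ extends to a unitary involution
(`UnitaryCocycle.exists_isUnitaryInvolution`). It is all of that group: if $M$ splits $A$ and $\tau$
is a unitary involution, then $A$ acts on some $V=M^k$, $\tau$ is adjoint to a $\theta$-hermitian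
form on $V$, and the $\sigma$- and $\rho$-semilinear operators $X,Y$ that commute with $A$ can be
scaled to be self-adjoint. Then $X^n$, $Y^\ell$, $XYX^{-1}Y^{-1}$ are scalars forming an admissible
triple, and its algebra centralizes $A$ in $\operatorname{End}_K(V)$, so it has class $[A]^{-1}$
(`IsDihedralGal.exists_unitaryCocycle`). Triples with $u=1$ have $b_1,b_2\in F$ and give exactly
$\operatorname{Dec}$, so modulo $\operatorname{Dec}$ the class depends only on $u$.

On the field side, $u\cdot\rho\sigma\theta(u)=1$ and Hilbert 90 for the involution
$\rho\sigma\theta$ give $u=q/\rho\sigma\theta(q)$. The other conditions force $N_{M/K}(u)=1$, which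
says $q\in\ker(\widetilde N)$; conversely, if $N_{M/K}(u)=1$, then Hilbert 90 over $L_1$ and $L_2$
supplies $b_1,b_2$. So $q$ determines a class modulo $\operatorname{Dec}$, and $\ker(\widetilde
N)\to\operatorname{Br}/\operatorname{Dec}$ is onto; $\Phi$ is the inverse of the induced
isomorphism.

The kernel is $\Pi$. If $g\theta(q)=q$ with $g\in H$, then $u=q/\sigma^a\rho^b(q)$ for suitable
$a,b$, and a telescoping change of $x,y$ makes $u=1$ (`exists_rescale_one`). Conversely, a split
$A(u,b_1,b_2)$ acts on a one-dimensional $M$-space, which yields $u=d\rho(c)/(c\sigma(d))$ with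
$\theta$-invariant partial norms of $c$ and $d$; repeated use of Hilbert 90 turns these into some
$p\in\Pi$ with $u=p/\rho\sigma\theta(p)$, and $q/p$ is fixed by $\rho\sigma\theta$
(`mem_fixedProduct_of_mk_eq_one`). -/

/-! ### The bicyclic relations: spanning, independence and universal property of the monomials. -/

section Relations

variable {K M R R' : Type*} [Field K] [Field M] [Algebra K M] [Ring R] [Ring R']

/-- The relations satisfied by the standard generators of an abelian crossed product with
parameters `(u, b₁, b₂)`, in an arbitrary ring `R` that receives `M`. -/
structure BicyclicRelations (σ ρ : M ≃ₐ[K] M) (u b₁ b₂ : Mˣ) (i : M →+* R) (x y : R) :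
    Prop where
  x_mul : ∀ c, x * i c = i (σ c) * x
  y_mul : ∀ c, y * i c = i (ρ c) * y
  x_pow : x ^ orderOf σ = i b₁
  y_pow : y ^ orderOf ρ = i b₂
  x_mul_y : x * y = i u * (y * x)

/-- The sum `∑ i (c (a, b)) x ^ a y ^ b`. -/
noncomputable def bicyclicSum (σ ρ : M ≃ₐ[K] M) (i : M →+* R) (x y : R) :
    (Fin (orderOf σ) × Fin (orderOf ρ) → M) →+ R where
  toFun c := ∑ p, i (c p) * (x ^ (p.1 : ℕ) * y ^ (p.2 : ℕ))
  map_zero' := by simp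
  map_add' c d := by simp [add_mul, Finset.sum_add_distrib]

theorem bicyclicSum_apply (σ ρ : M ≃ₐ[K] M) (i : M →+* R) (x y : R)
    (c : Fin (orderOf σ) × Fin (orderOf ρ) → M) :
    bicyclicSum σ ρ i x y c = ∑ p, i (c p) * (x ^ (p.1 : ℕ) * y ^ (p.2 : ℕ)) := rfl

theorem pow_mul_of_semiconj {σ : M ≃ₐ[K] M} {i : M →+* R} {x : R}
    (h : ∀ c, x * i c = i (σ c) * x) (k : ℕ) (c : M) :
    x ^ k * i c = i ((σ ^ k) c) * x ^ k := by
  induction k generalizing c with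
  | zero => simp
  | succ k ih => rw [pow_succ, mul_assoc, h, ← mul_assoc, ih, pow_succ, mul_assoc]; rfl

theorem mul_mem_range_bicyclicSum {σ ρ : M ≃ₐ[K] M} {i : M →+* R} {x y r : R}
    (hr : ∀ (c : M) (k l : ℕ), r * (i c * (x ^ k * y ^ l)) ∈ (bicyclicSum σ ρ i x y).range)
    {t : R} (ht : t ∈ (bicyclicSum σ ρ i x y).range) :
    r * t ∈ (bicyclicSum σ ρ i x y).range := by
  obtain ⟨c, rfl⟩ := ht
  rw [bicyclicSum_apply, Finset.mul_sum]
  exact AddSubgroup.sum_mem _ fun p _ => hr _ _ _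

theorem ringHom_ext_of_bicyclicSum_surjective {σ ρ : M ≃ₐ[K] M} {i : M →+* R} {x y : R}
    (hs : Function.Surjective (bicyclicSum σ ρ i x y)) {f g : R →+* R'}
    (hi : ∀ c, f (i c) = g (i c)) (hx : f x = g x) (hy : f y = g y) : f = g := by
  ext r
  obtain ⟨c, rfl⟩ := hs r
  simp [bicyclicSum_apply, hi, hx, hy]

namespace BicyclicRelations

variable {σ ρ : M ≃ₐ[K] M} {u b₁ b₂ : Mˣ} {i : M →+* R} {x y : R}
  {i' : M →+* R'} {x' y' : R'}

theorem map (h : BicyclicRelations σ ρ u b₁ b₂ i x y) (f : R →+* R') :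
    BicyclicRelations σ ρ u b₁ b₂ (f.comp i) (f x) (f y) where
  x_mul c := by simp [← map_mul, h.x_mul]
  y_mul c := by simp [← map_mul, h.y_mul]
  x_pow := by simp [← map_pow, h.x_pow]
  y_pow := by simp [← map_pow, h.y_pow]
  x_mul_y := by simp [← map_mul, h.x_mul_y]

/-- Prepares the graph argument of `exists_lift`: the subring generated by the paired generators is
the graph of the desired map. -/
theorem prod (h : BicyclicRelations σ ρ u b₁ b₂ i x y)
    (h' : BicyclicRelations σ ρ u b₁ b₂ i' x' y') :
    BicyclicRelations σ ρ u b₁ b₂ (i.prod i') (x, x') (y, y') where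
  x_mul c := Prod.ext (h.x_mul c) (h'.x_mul c)
  y_mul c := Prod.ext (h.y_mul c) (h'.y_mul c)
  x_pow := Prod.ext h.x_pow h'.x_pow
  y_pow := Prod.ext h.y_pow h'.y_pow
  x_mul_y := Prod.ext h.x_mul_y h'.x_mul_y

theorem isUnit_x [FiniteDimensional K M] (h : BicyclicRelations σ ρ u b₁ b₂ i x y) :
    IsUnit x := by
  have : IsUnit (x ^ orderOf σ) := h.x_pow ▸ b₁.isUnit.map i
  exact (isUnit_pow_iff (orderOf_pos σ).ne').1 this

theorem isUnit_y [FiniteDimensional K M] (h : BicyclicRelations σ ρ u b₁ b₂ i x y) :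
    IsUnit y := by
  have : IsUnit (y ^ orderOf ρ) := h.y_pow ▸ b₂.isUnit.map i
  exact (isUnit_pow_iff (orderOf_pos ρ).ne').1 this

/-- For closure of the span it matters only that reordering costs some factor from $M$, not which
one. -/
theorem y_mul_x_pow (h : BicyclicRelations σ ρ u b₁ b₂ i x y) (k : ℕ) :
    ∃ w : M, y * x ^ k = i w * (x ^ k * y) := by
  induction k with
  | zero => exact ⟨1, by simp⟩
  | succ k ih =>
    obtain ⟨w, hw⟩ := ih
    have h1 : y * x = i (u⁻¹ : Mˣ) * (x * y) := by
      rw [h.x_mul_y, ← mul_assoc, ← map_mul]; simp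
    refine ⟨w * (σ ^ k) (u⁻¹ : Mˣ), ?_⟩
    rw [pow_succ, ← mul_assoc, hw, mul_assoc, mul_assoc, h1, ← mul_assoc (x ^ k),
      pow_mul_of_semiconj h.x_mul, map_mul]
    simp only [mul_assoc]

variable [FiniteDimensional K M]

/-- Exponents are reduced modulo the orders; the surplus powers become powers of $b_1$ and $b_2$,
which are moved to the left. -/
theorem mul_mem_range (h : BicyclicRelations σ ρ u b₁ b₂ i x y) (c : M) (k l : ℕ) :
    i c * (x ^ k * y ^ l) ∈ (bicyclicSum σ ρ i x y).range := by
  have hx : x ^ k = i ((b₁ : M) ^ (k / orderOf σ)) * x ^ (k % orderOf σ) := by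
    rw [map_pow, ← h.x_pow, ← pow_mul, ← pow_add, Nat.div_add_mod]
  have hy : y ^ l = i ((b₂ : M) ^ (l / orderOf ρ)) * y ^ (l % orderOf ρ) := by
    rw [map_pow, ← h.y_pow, ← pow_mul, ← pow_add, Nat.div_add_mod]
  let p : Fin (orderOf σ) × Fin (orderOf ρ) :=
    (⟨k % orderOf σ, Nat.mod_lt _ (orderOf_pos σ)⟩, ⟨l % orderOf ρ, Nat.mod_lt _ (orderOf_pos ρ)⟩)
  refine ⟨Pi.single p (c * b₁ ^ (k / orderOf σ) *
    (σ ^ (k % orderOf σ)) ((b₂ : M) ^ (l / orderOf ρ))), ?_⟩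
  rw [bicyclicSum_apply, Finset.sum_eq_single p]
  · rw [hx, hy, Pi.single_eq_same, map_mul, map_mul]
    simp only [mul_assoc, p]
    rw [← mul_assoc (x ^ _), pow_mul_of_semiconj h.x_mul]
    simp only [mul_assoc]
  · intro q _ hq
    rw [Pi.single_eq_of_ne hq, map_zero, zero_mul]
  · simp

/-- The span of the `x ^ a y ^ b` as a subring. -/
noncomputable def subring (h : BicyclicRelations σ ρ u b₁ b₂ i x y) : Subring R where
  __ := (bicyclicSum σ ρ i x y).range
  one_mem' := by simpa using h.mul_mem_range 1 0 0
  mul_mem' := by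
    rintro a b ⟨c, rfl⟩ hb
    -- Closure under products reduces to stability under left multiplication by $M$, $x$ and $y$.
    have hi : ∀ c, ∀ t ∈ (bicyclicSum σ ρ i x y).range,
        i c * t ∈ (bicyclicSum σ ρ i x y).range := fun c t ht =>
      mul_mem_range_bicyclicSum (fun d k l => by
        rw [← mul_assoc, ← map_mul]; exact h.mul_mem_range _ _ _) ht
    have hx : ∀ t ∈ (bicyclicSum σ ρ i x y).range,
        x * t ∈ (bicyclicSum σ ρ i x y).range := fun t ht =>
      mul_mem_range_bicyclicSum (fun d k l => by
        rw [← mul_assoc, h.x_mul, mul_assoc, ← mul_assoc x, ← pow_succ']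
        exact h.mul_mem_range _ _ _) ht
    have hy : ∀ t ∈ (bicyclicSum σ ρ i x y).range,
        y * t ∈ (bicyclicSum σ ρ i x y).range := fun t ht =>
      mul_mem_range_bicyclicSum (fun d k l => by
        obtain ⟨w, hw⟩ := h.y_mul_x_pow k
        rw [← mul_assoc, h.y_mul, mul_assoc, ← mul_assoc y, hw, mul_assoc, mul_assoc, ← pow_succ',
          ← mul_assoc, ← map_mul]
        exact h.mul_mem_range _ _ _) ht
    have hpow : ∀ z : R, (∀ t ∈ (bicyclicSum σ ρ i x y).range,
        z * t ∈ (bicyclicSum σ ρ i x y).range) → ∀ (k : ℕ), ∀ t ∈ (bicyclicSum σ ρ i x y).range,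
        z ^ k * t ∈ (bicyclicSum σ ρ i x y).range := by
      intro z hz k
      induction k with
      | zero => simp
      | succ k ih => exact fun t ht => by rw [pow_succ, mul_assoc]; exact ih _ (hz t ht)
    change bicyclicSum σ ρ i x y c * b ∈ (bicyclicSum σ ρ i x y).range
    rw [bicyclicSum_apply, Finset.sum_mul]
    refine AddSubgroup.sum_mem _ fun p _ => ?_
    rw [mul_assoc, mul_assoc]
    exact hi _ _ (hpow x hx _ _ (hpow y hy _ _ hb))

theorem apply_mem_subring (h : BicyclicRelations σ ρ u b₁ b₂ i x y) (c : M) :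
    i c ∈ h.subring := by simpa using show _ ∈ h.subring from h.mul_mem_range c 0 0

theorem x_mem_subring (h : BicyclicRelations σ ρ u b₁ b₂ i x y) : x ∈ h.subring := by
  simpa using show _ ∈ h.subring from h.mul_mem_range 1 1 0

theorem y_mem_subring (h : BicyclicRelations σ ρ u b₁ b₂ i x y) : y ∈ h.subring := by
  simpa using show _ ∈ h.subring from h.mul_mem_range 1 0 1

end BicyclicRelations

/-- The automorphisms `σ ^ a ρ ^ b`, with `a < orderOf σ` and `b < orderOf ρ`, are distinct. -/
def IndependentAuts (σ ρ : M ≃ₐ[K] M) : Prop :=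
  Function.Injective fun p : Fin (orderOf σ) × Fin (orderOf ρ) => σ ^ (p.1 : ℕ) * ρ ^ (p.2 : ℕ)

namespace BicyclicRelations

variable {σ ρ : M ≃ₐ[K] M} {u b₁ b₂ : Mˣ} {i : M →+* R} {x y : R}
  {i' : M →+* R'} {x' y' : R'} [FiniteDimensional K M] [Algebra.IsSeparable K M]

/-- For a primitive element $\alpha$ of $M/K$, each $x^ay^b$ is an eigenvector of right
multiplication by $\alpha$ on the left $M$-space $R$, with eigenvalue $\sigma^a\rho^b(\alpha)$.
These eigenvalues are distinct. -/
theorem bicyclicSum_injective [Nontrivial R] (h : BicyclicRelations σ ρ u b₁ b₂ i x y)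
    (hσρ : IndependentAuts σ ρ) : Function.Injective (bicyclicSum σ ρ i x y) := by
  let pb := Field.powerBasisOfFiniteOfSeparable K M
  let α := pb.gen
  have hα' : ∀ g g' : M ≃ₐ[K] M, g α = g' α → g = g' := fun g g' hg =>
    AlgEquiv.ext fun z => DFunLike.congr_fun
      (pb.algHom_ext (f := (g : M →ₐ[K] M)) (g := (g' : M →ₐ[K] M)) hg) z
  let _ : Module M R := Module.compHom R i
  have hsmul : ∀ (m : M) (r : R), m • r = i m * r := fun _ _ => rfl
  let T : Module.End M R :=
    { toFun r := r * i α
      map_add' := fun _ _ => add_mul _ _ _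
      map_smul' := fun m r => by simp [hsmul, mul_assoc] }
  have hli := T.eigenvectors_linearIndependent'
    (fun p : Fin (orderOf σ) × Fin (orderOf ρ) => (σ ^ (p.1 : ℕ) * ρ ^ (p.2 : ℕ)) α)
    (fun p q hpq => hσρ (hα' _ _ hpq)) (fun p => x ^ (p.1 : ℕ) * y ^ (p.2 : ℕ)) (fun p => by
      refine ⟨Module.End.mem_eigenspace_iff.2 ?_,
        ((h.isUnit_x.pow _).mul (h.isUnit_y.pow _)).ne_zero⟩
      change _ * i α = i _ * _
      rw [mul_assoc, pow_mul_of_semiconj h.y_mul, ← mul_assoc, pow_mul_of_semiconj h.x_mul,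
        mul_assoc]
      rfl)
  rw [injective_iff_map_eq_zero]
  intro c hc
  exact funext (Fintype.linearIndependent_iff.1 hli c hc)

/-- The span of the paired monomials in $R\times R'$ is a subring. It projects bijectively to $R$,
by independence and spanning there; inverting this and projecting to $R'$ gives the map. -/
theorem exists_lift [Nontrivial R] (h : BicyclicRelations σ ρ u b₁ b₂ i x y)
    (h' : BicyclicRelations σ ρ u b₁ b₂ i' x' y') (hσρ : IndependentAuts σ ρ)
    (hs : Function.Surjective (bicyclicSum σ ρ i x y)) :
    ∃ f : R →+* R', (∀ c, f (i c) = i' c) ∧ f x = x' ∧ f y = y' := by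
  have hp := h.prod h'
  let π : hp.subring →+* R := (RingHom.fst R R').comp hp.subring.subtype
  have hfst : ∀ c, (bicyclicSum σ ρ (i.prod i') (x, x') (y, y') c).1 = bicyclicSum σ ρ i x y c := by
    intro c
    simp [bicyclicSum_apply, Prod.fst_sum]
  have hπ : Function.Bijective π := by
    constructor
    · rintro ⟨_, c, rfl⟩ ⟨_, d, rfl⟩ hcd
      have : bicyclicSum σ ρ i x y c = bicyclicSum σ ρ i x y d := by
        rw [← hfst, ← hfst]; exact hcd
      rw [h.bicyclicSum_injective hσρ this]
    · intro r
      obtain ⟨c, rfl⟩ := hs r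
      exact ⟨⟨_, c, rfl⟩, hfst c⟩
  let e := RingEquiv.ofBijective π hπ
  have key : ∀ (s : R × R') (hs : s ∈ hp.subring), (e.symm s.1 : R × R') = s := by
    intro s hs
    have : e.symm s.1 = ⟨s, hs⟩ := e.symm_apply_eq.2 rfl
    rw [this]
  refine ⟨(RingHom.snd R R').comp (hp.subring.subtype.comp e.symm.toRingHom), fun c => ?_, ?_, ?_⟩
  · exact congrArg Prod.snd (key _ (hp.apply_mem_subring c))
  · exact congrArg Prod.snd (key _ hp.x_mem_subring)
  · exact congrArg Prod.snd (key _ hp.y_mem_subring)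

/-- A nonzero quotient satisfies the same relations, so its monomials are still independent and
nothing has been killed. -/
theorem isSimpleRing [Nontrivial R] (h : BicyclicRelations σ ρ u b₁ b₂ i x y)
    (hσρ : IndependentAuts σ ρ) (hs : Function.Surjective (bicyclicSum σ ρ i x y)) :
    IsSimpleRing R := by
  refine IsSimpleRing.of_eq_bot_or_eq_top fun I => ?_
  by_cases hI : I = ⊤
  · exact Or.inr hI
  left
  have : Nontrivial I.ringCon.Quotient := by
    refine ⟨⟨0, 1, fun h01 => hI ?_⟩⟩
    have : (1 : R) ∈ I := by
      rw [TwoSidedIdeal.mem_iff]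
      exact I.ringCon.symm ((RingCon.eq _).1 h01)
    exact eq_top_iff.2 fun r _ => by simpa using I.mul_mem_left r 1 this
  have hq := (h.map I.ringCon.mk').bicyclicSum_injective hσρ
  refine le_antisymm (fun r hr => ?_) bot_le
  obtain ⟨c, rfl⟩ := hs r
  have h0 : I.ringCon.mk' (bicyclicSum σ ρ i x y c) = 0 :=
    (RingCon.eq _).2 ((TwoSidedIdeal.mem_iff _ _).1 hr)
  have : bicyclicSum σ ρ (I.ringCon.mk'.comp i) (I.ringCon.mk' x) (I.ringCon.mk' y) c = 0 := by
    rw [← h0]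
    simp [bicyclicSum_apply]
  rw [(injective_iff_map_eq_zero _).1 hq c this, map_zero]
  exact zero_mem _

end BicyclicRelations

end Relations

/-! ### Partial norms, and a module on which the relations hold. -/

section Existence

variable {K M : Type*} [Field K] [Field M] [Algebra K M]

/-- The product `m σ(m) ⋯ σ ^ (k - 1) (m)`. -/
def partialNorm (σ : M ≃ₐ[K] M) (k : ℕ) (m : M) : M := ∏ j ∈ Finset.range k, (σ ^ j) m

theorem partialNorm_succ (σ : M ≃ₐ[K] M) (k : ℕ) (m : M) :
    partialNorm σ (k + 1) m = partialNorm σ k m * (σ ^ k) m := Finset.prod_range_succ _ _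

theorem partialNorm_succ' (σ : M ≃ₐ[K] M) (k : ℕ) (m : M) :
    partialNorm σ (k + 1) m = m * σ (partialNorm σ k m) := by
  rw [partialNorm, Finset.prod_range_succ', partialNorm, map_prod, mul_comm]
  simp [pow_succ']

theorem partialNorm_mul (σ : M ≃ₐ[K] M) (k : ℕ) (m m' : M) :
    partialNorm σ k (m * m') = partialNorm σ k m * partialNorm σ k m' := by
  simp [partialNorm, Finset.prod_mul_distrib]

theorem partialNorm_inv (σ : M ≃ₐ[K] M) (k : ℕ) (m : M) :
    partialNorm σ k m⁻¹ = (partialNorm σ k m)⁻¹ := by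
  simp [partialNorm]

theorem partialNorm_one (σ : M ≃ₐ[K] M) (k : ℕ) : partialNorm σ k 1 = 1 := by
  simp [partialNorm]

theorem partialNorm_ne_zero (σ : M ≃ₐ[K] M) (k : ℕ) {m : M} (hm : m ≠ 0) :
    partialNorm σ k m ≠ 0 := by
  exact Finset.prod_ne_zero_iff.2 fun j _ => (map_ne_zero _).2 hm

theorem partialNorm_apply {G : Type*} [FunLike G M M] [MonoidHomClass G M M] {σ : M ≃ₐ[K] M} {g : G}
    (h : ∀ m, σ (g m) = g (σ m)) (k : ℕ) (m : M) :
    partialNorm σ k (g m) = g (partialNorm σ k m) := by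
  rw [partialNorm, partialNorm, map_prod]
  congr 1
  funext j
  induction j with
  | zero => rfl
  | succ j ih => rw [pow_succ', AlgEquiv.mul_apply, ih, h]; rfl

theorem pow_apply_comm {σ ρ : M ≃ₐ[K] M} (h : Commute σ ρ) (a b : ℕ) (m : M) :
    (σ ^ a) ((ρ ^ b) m) = (ρ ^ b) ((σ ^ a) m) :=
  DFunLike.congr_fun (h.pow_pow a b).eq m

theorem pow_apply_of_apply_eq {σ : M ≃ₐ[K] M} {m : M} (h : σ m = m) (a : ℕ) : (σ ^ a) m = m := by
  induction a with
  | zero => rfl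
  | succ a ih => rw [pow_succ, AlgEquiv.mul_apply, h, ih]

/-- The two recursions for the partial norm of length $n+1$ are compared, using $\sigma^n=1$. -/
theorem apply_partialNorm_orderOf (σ : M ≃ₐ[K] M) {m : M} (hm : m ≠ 0) :
    σ (partialNorm σ (orderOf σ) m) = partialNorm σ (orderOf σ) m := by
  have h := (partialNorm_succ' σ (orderOf σ) m).symm.trans (partialNorm_succ σ (orderOf σ) m)
  rw [pow_orderOf_eq_one, AlgEquiv.one_apply, mul_comm] at h
  exact mul_right_cancel₀ hm h

/-- Conditions on `(u, b₁, b₂)` under which the abelian crossed product exists. -/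
structure BicyclicCocycle (σ ρ : M ≃ₐ[K] M) (u b₁ b₂ : Mˣ) : Prop where
  apply₁ : σ b₁ = b₁
  apply₂ : ρ b₂ = b₂
  norm₁ : partialNorm σ (orderOf σ) u * ρ b₁ = b₁
  norm₂ : partialNorm ρ (orderOf ρ) u * b₂ = σ b₂

/-- The functions `f` with `f (a + n, b) = ρ ^ b (b₁) f (a, b)` and
`f (a, b + ℓ) = b₂ f (a, b)`. -/
def quasiPeriodic (σ ρ : M ≃ₐ[K] M) (b₁ b₂ : Mˣ) : Submodule K (ℕ → ℕ → M) where
  carrier := {f | ∀ a b, f (a + orderOf σ) b = (ρ ^ b) b₁ * f a b ∧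
    f a (b + orderOf ρ) = b₂ * f a b}
  zero_mem' := by simp
  add_mem' hf hg a b := by simp [hf a b, hg a b, mul_add]
  smul_mem' c f hf a b := by simp [hf a b]

/-- Only nonvanishing is needed, since the crossed product will be cut out of the endomorphism ring
as a span of monomials. The witness is supported on pairs of multiples of $n$ and $\ell$. -/
theorem nontrivial_quasiPeriodic [FiniteDimensional K M] (σ ρ : M ≃ₐ[K] M) (b₁ b₂ : Mˣ) :
    Nontrivial (quasiPeriodic σ ρ b₁ b₂) := by
  have hn := orderOf_pos σ
  have hl := orderOf_pos ρ
  refine ⟨⟨⟨fun a b => if orderOf σ ∣ a ∧ orderOf ρ ∣ b then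
    (b₁ : M) ^ (a / orderOf σ) * b₂ ^ (b / orderOf ρ) else 0, fun a b => ?_⟩, 0, fun h => ?_⟩⟩
  · simp only [Nat.dvd_add_self_right, Nat.add_div_right _ hn, Nat.add_div_right _ hl, pow_succ]
    constructor
    · split_ifs with h
      · rw [orderOf_dvd_iff_pow_eq_one.1 h.2, AlgEquiv.one_apply]
        ring
      · simp
    · split_ifs with h
      · ring
      · simp
  · simpa using congrFun (congrFun (congrArg Subtype.val h) 0) 0

/-- $M$ acts at the place $(a,b)$ through $\sigma^a\rho^b$, $x$ shifts $a$, and $y$ shifts $b$ with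
a twist. Quasi-periodicity makes the full shifts multiplication by $b_1$ and, together with the
twist, by $b_2$. -/
theorem BicyclicCocycle.exists_relations [FiniteDimensional K M] {σ ρ : M ≃ₐ[K] M} {u b₁ b₂ : Mˣ}
    (h : BicyclicCocycle σ ρ u b₁ b₂) (hc : Commute σ ρ) :
    ∃ (i : M →ₐ[K] Module.End K (quasiPeriodic σ ρ b₁ b₂))
      (x y : Module.End K (quasiPeriodic σ ρ b₁ b₂)),
      BicyclicRelations σ ρ u b₁ b₂ (i : M →+* _) x y := by
  -- The twist is dictated by $x^ay=N_a(u)\,yx^a$, where $N_a$ is the partial norm of length $a$,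
  -- translated by $\rho^b$.
  let w (a b : ℕ) : M := (ρ ^ b) (partialNorm σ a u)
  have hw1 : ∀ a b, w (a + 1) b = (σ ^ a) ((ρ ^ b) u) * w a b := fun a b => by
    simp only [w, partialNorm_succ, map_mul, pow_apply_comm hc, mul_comm]
  have hw2 : ∀ a b, w a (b + orderOf ρ) = w a b := fun a b => by
    simp only [w, pow_add, pow_orderOf_eq_one, mul_one]
  -- Here `norm₁` enters: this is what makes $y$ preserve quasi-periodicity in $a$.
  have hw3 : ∀ a b, w (a + orderOf σ) b * (ρ ^ (b + 1)) b₁ = (ρ ^ b) b₁ * w a b := by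
    intro a b
    induction a with
    | zero =>
      simp only [w, zero_add, pow_succ, AlgEquiv.mul_apply, ← map_mul, h.norm₁]
      simp [partialNorm]
    | succ a ih =>
      rw [add_right_comm, hw1, hw1, pow_add, pow_orderOf_eq_one, mul_one, mul_assoc, ih]
      ring
  let c (m : M) : Module.End K (quasiPeriodic σ ρ b₁ b₂) :=
    { toFun f := ⟨fun a b => (σ ^ a) ((ρ ^ b) m) * f.1 a b, fun a b => by
        dsimp only
        rw [(f.2 a b).1, (f.2 a b).2, pow_add, pow_add, pow_orderOf_eq_one, pow_orderOf_eq_one]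
        simp only [mul_one]
        exact ⟨by ring, by ring⟩⟩
      map_add' f g := by
        ext a b
        simp [mul_add]
      map_smul' k f := by
        ext a b
        simp }
  let i : M →ₐ[K] Module.End K (quasiPeriodic σ ρ b₁ b₂) := AlgHom.ofLinearMap
    { toFun := c
      map_add' := fun m m' => by
        ext f a b
        simp [c, add_mul]
      map_smul' := fun k m => by
        ext f a b
        change (σ ^ a) ((ρ ^ b) (k • m)) * f.1 a b = k • ((σ ^ a) ((ρ ^ b) m) * f.1 a b)
        rw [map_smul, map_smul, smul_mul_assoc] }
    (by ext f a b; simp [c]) (fun m m' => by ext f a b; simp [c, mul_assoc])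
  let x : Module.End K (quasiPeriodic σ ρ b₁ b₂) :=
    { toFun f := ⟨fun a b => f.1 (a + 1) b, fun a b => by
        dsimp only
        rw [add_right_comm]; exact f.2 (a + 1) b⟩
      map_add' f g := rfl
      map_smul' k f := rfl }
  let y : Module.End K (quasiPeriodic σ ρ b₁ b₂) :=
    { toFun f := ⟨fun a b => w a b * f.1 a (b + 1), fun a b => by
        dsimp only
        rw [add_right_comm, (f.2 a (b + 1)).1, (f.2 a (b + 1)).2, ← mul_assoc, hw3, hw2]
        exact ⟨by ring, by ring⟩⟩
      map_add' f g := by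
        ext a b
        simp [mul_add]
      map_smul' k f := by
        ext a b
        simp }
  have hi : ∀ m f a b, (i m f).1 a b = (σ ^ a) ((ρ ^ b) m) * f.1 a b := fun _ _ _ _ => rfl
  have hx : ∀ f a b, (x f).1 a b = f.1 (a + 1) b := fun _ _ _ => rfl
  have hy : ∀ f a b, (y f).1 a b = w a b * f.1 a (b + 1) := fun _ _ _ => rfl
  have hxk : ∀ k f a b, ((x ^ k) f).1 a b = f.1 (a + k) b := by
    intro k
    induction k with
    | zero => simp
    | succ k ih =>
      intro f a b
      rw [pow_succ', Module.End.mul_apply, hx, ih, add_right_comm, add_assoc]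
  have hyk : ∀ k f a b, ((y ^ k) f).1 a b = (ρ ^ b) (partialNorm ρ k (partialNorm σ a u)) *
      f.1 a (b + k) := by
    intro k
    induction k with
    | zero => simp [partialNorm]
    | succ k ih =>
      intro f a b
      rw [pow_succ', Module.End.mul_apply, hy, ih, partialNorm_succ', map_mul, pow_succ]
      simp only [w, AlgEquiv.mul_apply, mul_assoc, add_right_comm, add_assoc]
  -- Here `norm₂` enters: the accumulated twist of $y^\ell$ turns $b_2$ into its value at the place
  -- $a$.
  have hN : ∀ a, partialNorm ρ (orderOf ρ) (partialNorm σ a u) * b₂ = (σ ^ a) b₂ := by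
    intro a
    induction a with
    | zero => simp [partialNorm]
    | succ a ih =>
      rw [partialNorm_succ, partialNorm_mul, mul_right_comm, ih,
        partialNorm_apply (g := σ ^ a) (fun m => by
          simpa using (pow_apply_comm hc a 1 m).symm), ← map_mul, mul_comm, h.norm₂, pow_succ,
        AlgEquiv.mul_apply]
  refine ⟨i, x, y, ?_, ?_, ?_, ?_, ?_⟩
  · intro m
    ext f a b
    change (x (i m f)).1 a b = (i (σ m) (x f)).1 a b
    rw [hx, hi, hi, hx, pow_succ, AlgEquiv.mul_apply]
    have := pow_apply_comm hc 1 b m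
    rw [pow_one] at this
    rw [this]
  · intro m
    ext f a b
    change (y (i m f)).1 a b = (i (ρ m) (y f)).1 a b
    rw [hy, hi, hi, hy, pow_succ, AlgEquiv.mul_apply]
    ring
  · ext f a b
    change ((x ^ _) f).1 a b = (i b₁ f).1 a b
    rw [hxk, hi, (f.2 a b).1, pow_apply_comm hc, pow_apply_of_apply_eq h.apply₁]
  · ext f a b
    change ((y ^ _) f).1 a b = (i b₂ f).1 a b
    rw [hyk, hi, (f.2 a b).2, pow_apply_of_apply_eq h.apply₂, ← mul_assoc, ← hN]
    nth_rewrite 1 [← pow_apply_of_apply_eq h.apply₂ b]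
    rw [← map_mul, hN, ← pow_apply_comm hc, pow_apply_of_apply_eq h.apply₂]
  · ext f a b
    change (x (y f)).1 a b = (i u (y (x f))).1 a b
    rw [hx, hy, hi, hy, hx, hw1, mul_assoc]

end Existence

/-! ### Crossed products for a bicyclic Galois group: dimension and centre. -/

section Crossed

variable {K M : Type u} [Field K] [Field M] [Algebra K M]
  {σ ρ : M ≃ₐ[K] M} {u b₁ b₂ : Mˣ}

/-- Invertibility of $x$ and $y$ is automatic: powers of them are images of units of $M$. -/
theorem isAbelianCrossedProduct_iff [FiniteDimensional K M] {A : Type u} [Ring A] [Algebra K A] :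
    IsAbelianCrossedProduct σ ρ u b₁ b₂ A ↔ Module.finrank K A = Module.finrank K M ^ 2 ∧
      ∃ (i : M →ₐ[K] A) (x y : A), BicyclicRelations σ ρ u b₁ b₂ (i : M →+* A) x y := by
  refine and_congr_right fun _ => ⟨?_, ?_⟩
  · rintro ⟨i, x, y, h1, h2, h3, h4, h5⟩
    refine ⟨i, x, y, h1, h2, h3, h4, ?_⟩
    change _ = i u * _
    rw [← h5]
    simp [← Units.val_mul]
  · rintro ⟨i, x, y, h⟩
    obtain ⟨x, rfl⟩ := h.isUnit_x
    obtain ⟨y, rfl⟩ := h.isUnit_y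
    refine ⟨i, x, y, h.x_mul, h.y_mul, h.x_pow, h.y_pow, ?_⟩
    have := h.x_mul_y
    change _ = i u * _ at this
    have h2 : x * y = Units.map (i : M →* A) u * (y * x) := Units.ext this
    have h3 : Units.map (i : M →* A) u * (y * x) * x⁻¹ * y⁻¹ = Units.map (i : M →* A) u := by group
    rw [h2, h3]
    rfl

/-- The automorphisms `σ` and `ρ` generate `Gal(M/K)` as the direct product of the subgroups
that they generate. -/
structure IsBicyclicGal (σ ρ : M ≃ₐ[K] M) : Prop where
  finiteDimensional : FiniteDimensional K M
  isGalois : IsGalois K M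
  commute : Commute σ ρ
  independent : IndependentAuts σ ρ
  card : orderOf σ * orderOf ρ = Module.finrank K M

namespace IsBicyclicGal

theorem exists_pow (h : IsBicyclicGal σ ρ) (g : M ≃ₐ[K] M) : ∃ a b : ℕ, g = σ ^ a * ρ ^ b := by
  have := h.finiteDimensional
  have := h.isGalois
  have hb : Function.Bijective fun p : Fin (orderOf σ) × Fin (orderOf ρ) =>
      σ ^ (p.1 : ℕ) * ρ ^ (p.2 : ℕ) := by
    rw [Nat.bijective_iff_injective_and_card]
    exact ⟨h.independent, by rw [IsGalois.card_aut_eq_finrank, ← h.card]; simp⟩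
  obtain ⟨p, rfl⟩ := hb.2 g
  exact ⟨_, _, rfl⟩

theorem mem_range_of_apply_eq (h : IsBicyclicGal σ ρ) {m : M} (h1 : σ m = m) (h2 : ρ m = m) :
    ∃ k : K, algebraMap K M k = m := by
  have := h.finiteDimensional
  have := h.isGalois
  refine (IsGalois.mem_range_algebraMap_iff_fixed m).2 fun g => ?_
  obtain ⟨a, b, rfl⟩ := h.exists_pow g
  rw [AlgEquiv.mul_apply, pow_apply_of_apply_eq h2, pow_apply_of_apply_eq h1]

variable {R : Type*} [Ring R] [Algebra K R] {i : M →ₐ[K] R} {x y : R}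

/-- `bicyclicSum` as a linear map. -/
noncomputable def _root_.bicyclicSumₗ (σ ρ : M ≃ₐ[K] M) (i : M →ₐ[K] R) (x y : R) :
    (Fin (orderOf σ) × Fin (orderOf ρ) → M) →ₗ[K] R where
  __ := bicyclicSum σ ρ (i : M →+* R) x y
  map_smul' k c := by simp [bicyclicSum_apply, Finset.smul_sum]

theorem finrank_fun (h : IsBicyclicGal σ ρ) :
    Module.finrank K (Fin (orderOf σ) × Fin (orderOf ρ) → M) = Module.finrank K M ^ 2 := by
  have := h.finiteDimensional
  rw [Module.finrank_pi_fintype]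
  simp [h.card, sq]

theorem surjective [Nontrivial R] [FiniteDimensional K R] (hG : IsBicyclicGal σ ρ)
    (h : BicyclicRelations σ ρ u b₁ b₂ (i : M →+* R) x y)
    (hR : Module.finrank K R = Module.finrank K M ^ 2) :
    Function.Surjective (bicyclicSum σ ρ (i : M →+* R) x y) := by
  have := hG.finiteDimensional
  have := hG.isGalois
  exact (LinearMap.injective_iff_surjective_of_finrank_eq_finrank (f := bicyclicSumₗ σ ρ i x y)
    (hG.finrank_fun.trans hR.symm)).1 (h.bicyclicSum_injective hG.independent)

/-- Comparing coefficients after commuting with $M$ leaves only the coefficient of $x^0y^0$, since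
distinct monomials induce distinct automorphisms. Commuting with $x$ and $y$ puts that coefficient
in $K$. -/
theorem isCentral [Nontrivial R] (hG : IsBicyclicGal σ ρ)
    (h : BicyclicRelations σ ρ u b₁ b₂ (i : M →+* R) x y)
    (hs : Function.Surjective (bicyclicSum σ ρ (i : M →+* R) x y)) : Algebra.IsCentral K R := by
  have := hG.finiteDimensional
  have := hG.isGalois
  refine ⟨fun r hr => ?_⟩
  obtain ⟨c, rfl⟩ := hs r
  have hinj := h.bicyclicSum_injective hG.independent
  have hi : Function.Injective i := i.toRingHom.injective
  rw [Subalgebra.mem_center_iff] at hr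
  let p₀ : Fin (orderOf σ) × Fin (orderOf ρ) := (⟨0, orderOf_pos σ⟩, ⟨0, orderOf_pos ρ⟩)
  have hc : ∀ p, p ≠ p₀ → c p = 0 := by
    intro p hp
    by_contra hcp
    refine hp (hG.independent (AlgEquiv.ext fun m => ?_))
    have h1 := hr (i m)
    have h2 : bicyclicSum σ ρ (i : M →+* R) x y c * i m = bicyclicSum σ ρ (i : M →+* R) x y
        (fun p => c p * (σ ^ (p.1 : ℕ) * ρ ^ (p.2 : ℕ)) m) := by
      rw [bicyclicSum_apply, Finset.sum_mul, bicyclicSum_apply]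
      refine Finset.sum_congr rfl fun p _ => ?_
      have hy := pow_mul_of_semiconj h.y_mul (p.2 : ℕ) m
      have hx := pow_mul_of_semiconj h.x_mul (p.1 : ℕ) ((ρ ^ (p.2 : ℕ)) m)
      rw [RingHom.coe_coe] at hx hy
      rw [mul_assoc, mul_assoc, hy, ← mul_assoc (x ^ _), hx]
      simp [mul_assoc]
    have h3 : i m * bicyclicSum σ ρ (i : M →+* R) x y c = bicyclicSum σ ρ (i : M →+* R) x y
        (fun p => m * c p) := by
      rw [bicyclicSum_apply, Finset.mul_sum, bicyclicSum_apply]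
      exact Finset.sum_congr rfl fun p _ => by simp [mul_assoc]
    rw [h2, h3] at h1
    have h4 := congrFun (hinj h1) p
    simp only [mul_comm m] at h4
    simpa [p₀] using (mul_left_cancel₀ hcp h4).symm
  have hr0 : bicyclicSum σ ρ (i : M →+* R) x y c = i (c p₀) := by
    rw [bicyclicSum_apply, Finset.sum_eq_single p₀ (fun p _ hp => by simp [hc p hp]) (by simp)]
    simp [p₀]
  rw [hr0] at hr ⊢
  have h1 : σ (c p₀) = c p₀ := hi (h.isUnit_x.mul_right_cancel ((h.x_mul _).symm.trans (hr x)))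
  have h2 : ρ (c p₀) = c p₀ := hi (h.isUnit_y.mul_right_cancel ((h.y_mul _).symm.trans (hr y)))
  obtain ⟨k, hk⟩ := hG.mem_range_of_apply_eq h1 h2
  exact Algebra.mem_bot.2 ⟨k, by rw [← hk, i.commutes]⟩

end IsBicyclicGal

end Crossed

/-! ### Brauer classes from actions and dimension counts. -/

section Brauer

variable {K : Type u} [Field K]

theorem CSA.mk_eq_of_algEquiv {A B : CSA.{u, u} K} (e : A ≃ₐ[K] B) :
    (⟦A⟧ : BrauerGroup.{u, u} K) = ⟦B⟧ :=
  Quotient.sound (CSA.isBrauerEquivalent_of_algEquiv e)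

theorem CSA.mk_tensor (A B : CSA.{u, u} K) :
    (⟦A.tensor B⟧ : BrauerGroup.{u, u} K) = ⟦A⟧ * ⟦B⟧ := rfl

theorem CSA.mk_op (A : CSA.{u, u} K) :
    (⟦A.op⟧ : BrauerGroup.{u, u} K) = (⟦A⟧ : BrauerGroup.{u, u} K)⁻¹ :=
  rfl

theorem CSA.mk_eq_one_of_algEquiv_end {A : CSA.{u, u} K} {V : Type*} [AddCommGroup V] [Module K V]
    [FiniteDimensional K V] [Nontrivial V] (e : A ≃ₐ[K] Module.End K V) :
    (⟦A⟧ : BrauerGroup.{u, u} K) = 1 :=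
  Quotient.sound ⟨1, 1 * Module.finrank K V, one_ne_zero, by simp [Module.finrank_pos.ne'],
    ⟨(AlgEquiv.mapMatrix <| e.trans <| algEquivMatrix (Module.finBasis K V)).trans <|
      (Matrix.compAlgEquiv _ _ _ _).trans <|
      Matrix.reindexAlgEquiv K K finProdFinEquiv⟩⟩

/-- A homomorphism from a simple algebra to an algebra of the same dimension is bijective. -/
theorem AlgHom.bijective_of_finrank_eq {A B : Type*} [Ring A] [Algebra K A] [IsSimpleRing A]
    [Ring B] [Nontrivial B] [Algebra K B] [FiniteDimensional K A] [FiniteDimensional K B]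
    (f : A →ₐ[K] B) (h : Module.finrank K A = Module.finrank K B) : Function.Bijective f := by
  have hi : Function.Injective f := f.toRingHom.injective
  exact ⟨hi, (LinearMap.injective_iff_surjective_of_finrank_eq_finrank (f := f.toLinearMap) h).1 hi⟩

/-- An algebra that acts on a space `V` with `dim A = (dim V)²` is split. -/
theorem CSA.mk_eq_one_of_algHom {A : CSA.{u, u} K} {V : Type*} [AddCommGroup V] [Module K V]
    [FiniteDimensional K V] [Nontrivial V] (f : A →ₐ[K] Module.End K V)
    (h : Module.finrank K A = Module.finrank K V ^ 2) : (⟦A⟧ : BrauerGroup.{u, u} K) = 1 :=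
  CSA.mk_eq_one_of_algEquiv_end (AlgEquiv.ofBijective f (f.bijective_of_finrank_eq (by
    rw [h, Module.finrank_linearMap, sq])))

/-- Two algebras with commuting actions on a space `V` with `dim A dim B = (dim V)²` have inverse
Brauer classes. -/
theorem CSA.mk_mul_mk_eq_one {A B : CSA.{u, u} K} {V : Type*} [AddCommGroup V] [Module K V]
    [FiniteDimensional K V] [Nontrivial V] (f : A →ₐ[K] Module.End K V)
    (g : B →ₐ[K] Module.End K V) (hfg : ∀ a b, Commute (f a) (g b))
    (h : Module.finrank K A * Module.finrank K B = Module.finrank K V ^ 2) :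
    (⟦A⟧ * ⟦B⟧ : BrauerGroup.{u, u} K) = 1 := by
  rw [← CSA.mk_tensor]
  refine CSA.mk_eq_one_of_algHom (V := V) (Algebra.TensorProduct.lift f g hfg) ?_
  rw [← h]
  exact Module.finrank_tensorProduct

end Brauer

/-! ### Uniqueness, existence and splitting of abelian crossed products. -/

section Crossed

variable {K M : Type u} [Field K] [Field M] [Algebra K M]
  {σ ρ : M ≃ₐ[K] M} {u b₁ b₂ : Mˣ}

namespace IsBicyclicGal

theorem exists_algHom {A : CSA.{u, u} K} {R : Type*} [Ring R] [Algebra K R]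
    {i : M →ₐ[K] A} {x y : A} {i' : M →ₐ[K] R} {x' y' : R} (hG : IsBicyclicGal σ ρ)
    (hA : Module.finrank K A = Module.finrank K M ^ 2)
    (h : BicyclicRelations σ ρ u b₁ b₂ (i : M →+* A) x y)
    (h' : BicyclicRelations σ ρ u b₁ b₂ (i' : M →+* R) x' y') :
    ∃ f : A →ₐ[K] R, (∀ c, f (i c) = i' c) ∧ f x = x' ∧ f y = y' := by
  have := hG.finiteDimensional
  have := hG.isGalois
  obtain ⟨f, h1, h2, h3⟩ := h.exists_lift h' hG.independent (hG.surjective h hA)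
  refine ⟨{ f with commutes' := fun k => ?_ }, h1, h2, h3⟩
  have := h1 (algebraMap K M k)
  simpa using this

theorem mk_eq_of_isAbelianCrossedProduct (hG : IsBicyclicGal σ ρ) {A B : CSA.{u, u} K}
    (hA : IsAbelianCrossedProduct σ ρ u b₁ b₂ A) (hB : IsAbelianCrossedProduct σ ρ u b₁ b₂ B) :
    (⟦A⟧ : BrauerGroup.{u, u} K) = ⟦B⟧ := by
  have := hG.finiteDimensional
  rw [isAbelianCrossedProduct_iff] at hA hB
  obtain ⟨hA, i, x, y, h⟩ := hA
  obtain ⟨hB, i', x', y', h'⟩ := hB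
  obtain ⟨f, -⟩ := hG.exists_algHom hA h h'
  exact CSA.mk_eq_of_algEquiv
    (AlgEquiv.ofBijective f (f.bijective_of_finrank_eq (hA.trans hB.symm)))

/-- The span of the monomials in any nonzero algebra with the relations is the crossed product. This
serves both the quasi-periodic model and the operators on $M^n$ obtained from a unitary involution.
-/
theorem exists_isAbelianCrossedProduct_of_relations (hG : IsBicyclicGal σ ρ) {R : Type u} [Ring R]
    [Nontrivial R] [Algebra K R] {i : M →ₐ[K] R} {x y : R}
    (h : BicyclicRelations σ ρ u b₁ b₂ (i : M →+* R) x y) :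
    ∃ A : CSA.{u, u} K, IsAbelianCrossedProduct σ ρ u b₁ b₂ A := by
  have := hG.finiteDimensional
  have := hG.isGalois
  let S : Subalgebra K R :=
    { h.subring with
      algebraMap_mem' := fun k => by simpa using h.apply_mem_subring (algebraMap K M k) }
  let iS : M →ₐ[K] S := i.codRestrict S h.apply_mem_subring
  let xS : S := ⟨x, h.x_mem_subring⟩
  let yS : S := ⟨y, h.y_mem_subring⟩
  have hS : BicyclicRelations σ ρ u b₁ b₂ (iS : M →+* S) xS yS :=
    { x_mul c := Subtype.ext (h.x_mul c)
      y_mul c := Subtype.ext (h.y_mul c)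
      x_pow := Subtype.ext h.x_pow
      y_pow := Subtype.ext h.y_pow
      x_mul_y := Subtype.ext h.x_mul_y }
  have hval : ∀ c, (bicyclicSum σ ρ (iS : M →+* S) xS yS c : R) =
      bicyclicSum σ ρ (i : M →+* R) x y c := by
    intro c
    rw [bicyclicSum_apply, bicyclicSum_apply, AddSubmonoidClass.coe_finsetSum]
    rfl
  have hs : Function.Surjective (bicyclicSum σ ρ (iS : M →+* S) xS yS) := by
    rintro ⟨r, c, rfl⟩
    exact ⟨c, Subtype.ext (hval c)⟩
  let e : (Fin (orderOf σ) × Fin (orderOf ρ) → M) ≃ₗ[K] S :=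
    LinearEquiv.ofBijective (bicyclicSumₗ σ ρ iS xS yS)
      ⟨hS.bicyclicSum_injective hG.independent, hs⟩
  have hfin : FiniteDimensional K S := e.finiteDimensional
  have hcen : Algebra.IsCentral K S := hG.isCentral hS hs
  have hsim : IsSimpleRing S := hS.isSimpleRing hG.independent hs
  refine ⟨{ toAlgCat := AlgCat.of K S, isCentral := hcen, isSimple := hsim, fin_dim := hfin }, ?_⟩
  exact isAbelianCrossedProduct_iff.2 ⟨by rw [← hG.finrank_fun]; exact e.finrank_eq.symm,
    iS, xS, yS, hS⟩

theorem exists_isAbelianCrossedProduct (hG : IsBicyclicGal σ ρ)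
    (h : BicyclicCocycle σ ρ u b₁ b₂) :
    ∃ A : CSA.{u, u} K, IsAbelianCrossedProduct σ ρ u b₁ b₂ A := by
  have := hG.finiteDimensional
  obtain ⟨i, x, y, hR⟩ := h.exists_relations hG.commute
  have := nontrivial_quasiPeriodic σ ρ b₁ b₂
  exact hG.exists_isAbelianCrossedProduct_of_relations hR

/-- $A$ is a right $M$-space of dimension $[M:K]$. Left multiplication by $A$ and right
multiplication by $M$ give $M\otimes_KA\to\operatorname{End}_M(A)$, bijective by simplicity and
dimension. -/
theorem isSplitBy (hG : IsBicyclicGal σ ρ) {A : CSA.{u, u} K}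
    (hA : IsAbelianCrossedProduct σ ρ u b₁ b₂ A) : IsSplitBy K M A := by
  have := hG.finiteDimensional
  obtain ⟨hA, i, -⟩ := hA
  let _ : Module M A := Module.compHom A ((i.toRingHom.toOpposite fun a b => by
    simp [Commute, SemiconjBy, ← map_mul, mul_comm]) : M →+* (A : Type u)ᵐᵒᵖ)
  have hsmul : ∀ (m : M) (a : A), m • a = a * i m := fun _ _ => rfl
  have : IsScalarTower K M A := ⟨fun k m a => by simp [hsmul]⟩
  have hfin : FiniteDimensional M A := FiniteDimensional.right K M A
  have : SMulCommClass K M A := ⟨fun k m a => by simp [hsmul]⟩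
  let g : A →ₐ[K] Module.End M A := AlgHom.ofLinearMap
    { toFun := fun a =>
        { toFun := fun b => a * b
          map_add' := mul_add a
          map_smul' := fun m b => by simp [hsmul, mul_assoc] }
      map_add' := fun a b => by ext c; simp [add_mul]
      map_smul' := fun k a => by ext c; simp }
    (by ext c; simp) (fun a b => by ext c; simp [mul_assoc])
  let f : M ⊗[K] A →ₐ[M] Module.End M A :=
    Algebra.TensorProduct.lift (Algebra.ofId M _) g fun m a => Algebra.commute_algebraMap_left _ _
  have hdim : Module.finrank M A = Module.finrank K M := by
    have := Module.finrank_mul_finrank K M A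
    rw [hA, sq] at this
    exact Nat.eq_of_mul_eq_mul_left Module.finrank_pos this
  have : IsSimpleRing (A ⊗[K] M) := CentralSimple.isSimpleRing_tensorProduct K A M
  have : IsSimpleRing (M ⊗[K] A) :=
    IsSimpleRing.of_ringEquiv (Algebra.TensorProduct.comm K A M).toRingEquiv this
  have hb := f.bijective_of_finrank_eq (by
    rw [Module.finrank_baseChange, Module.finrank_linearMap, hdim, hA, sq])
  exact ⟨_, ⟨(AlgEquiv.ofBijective f hb).trans (algEquivMatrix (Module.finBasis M A))⟩⟩

end IsBicyclicGal

end Crossed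

/-! ### Multiplicativity of the Brauer class in the parameters. -/

section Product

variable {K M : Type u} [Field K] [Field M] [Algebra K M]
  {σ ρ : M ≃ₐ[K] M} {u b₁ b₂ u' b₁' b₂' : Mˣ}

theorem BicyclicRelations.commute_of_surjective {M R R' : Type*} [Field M] [Algebra K M] [Ring R]
    [Ring R'] {σ ρ : M ≃ₐ[K] M} {i : M →+* R} {x y : R}
    (hs : Function.Surjective (bicyclicSum σ ρ i x y)) (f : R →+* R') {t : R'}
    (hi : ∀ c, Commute (f (i c)) t) (hx : Commute (f x) t) (hy : Commute (f y) t) (r : R) :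
    Commute (f r) t := by
  obtain ⟨c, rfl⟩ := hs r
  rw [bicyclicSum_apply, map_sum]
  refine Commute.sum_left _ _ _ fun p _ => ?_
  rw [map_mul, map_mul, map_pow, map_pow]
  exact (hi _).mul_left ((hx.pow_left _).mul_left (hy.pow_left _))

/-- On $V=A\otimes_MA'$, with $M$ acting from the left, $x\otimes x'$ and $y\otimes y'$ satisfy the
relations with the product parameters, so $A''$ acts. This action commutes with right multiplication
by $A$ and $A'$. With $d=[M:K]$ the dimensions are $d^2,d^2,d^2$ against $(d^3)^2$, whence
$[A''][A]^{-1}[A']^{-1}=1$. -/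
theorem IsBicyclicGal.mk_mul_mk (hG : IsBicyclicGal σ ρ) {A A' A'' : CSA.{u, u} K}
    (hA : IsAbelianCrossedProduct σ ρ u b₁ b₂ A)
    (hA' : IsAbelianCrossedProduct σ ρ u' b₁' b₂' A')
    (hA'' : IsAbelianCrossedProduct σ ρ (u * u') (b₁ * b₁') (b₂ * b₂') A'') :
    (⟦A⟧ * ⟦A'⟧ : BrauerGroup.{u, u} K) = ⟦A''⟧ := by
  have := hG.finiteDimensional
  have := hG.isGalois
  rw [isAbelianCrossedProduct_iff] at hA hA' hA''
  obtain ⟨hA, i, x, y, h⟩ := hA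
  obtain ⟨hA', i', x', y', h'⟩ := hA'
  obtain ⟨hA'', i'', x'', y'', h''⟩ := hA''
  let _ : Module M A := Module.compHom A (i : M →+* A)
  let _ : Module M A' := Module.compHom A' (i' : M →+* A')
  have hsm : ∀ (m : M) (a : A), m • a = i m * a := fun _ _ => rfl
  have hsm' : ∀ (m : M) (a : A'), m • a = i' m * a := fun _ _ => rfl
  have : IsScalarTower K M A := ⟨fun k m a => by simp [hsm]⟩
  have : IsScalarTower K M A' := ⟨fun k m a => by simp [hsm']⟩
  have : FiniteDimensional M A := FiniteDimensional.right K M A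
  have : FiniteDimensional M A' := FiniteDimensional.right K M A'
  have hdim : ∀ (B : CSA.{u, u} K) [Module M B] [IsScalarTower K M B],
      Module.finrank K B = Module.finrank K M ^ 2 → Module.finrank M B = Module.finrank K M := by
    intro B _ _ hB
    have := Module.finrank_mul_finrank K M B
    rw [hB, sq] at this
    exact Nat.eq_of_mul_eq_mul_left Module.finrank_pos this
  let V := A ⊗[M] A'
  have hV : Module.finrank K V = Module.finrank K M ^ 3 := by
    rw [← Module.finrank_mul_finrank K M V, Module.finrank_tensorProduct, hdim A hA, hdim A' hA']
    ring
  have : FiniteDimensional K V := FiniteDimensional.trans K M V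
  have : Nontrivial V := Module.nontrivial_of_finrank_pos (R := K) (by
    rw [hV]; exact pow_pos Module.finrank_pos 3)
  have hsmV : ∀ (m : M) (a : A) (a' : A'), m • (a ⊗ₜ[M] a') = (m • a) ⊗ₜ[M] a' := fun _ _ _ => rfl
  have extV : ∀ {S T : Module.End K V}, (∀ a a', S (a ⊗ₜ a') = T (a ⊗ₜ a')) → S = T := by
    intro S T hST
    refine LinearMap.ext fun v => ?_
    induction v using TensorProduct.induction_on with
    | zero => simp
    | add v w hv hw => rw [map_add, map_add, hv, hw]
    | tmul a a' => exact hST a a'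
  -- $z\otimes z'$ is well defined over $M$ because both factors are semilinear for the same
  -- automorphism; the result is $K$-linear.
  have lift : ∀ (τ : M ≃ₐ[K] M) (z : A) (z' : A'), (∀ c, z * i c = i (τ c) * z) →
      (∀ c, z' * i' c = i' (τ c) * z') →
      ∃ Z : Module.End K V, ∀ a a', Z (a ⊗ₜ a') = (z * a) ⊗ₜ (z' * a') := by
    intro τ z z' hz hz'
    let X : A →ₛₗ[(τ : M →+* M)] A :=
      { toFun a := z * a
        map_add' := mul_add z
        map_smul' := fun m a => by simp [hsm, ← mul_assoc, hz] }
    let X' : A' →ₛₗ[(τ : M →+* M)] A' :=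
      { toFun a := z' * a
        map_add' := mul_add z'
        map_smul' := fun m a => by simp [hsm', ← mul_assoc, hz'] }
    refine ⟨{ toFun := TensorProduct.map X X'
              map_add' := map_add _
              map_smul' := fun k v => ?_ }, fun a a' => rfl⟩
    rw [← algebraMap_smul M k v, map_smulₛₗ, RingHom.coe_coe, τ.commutes, algebraMap_smul]
    rfl
  obtain ⟨X, hX⟩ := lift σ x x' h.x_mul h'.x_mul
  obtain ⟨Y, hY⟩ := lift ρ y y' h.y_mul h'.y_mul
  have hpow : ∀ {Z : Module.End K V} {z : A} {z' : A'},
      (∀ a a', Z (a ⊗ₜ a') = (z * a) ⊗ₜ (z' * a')) → ∀ (k : ℕ) (a : A) (a' : A'),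
      (Z ^ k) (a ⊗ₜ a') = (z ^ k * a) ⊗ₜ (z' ^ k * a') := by
    intro Z z z' hZ k
    induction k with
    | zero => simp
    | succ k ih => intro a a'; rw [pow_succ', Module.End.mul_apply, ih, hZ, pow_succ', pow_succ',
        mul_assoc, mul_assoc]
  let I : M →ₐ[K] Module.End K V := Algebra.lsmul K K V
  have hI : ∀ m a a', I m (a ⊗ₜ a') = (i m * a) ⊗ₜ a' := fun _ _ _ => rfl
  -- Scalars of $M$ cross the tensor sign, so one factor of each product parameter can be absorbed
  -- on each side.
  have hI' : ∀ m a a', I m (a ⊗ₜ a') = a ⊗ₜ (i' m * a') := fun m a a' => by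
    rw [hI, ← hsm, ← hsm', TensorProduct.smul_tmul]
  have hrel : BicyclicRelations σ ρ (u * u') (b₁ * b₁') (b₂ * b₂') (I : M →+* Module.End K V) X Y :=
    { x_mul c := extV fun a a' => by
        change X (I c _) = I (σ c) (X _)
        have := h.x_mul c
        simp only [RingHom.coe_coe] at this
        rw [hI, hX, hX, hI, ← mul_assoc, ← mul_assoc, this]
      y_mul c := extV fun a a' => by
        change Y (I c _) = I (ρ c) (Y _)
        have := h.y_mul c
        simp only [RingHom.coe_coe] at this
        rw [hI, hY, hY, hI, ← mul_assoc, ← mul_assoc, this]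
      x_pow := extV fun a a' => by
        change (X ^ _) _ = I ((b₁ * b₁' : Mˣ) : M) _
        rw [hpow hX, Units.val_mul, map_mul, Module.End.mul_apply, hI', hI, h.x_pow, h'.x_pow]
        rfl
      y_pow := extV fun a a' => by
        change (Y ^ _) _ = I ((b₂ * b₂' : Mˣ) : M) _
        rw [hpow hY, Units.val_mul, map_mul, Module.End.mul_apply, hI', hI, h.y_pow, h'.y_pow]
        rfl
      x_mul_y := extV fun a a' => by
        change X (Y _) = I ((u * u' : Mˣ) : M) (Y (X _))
        rw [hY, hX, hX, hY, Units.val_mul, map_mul, Module.End.mul_apply, hI', hI, ← mul_assoc,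
          ← mul_assoc, h.x_mul_y, h'.x_mul_y]
        simp only [mul_assoc]
        rfl }
  obtain ⟨f, hfi, hfx, hfy⟩ := hG.exists_algHom hA'' h'' hrel
  let r (a : A) : A →ₗ[M] A :=
    { toFun b := b * a
      map_add' b c := add_mul b c a
      map_smul' m b := by simp [hsm, mul_assoc] }
  let r' (a : A') : A' →ₗ[M] A' :=
    { toFun b := b * a
      map_add' b c := add_mul b c a
      map_smul' m b := by simp [hsm', mul_assoc] }
  let E (a : A) (a' : A') : Module.End K V := (TensorProduct.map (r a) (r' a')).restrictScalars K
  have hE : ∀ a a' b b', E a a' (b ⊗ₜ b') = (b * a) ⊗ₜ (b' * a') := fun _ _ _ _ => rfl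
  have smulV : ∀ (k : K) (a : A) (a' : A'), k • (a ⊗ₜ[M] a') = (k • a) ⊗ₜ[M] a' := fun _ _ _ => rfl
  have smulV' : ∀ (k : K) (a : A) (a' : A'), k • (a ⊗ₜ[M] a') = a ⊗ₜ[M] (k • a') := fun k a a' => by
    rw [smulV, TensorProduct.smul_tmul]
  let g : (A : Type u)ᵐᵒᵖ →ₐ[K] Module.End K V := AlgHom.ofLinearMap
    { toFun := fun a => E a.unop 1
      map_add' := fun a b => extV fun c c' => by simp [hE, mul_add, TensorProduct.add_tmul]
      map_smul' := fun k a => extV fun c c' => by simp [hE, smulV] }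
    (extV fun c c' => by
      change E 1 1 _ = _
      simp [hE]) (fun a b => extV fun c c' => by
      change E (MulOpposite.unop b * MulOpposite.unop a) 1 _ = E _ 1 (E _ 1 _)
      simp [hE, mul_assoc])
  let g' : (A' : Type u)ᵐᵒᵖ →ₐ[K] Module.End K V := AlgHom.ofLinearMap
    { toFun := fun a => E 1 a.unop
      map_add' := fun a b => extV fun c c' => by simp [hE, mul_add, TensorProduct.tmul_add]
      map_smul' := fun k a => extV fun c c' => by
        change E 1 (k • a.unop) (c ⊗ₜ c') = k • E 1 a.unop (c ⊗ₜ c')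
        rw [hE, hE, smulV', mul_smul_comm] }
    (extV fun c c' => by
      change E 1 1 _ = _
      simp [hE]) (fun a b => extV fun c c' => by
      change E 1 (MulOpposite.unop b * MulOpposite.unop a) _ = E 1 _ (E 1 _ _)
      simp [hE, mul_assoc])
  have hg : ∀ a, g a = E (MulOpposite.unop a) 1 := fun _ => rfl
  have hg' : ∀ a, g' a = E 1 (MulOpposite.unop a) := fun _ => rfl
  have hgg : ∀ a a', Commute (g a) (g' a') := fun a a' => extV fun c c' => by
    rw [hg, hg', Module.End.mul_apply, Module.End.mul_apply]
    simp [hE]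
  have hfE : ∀ (s : A'') (a : A) (a' : A'), Commute (f s) (E a a') := by
    intro s a a'
    refine BicyclicRelations.commute_of_surjective (hG.surjective h'' hA'') f.toRingHom ?_ ?_ ?_ s
    · intro c
      change Commute (f (i'' c)) _
      rw [hfi]
      exact extV fun b b' => by
        rw [Module.End.mul_apply, Module.End.mul_apply]
        simp only [hE, hI, mul_assoc]
    · change Commute (f x'') _
      rw [hfx]
      exact extV fun b b' => by
        rw [Module.End.mul_apply, Module.End.mul_apply]
        simp only [hE, hX, mul_assoc]
    · change Commute (f y'') _
      rw [hfy]
      exact extV fun b b' => by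
        rw [Module.End.mul_apply, Module.End.mul_apply]
        simp only [hE, hY, mul_assoc]
  let F : (A : Type u)ᵐᵒᵖ ⊗[K] (A' : Type u)ᵐᵒᵖ →ₐ[K] Module.End K V :=
    Algebra.TensorProduct.lift g g' hgg
  have hF : ∀ s t, Commute (f s) (F t) := fun s t => by
    induction t using TensorProduct.induction_on with
    | zero => rw [map_zero]; exact Commute.zero_right _
    | add t t' ht ht' => rw [map_add]; exact ht.add_right ht'
    | tmul a a' =>
      rw [Algebra.TensorProduct.lift_tmul]
      exact (hfE _ _ _).mul_right (hfE _ _ _)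
  have key := CSA.mk_mul_mk_eq_one (A := A'') (B := A.op.tensor A'.op) f F hF (by
      have h1 : Module.finrank K (A.op.tensor A'.op) =
          Module.finrank K A * Module.finrank K A' := by
        change Module.finrank K ((A : Type u)ᵐᵒᵖ ⊗[K] (A' : Type u)ᵐᵒᵖ) = _
        rw [Module.finrank_tensorProduct, (MulOpposite.opLinearEquiv K (M := A)).finrank_eq,
          (MulOpposite.opLinearEquiv K (M := A')).finrank_eq]
      rw [h1, hA, hA', hA'', hV]
      ring)
  rw [CSA.mk_tensor, CSA.mk_op, CSA.mk_op, ← mul_inv, mul_inv_eq_one] at key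
  exact key.symm

end Product

/-! ### Split crossed products and changes of generators. -/

section Split

variable {K M : Type u} [Field K] [Field M] [Algebra K M]
  {σ ρ : M ≃ₐ[K] M} {u b₁ b₂ : Mˣ}

/-- A split algebra of dimension `d²` acts on a space of dimension `d`. -/
theorem CSA.exists_algHom_end_of_mk_eq_one {A : CSA.{u, u} K} {d : ℕ}
    (hA : Module.finrank K A = d ^ 2) (h : (⟦A⟧ : BrauerGroup.{u, u} K) = 1) :
    ∃ (W : Type u) (_ : AddCommGroup W) (_ : Module K W) (_ : A →ₐ[K] Module.End K W),
      Module.finrank K W = d := by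
  obtain ⟨p, q, hp, hq, ⟨e⟩⟩ := (Quotient.exact h : IsBrauerEquivalent A (CSA.base K))
  have : NeZero p := ⟨hp⟩
  let V := Fin q → K
  let φ : Matrix (Fin p) (Fin p) A →ₐ[K] Module.End K V :=
    (Matrix.toLinAlgEquiv' : Matrix (Fin q) (Fin q) K ≃ₐ[K] _).toAlgHom.comp e.toAlgHom
  have hq : q = p * d := by
    have h1 := e.toLinearEquiv.finrank_eq
    have h2 : Module.finrank K (Matrix (Fin q) (Fin q) (CSA.base K)) = q * q := by
      change Module.finrank K (Matrix (Fin q) (Fin q) K) = q * q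
      rw [Module.finrank_matrix]; simp
    rw [h2, Module.finrank_matrix, hA, Fintype.card_fin] at h1
    exact Nat.mul_self_inj.1 (by rw [← h1]; ring)
  let E (s t : Fin p) : Module.End K V := φ (Matrix.single s t 1)
  have hE : ∀ s t r v, E s t (E t r v) = E s r v := fun s t r v => by
    rw [← Module.End.mul_apply, ← map_mul, Matrix.single_mul_single_same, one_mul]
  have hE0 : ∀ s t t' r v, t ≠ t' → E s t (E t' r v) = 0 := fun s t t' r v htt => by
    rw [← Module.End.mul_apply, ← map_mul, Matrix.single_mul_single_of_ne _ _ _ _ htt, map_zero,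
      LinearMap.zero_apply]
  have hE1 : ∀ v, ∑ s, E s s v = v := fun v => by
    rw [← LinearMap.sum_apply, ← map_sum, Matrix.sum_single_one, map_one, Module.End.one_apply]
  -- Morita reduction: the matrix units decompose $V$ into $p$ copies of $W$, on each of which the
  -- scalar matrices from $A$ act.
  let W := LinearMap.range (E 0 0)
  have hW : ∀ w : W, E 0 0 w = w := by
    rintro ⟨_, v, rfl⟩
    exact hE 0 0 0 v
  let eV : V ≃ₗ[K] (Fin p → W) :=
    { toFun := fun v s => ⟨E 0 s v, E 0 s v, hE 0 0 s v⟩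
      map_add' := fun v w => by ext; simp
      map_smul' := fun k v => by ext; simp
      invFun := fun w => ∑ s, E s 0 (w s)
      left_inv := fun v => by simp only [hE, hE1]
      right_inv := fun w => by
        funext s
        refine Subtype.ext ?_
        change E 0 s (∑ t, E t 0 (w t)) = w s
        rw [map_sum, Finset.sum_eq_single s (fun t _ hts => hE0 _ _ _ _ _ hts.symm) (by simp), hE,
          hW] }
  let D : A →ₐ[K] Module.End K V := φ.comp (Matrix.scalarAlgHom (Fin p) K)
  have hD : ∀ a s t v, D a (E s t v) = E s t (D a v) := fun a s t v => by
    rw [← Module.End.mul_apply, ← Module.End.mul_apply]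
    simp only [D, E, AlgHom.comp_apply, ← map_mul]
    congr 2
    ext j k
    by_cases hj : s = j ∧ t = k <;> simp [Matrix.scalarAlgHom, hj]
  refine ⟨W, inferInstance, inferInstance, AlgHom.ofLinearMap
    { toFun := fun a => (D a).restrict (p := W) (q := W) (by
        rintro _ ⟨v, rfl⟩
        exact ⟨D a v, (hD a 0 0 v).symm⟩)
      map_add' := fun a b => by ext; simp
      map_smul' := fun k a => by ext; simp } (by ext; simp) (fun a b => by ext; simp), ?_⟩
  have h3 := eV.finrank_eq
  rw [Module.finrank_fin_fun, Module.finrank_pi_fintype] at h3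
  simp only [Finset.sum_const, Finset.card_univ, Fintype.card_fin, smul_eq_mul] at h3
  exact Nat.eq_of_mul_eq_mul_left (Nat.pos_of_ne_zero hp) (h3.symm.trans hq)

namespace IsBicyclicGal

/-- If `A(u, b₁, b₂)` is split, then its parameters are trivial up to a change of generators. -/
theorem exists_of_mk_eq_one (hG : IsBicyclicGal σ ρ) {A : CSA.{u, u} K}
    (hA : IsAbelianCrossedProduct σ ρ u b₁ b₂ A) (h1 : (⟦A⟧ : BrauerGroup.{u, u} K) = 1) :
    ∃ c d : M, c ≠ 0 ∧ d ≠ 0 ∧ c * σ d * u = d * ρ c ∧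
      partialNorm σ (orderOf σ) c * b₁ = 1 ∧ partialNorm ρ (orderOf ρ) d * b₂ = 1 := by
  have := hG.finiteDimensional
  rw [isAbelianCrossedProduct_iff] at hA
  obtain ⟨hA, i, x, y, h⟩ := hA
  obtain ⟨W, _, _, f, hW⟩ := CSA.exists_algHom_end_of_mk_eq_one hA h1
  have hWpos : 0 < Module.finrank K W := by rw [hW]; exact Module.finrank_pos
  have : FiniteDimensional K W := Module.finite_of_finrank_pos hWpos
  have : Nontrivial W := Module.nontrivial_of_finrank_pos hWpos
  let I : M →ₐ[K] Module.End K W := f.comp i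
  have hr : BicyclicRelations σ ρ u b₁ b₂ (I : M →+* Module.End K W) (f x) (f y) :=
    h.map (f : A →+* Module.End K W)
  have hI : ∀ c d w, I (c * d) w = I c (I d w) := fun c d w => by rw [map_mul]; rfl
  have hX : ∀ c w, f x (I c w) = I (σ c) (f x w) := fun c w => DFunLike.congr_fun (hr.x_mul c) w
  have hY : ∀ c w, f y (I c w) = I (ρ c) (f y w) := fun c w => DFunLike.congr_fun (hr.y_mul c) w
  obtain ⟨w, hw⟩ := exists_ne (0 : W)
  -- $\dim_KW=[M:K]$, so $W$ is a line over $M$ spanned by $w$, and the values at $w$ determine the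
  -- semilinear operators $x,y$.
  let T : M →ₗ[K] W := LinearMap.applyₗ w ∘ₗ I.toLinearMap
  have hT : ∀ c, T c = I c w := fun _ => rfl
  have hTi : Function.Injective T := by
    rw [← LinearMap.ker_eq_bot, LinearMap.ker_eq_bot']
    intro c hc
    by_contra hc0
    apply hw
    rw [← Module.End.one_apply (R := K) w, ← map_one I, ← inv_mul_cancel₀ hc0, hI, ← hT c, hc,
      map_zero]
  have hTs : Function.Surjective T :=
    (LinearMap.injective_iff_surjective_of_finrank_eq_finrank (f := T) hW.symm).1 hTi
  -- The inverse is taken so that $cx$ and $dy$ fix $w$, that is, so that rescaling by $c,d$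
  -- trivializes the parameters.
  have key : ∀ z : Module.End K W, IsUnit z → ∃ c : M, c ≠ 0 ∧ z w = I c⁻¹ w := by
    intro z hz
    obtain ⟨c, hc⟩ := hTs (z w)
    have hz0 : z w ≠ 0 := by
      intro h0
      obtain ⟨z', hz'⟩ := hz.exists_left_inv
      apply hw
      rw [← Module.End.one_apply (R := K) w, ← hz', Module.End.mul_apply, h0, map_zero]
    refine ⟨c⁻¹, inv_ne_zero ?_, by rw [inv_inv, ← hc, hT]⟩
    rintro rfl
    exact hz0 (by rw [← hc, map_zero])
  obtain ⟨c, hc, hxw⟩ := key _ hr.isUnit_x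
  obtain ⟨d, hd, hyw⟩ := key _ hr.isUnit_y
  have hpow : ∀ (τ : M ≃ₐ[K] M) (z : Module.End K W) (c : M),
      (∀ c w, z (I c w) = I (τ c) (z w)) → z w = I c⁻¹ w →
      ∀ k, (z ^ k) w = I (partialNorm τ k c⁻¹) w := by
    intro τ z c hz hzw k
    induction k with
    | zero => simp [partialNorm]
    | succ k ih =>
      rw [pow_succ', Module.End.mul_apply, ih, hz, hzw, ← hI, partialNorm_succ', mul_comm]
  refine ⟨c, d, hc, hd, ?_, ?_, ?_⟩
  · have h2 : f x (f y w) = I u (f y (f x w)) := DFunLike.congr_fun hr.x_mul_y w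
    rw [hyw, hX, hxw, hY, hyw, ← hI, ← hI, ← hI] at h2
    have h3 := hTi h2
    have hσd : σ d ≠ 0 := (map_ne_zero _).2 hd
    have hρc : ρ c ≠ 0 := (map_ne_zero _).2 hc
    rw [map_inv₀, map_inv₀] at h3
    field_simp at h3
    linear_combination -h3
  · have h2 := hpow σ (f x) c hX hxw (orderOf σ)
    rw [hr.x_pow] at h2
    have h3 : (b₁ : M) = _ := hTi h2
    rw [h3, ← partialNorm_mul, mul_inv_cancel₀ hc, partialNorm_one]
  · have h2 := hpow ρ (f y) d hY hyw (orderOf ρ)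
    rw [hr.y_pow] at h2
    have h3 : (b₂ : M) = _ := hTi h2
    rw [h3, ← partialNorm_mul, mul_inv_cancel₀ hd, partialNorm_one]

/-- Replacing `x` by `c x` and `y` by `d y`. -/
theorem _root_.BicyclicRelations.rescale {R : Type*} [Ring R] {i : M →+* R} {x y : R}
    (h : BicyclicRelations σ ρ u b₁ b₂ i x y) (c d : Mˣ) {v : Mˣ}
    (hv : (d : M) * ρ c * v = c * σ d * u)
    {b₁' b₂' : Mˣ} (hb₁ : (b₁' : M) = partialNorm σ (orderOf σ) c * b₁)
    (hb₂ : (b₂' : M) = partialNorm ρ (orderOf ρ) d * b₂) :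
    BicyclicRelations σ ρ v b₁' b₂' i (i c * x) (i d * y) := by
  have hpow : ∀ (τ : M ≃ₐ[K] M) (z : R) (c : M), (∀ c, z * i c = i (τ c) * z) →
      ∀ k, (i c * z) ^ k = i (partialNorm τ k c) * z ^ k := by
    intro τ z c hz k
    induction k with
    | zero => simp [partialNorm]
    | succ k ih =>
      rw [pow_succ', ih, mul_assoc, ← mul_assoc z, hz, partialNorm_succ', map_mul, pow_succ']
      simp only [mul_assoc]
  refine ⟨fun m => ?_, fun m => ?_, ?_, ?_, ?_⟩
  · rw [mul_assoc, h.x_mul, ← mul_assoc, ← map_mul, mul_comm, map_mul, mul_assoc]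
  · rw [mul_assoc, h.y_mul, ← mul_assoc, ← map_mul, mul_comm, map_mul, mul_assoc]
  · rw [hpow σ x c h.x_mul, h.x_pow, ← map_mul, hb₁]
  · rw [hpow ρ y d h.y_mul, h.y_pow, ← map_mul, hb₂]
  · calc i c * x * (i d * y) = i (c * σ d) * (x * y) := by
          rw [mul_assoc, ← mul_assoc x, h.x_mul, map_mul]; simp only [mul_assoc]
      _ = i (v * (d * ρ c)) * (y * x) := by
          rw [h.x_mul_y, ← mul_assoc, ← map_mul, ← hv, mul_comm (v : M)]
      _ = i v * (i d * y * (i c * x)) := by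
          rw [mul_assoc (i d), ← mul_assoc y, h.y_mul, map_mul, map_mul]; simp only [mul_assoc]

theorem isAbelianCrossedProduct_rescale (hG : IsBicyclicGal σ ρ) {A : CSA.{u, u} K}
    (hA : IsAbelianCrossedProduct σ ρ u b₁ b₂ A) (c d : Mˣ) {v : Mˣ}
    (hv : (d : M) * ρ c * v = c * σ d * u)
    {b₁' b₂' : Mˣ} (hb₁ : (b₁' : M) = partialNorm σ (orderOf σ) c * b₁)
    (hb₂ : (b₂' : M) = partialNorm ρ (orderOf ρ) d * b₂) :
    IsAbelianCrossedProduct σ ρ v b₁' b₂' A := by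
  have := hG.finiteDimensional
  rw [isAbelianCrossedProduct_iff] at hA ⊢
  obtain ⟨hA, i, x, y, h⟩ := hA
  exact ⟨hA, i, _, _, h.rescale c d hv hb₁ hb₂⟩

end IsBicyclicGal

end Split

/-! ### Necessity of the cocycle conditions. -/

section Cocycle

variable {K M R : Type*} [Field K] [Field M] [Algebra K M] [Ring R]
  {σ ρ : M ≃ₐ[K] M} {u b₁ b₂ : Mˣ} {i : M →+* R} {x y : R}

/-- Each condition comes from evaluating one product in two ways: $x\cdot x^n$, $y\cdot y^\ell$,
$x^n\cdot y$ and $x\cdot y^\ell$. -/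
theorem BicyclicRelations.cocycle [FiniteDimensional K M] [Nontrivial R]
    (h : BicyclicRelations σ ρ u b₁ b₂ i x y) : BicyclicCocycle σ ρ u b₁ b₂ := by
  have hx := h.isUnit_x
  have hy := h.isUnit_y
  have hyx : ∀ k, i (partialNorm σ k u) * (y * x ^ k) = x ^ k * y := by
    intro k
    induction k with
    | zero => simp [partialNorm]
    | succ k ih =>
      rw [pow_succ, mul_assoc, h.x_mul_y, ← mul_assoc _ (i u), pow_mul_of_semiconj h.x_mul,
        mul_assoc _ (x ^ k), ← mul_assoc (x ^ k), ← ih, partialNorm_succ, mul_comm, map_mul,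
        mul_assoc (i _)]
      simp only [mul_assoc]
  have hxy : ∀ k, x * y ^ k = i (partialNorm ρ k u) * (y ^ k * x) := by
    intro k
    induction k with
    | zero => simp [partialNorm]
    | succ k ih =>
      rw [pow_succ, ← mul_assoc, ih, mul_assoc, mul_assoc, h.x_mul_y, ← mul_assoc (y ^ k) (i _),
        pow_mul_of_semiconj h.y_mul, partialNorm_succ, map_mul]
      simp only [mul_assoc]
  refine ⟨?_, ?_, ?_, ?_⟩
  · refine i.injective (hx.mul_right_cancel ?_)
    rw [← h.x_mul, ← h.x_pow, ← pow_succ, ← pow_succ']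
  · refine i.injective (hy.mul_right_cancel ?_)
    rw [← h.y_mul, ← h.y_pow, ← pow_succ, ← pow_succ']
  · refine i.injective (hy.mul_right_cancel ?_)
    rw [map_mul, mul_assoc, ← h.y_mul, ← h.x_pow, hyx]
  · refine i.injective (hx.mul_right_cancel ?_)
    rw [← h.x_mul, map_mul, mul_assoc, ← h.y_pow, ← hxy]

end Cocycle

/-! ### Hilbert 90 for involutions. -/

section HilbertNinety

/-- Hilbert's Theorem 90 for an automorphism of order two. -/
theorem exists_mul_apply_eq {K M : Type*} [Field K] [Field M] [Algebra K M] (g : M ≃+* M)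
    (hg : ∀ m, g (g m) = m) {a : K} (ha : g (algebraMap K M a) ≠ algebraMap K M a)
    (ha' : g (algebraMap K M a) ∈ (algebraMap K M).range) {m : M} (hm : m * g m = 1) :
    ∃ r : M, r ≠ 0 ∧ m * g r = r ∧ ∀ E : IntermediateField K M, m ∈ E → r ∈ E := by
  have key : ∀ b, m * g (b + m * g b) = b + m * g b := fun b => by
    rw [map_add, map_mul, hg, mul_add, ← mul_assoc, hm, one_mul, add_comm]
  -- The solution is $b+m\,g(b)$ with $b=1$. If that vanishes then $m=-1$, and $b=a$ gives
  -- $a-g(a)\ne0$.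
  by_cases h1 : 1 + m * g 1 = 0
  · refine ⟨_, fun h2 => ha ?_, key (algebraMap K M a), fun E hE =>
      E.add_mem (E.algebraMap_mem a) (E.mul_mem hE ?_)⟩
    · rw [map_one, mul_one, add_comm] at h1
      rw [eq_neg_of_add_eq_zero_left h1, neg_one_mul, add_neg_eq_zero] at h2
      exact h2.symm
    · obtain ⟨b, hb⟩ := ha'
      exact hb ▸ E.algebraMap_mem b
  · exact ⟨_, h1, key 1, fun E hE => E.add_mem E.one_mem
      (E.mul_mem hE (by rw [map_one]; exact E.one_mem))⟩

end HilbertNinety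

/-! ### Matrix representations of central simple algebras. -/

section SkolemNoether

variable {K M A : Type u} [Field K] [Field M] [Algebra K M] {n : ℕ} [Ring A] [Algebra K A]
  [Algebra.IsCentral K A] [IsSimpleRing A] [FiniteDimensional K A]

/-- The `M`-linear extension of a matrix representation. -/
noncomputable def liftMatrix {A : Type*} [Ring A] [Algebra K A]
    (j : A →ₐ[K] Matrix (Fin n) (Fin n) M) : M ⊗[K] A →ₐ[M] Matrix (Fin n) (Fin n) M :=
  Algebra.TensorProduct.lift (Algebra.ofId M (Matrix (Fin n) (Fin n) M)) j
    fun _ _ => Algebra.commute_algebraMap_left _ _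

theorem liftMatrix_tmul {A : Type*} [Ring A] [Algebra K A]
    (j : A →ₐ[K] Matrix (Fin n) (Fin n) M) (m : M) (a : A) :
    liftMatrix j (m ⊗ₜ a) = m • j a := by
  rw [Algebra.smul_def]
  exact Algebra.TensorProduct.lift_tmul _ _ _ _ _

theorem bijective_liftMatrix (hn : n ≠ 0) (hA : Module.finrank K A = n ^ 2)
    (j : A →ₐ[K] Matrix (Fin n) (Fin n) M) :
    Function.Bijective (liftMatrix j) := by
  have : NeZero n := ⟨hn⟩
  have : IsSimpleRing (A ⊗[K] M) := CentralSimple.isSimpleRing_tensorProduct K A M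
  have : IsSimpleRing (M ⊗[K] A) :=
    IsSimpleRing.of_ringEquiv (Algebra.TensorProduct.comm K A M).toRingEquiv this
  refine AlgHom.bijective_of_finrank_eq _ ?_
  rw [Module.finrank_baseChange, hA, Module.finrank_matrix]
  simp [sq]

/-- Two representations of a central simple algebra of degree `n` by `n × n`-matrices are
conjugate. -/
theorem exists_conj_matrix (hn : n ≠ 0) (hA : Module.finrank K A = n ^ 2)
    (j j' : A →ₐ[K] Matrix (Fin n) (Fin n) M) :
    ∃ P : Matrix (Fin n) (Fin n) M, IsUnit P ∧ ∀ a, P * j a = j' a * P := by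
  let e := AlgEquiv.ofBijective _ (bijective_liftMatrix hn hA j)
  let e' := AlgEquiv.ofBijective _ (bijective_liftMatrix hn hA j')
  have he : ∀ a, e (1 ⊗ₜ a) = j a := fun a => (liftMatrix_tmul j 1 a).trans (one_smul _ _)
  have he' : ∀ a, e' (1 ⊗ₜ a) = j' a := fun a => (liftMatrix_tmul j' 1 a).trans (one_smul _ _)
  let t : Matrix (Fin n) (Fin n) M ≃ₐ[M] Module.End M (Fin n → M) := Matrix.toLinAlgEquiv'
  -- The two isomorphisms $M\otimes_KA\cong M_n(M)$ differ by an automorphism of a full matrix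
  -- algebra, which is inner.
  obtain ⟨T, hT⟩ := ((t.symm.trans (e.symm.trans e')).trans t).eq_linearEquivConjAlgEquiv
  refine ⟨t.symm T.toLinearMap, ?_, fun a => ?_⟩
  · exact ((Module.End.isUnit_iff _).2 T.bijective).map t.symm
  · have h1 : e.symm (j a) = 1 ⊗ₜ a := by rw [← he, e.symm_apply_apply]
    have h2 := DFunLike.congr_fun hT (t (j a))
    simp only [AlgEquiv.trans_apply, AlgEquiv.symm_apply_apply, h1, he'] at h2
    apply t.injective
    rw [map_mul, map_mul, t.apply_symm_apply, h2]
    ext v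
    simp [LinearEquiv.conjAlgEquiv]

/-- The matrices that commute with an irreducible representation are scalar. -/
theorem exists_eq_smul_one (hn : n ≠ 0) (hA : Module.finrank K A = n ^ 2)
    (j : A →ₐ[K] Matrix (Fin n) (Fin n) M) {S : Matrix (Fin n) (Fin n) M}
    (hS : ∀ a, S * j a = j a * S) : ∃ m : M, S = m • (1 : Matrix (Fin n) (Fin n) M) := by
  have hc : S ∈ Subalgebra.center M (Matrix (Fin n) (Fin n) M) := by
    rw [Subalgebra.mem_center_iff]
    intro B
    obtain ⟨t, rfl⟩ := (bijective_liftMatrix hn hA j).2 B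
    induction t using TensorProduct.induction_on with
    | zero => simp
    | add t t' ht ht' => rw [map_add, add_mul, mul_add, ht, ht']
    | tmul m a =>
      rw [liftMatrix_tmul, smul_mul_assoc, mul_smul_comm, hS]
  have : NeZero n := ⟨hn⟩
  obtain ⟨m, hm⟩ := Algebra.mem_bot.1 (Algebra.IsCentral.out hc)
  exact ⟨m, by rw [← hm, Algebra.algebraMap_eq_smul_one]⟩

end SkolemNoether

/-! ### Semilinear operators commuting with a representation, and invariant forms. -/

section Dihedral

variable {F K M : Type u} [Field F] [Field K] [Field M] [Algebra K M] [Algebra F M]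

/-- `Gal(M/F)` is generalized dihedral over `Gal(M/K) = ⟨σ⟩ × ⟨ρ⟩`, and `θ` is an element of the
complement of `Gal(M/K)`. -/
structure IsDihedralGal [Algebra F K] (σ ρ : M ≃ₐ[K] M) (θ : M ≃ₐ[F] M) : Prop extends
    IsBicyclicGal σ ρ where
  involutive : ∀ m, θ (θ m) = m
  conj_σ : ∀ m, σ (θ (σ m)) = θ m
  conj_ρ : ∀ m, ρ (θ (ρ m)) = θ m
  restrict : ∃ s : K ≃ₐ[F] K, s ≠ 1 ∧ ∀ k, θ (algebraMap K M k) = algebraMap K M (s k)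

namespace IsDihedralGal

variable [Algebra F K] {σ ρ : M ≃ₐ[K] M} {θ : M ≃ₐ[F] M}

/-- When $h\theta h=\theta$, the map $h\theta$ is an involution of $M$ that acts nontrivially on
$K$, so Hilbert 90 for involutions applies to it. -/
theorem exists_mul_apply_eq_of_commutes (hG : IsDihedralGal σ ρ θ) (h : M ≃ₐ[K] M)
    (hh : ∀ m, h (θ (h m)) = θ m) {m : M} (hm : m * h (θ m) = 1) :
    ∃ r : M, r ≠ 0 ∧ m * h (θ r) = r ∧ ∀ E : IntermediateField K M, m ∈ E → r ∈ E := by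
  obtain ⟨s, hs1, hs⟩ := hG.restrict
  obtain ⟨a, ha⟩ : ∃ a, s a ≠ a := by
    by_contra! hcon
    exact hs1 (AlgEquiv.ext hcon)
  let g : M ≃+* M := (θ : M ≃+* M).trans (h : M ≃+* M)
  have hg : ∀ m, g m = h (θ m) := fun _ => rfl
  have hgK : ∀ k, g (algebraMap K M k) = algebraMap K M (s k) := fun k => by
    rw [hg, hs, h.commutes]
  refine exists_mul_apply_eq (K := K) g (fun m => ?_) (a := a) ?_ ⟨s a, (hgK a).symm⟩ hm
  · rw [hg, hg, hh, hG.involutive]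
  · rw [hgK]
    exact fun hc => ha ((algebraMap K M).injective hc)

end IsDihedralGal

/-- The invertible operators on `Mⁿ` that are `h`-semilinear and commute with the image of `j`. -/
structure IsSemiCommuting {K M A : Type*} [Field K] [Field M] [Algebra K M] [Ring A] [Algebra K A]
    {n : ℕ} (j : A →ₐ[K] Matrix (Fin n) (Fin n) M) (h : M ≃ₐ[K] M)
    (X : Module.End K (Fin n → M)) : Prop where
  bijective : Function.Bijective X
  smul : ∀ (m : M) v, X (m • v) = h m • X v
  mulVec : ∀ a v, X ((j a).mulVec v) = (j a).mulVec (X v)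

namespace IsSemiCommuting

variable {A : Type u} [Ring A] [Algebra K A] {n : ℕ} {j : A →ₐ[K] Matrix (Fin n) (Fin n) M}
  {h h' : M ≃ₐ[K] M}
  {X Y : Module.End K (Fin n → M)}

theorem mul (hX : IsSemiCommuting j h X) (hY : IsSemiCommuting j h' Y) :
    IsSemiCommuting j (h * h') (X * Y) where
  bijective := hX.bijective.comp hY.bijective
  smul m v := by simp [hY.smul, hX.smul]
  mulVec a v := by simp [hY.mulVec, hX.mulVec]

theorem one : IsSemiCommuting j 1 (1 : Module.End K (Fin n → M)) where
  bijective := Function.bijective_id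
  smul _ _ := rfl
  mulVec _ _ := rfl

theorem pow (hX : IsSemiCommuting j h X) (k : ℕ) : IsSemiCommuting j (h ^ k) (X ^ k) := by
  induction k with
  | zero => exact one
  | succ k ih => rw [pow_succ, pow_succ]; exact ih.mul hX

theorem smul_mul (hX : IsSemiCommuting j h X) {m : M} (hm : m ≠ 0) :
    IsSemiCommuting j h (Algebra.lsmul K K (Fin n → M) m * X) where
  bijective := (MulAction.bijective₀ hm).comp hX.bijective
  smul c v := by
    change m • X (c • v) = h c • m • X v
    rw [hX.smul, smul_comm]
  mulVec a v := by
    change m • X _ = _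
    rw [hX.mulVec, ← Matrix.mulVec_smul]
    rfl

variable [Algebra.IsCentral K A] [IsSimpleRing A] [FiniteDimensional K A]

/-- $XY^{-1}$ is $M$-linear and commutes with $j(A)$, hence is a scalar. -/
theorem exists_eq (hn : n ≠ 0) (hA : Module.finrank K A = n ^ 2) (hX : IsSemiCommuting j h X)
    (hY : IsSemiCommuting j h Y) : ∃ m : Mˣ, ∀ v, X v = (m : M) • Y v := by
  let e := LinearEquiv.ofBijective Y hY.bijective
  have he : ∀ v, e.symm (Y v) = v := fun v => e.symm_apply_apply v
  let Z : (Fin n → M) →ₗ[M] (Fin n → M) :=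
    { toFun := fun v => X (e.symm v)
      map_add' := by simp
      map_smul' := fun m v => by
        obtain ⟨v, rfl⟩ := hY.bijective.2 v
        obtain ⟨m, rfl⟩ := h.surjective m
        rw [he, ← hY.smul, he, hX.smul]
        rfl }
  have hZ : ∀ v, Z (Y v) = X v := fun v => congrArg X (he v)
  let S := Matrix.toLinAlgEquiv'.symm Z
  have hS : ∀ v, S.mulVec v = Z v := fun v => by
    change Matrix.toLinAlgEquiv' S v = Z v
    rw [AlgEquiv.apply_symm_apply]
  obtain ⟨m, hm⟩ := exists_eq_smul_one hn hA j (S := S) fun a => by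
    refine Matrix.toLin'.injective (LinearMap.ext fun v => ?_)
    obtain ⟨v, rfl⟩ := hY.bijective.2 v
    rw [Matrix.toLin'_apply, Matrix.toLin'_apply, ← Matrix.mulVec_mulVec, ← Matrix.mulVec_mulVec,
      hS, hS, hZ, ← hX.mulVec, ← hY.mulVec, hZ]
  have key : ∀ v, X v = m • Y v := fun v => by
    rw [← hZ, ← hS, hm, Matrix.smul_mulVec, Matrix.one_mulVec]
  have hm0 : m ≠ 0 := by
    rintro rfl
    have : NeZero n := ⟨hn⟩
    obtain ⟨v, hv⟩ := exists_ne (0 : Fin n → M)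
    exact hv (hX.bijective.1 (by rw [key, zero_smul, map_zero]))
  exact ⟨Units.mk0 m hm0, key⟩

/-- Applying $h$ to the entries of $j$ gives another representation, conjugate to $j$ by some $P$;
the operator is $v\mapsto P\,h(v)$. -/
theorem exists_isSemiCommuting (hn : n ≠ 0) (hA : Module.finrank K A = n ^ 2)
    (j : A →ₐ[K] Matrix (Fin n) (Fin n) M) (h : M ≃ₐ[K] M) : ∃ X, IsSemiCommuting j h X := by
  obtain ⟨P, hP, hPj⟩ := exists_conj_matrix hn hA ((h : M →ₐ[K] M).mapMatrix.comp j) j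
  have hPj' : ∀ a, P * (j a).map h = j a * P := hPj
  have hPb : Function.Bijective P.mulVec :=
    ⟨Matrix.mulVec_injective_iff_isUnit.2 hP, Matrix.mulVec_surjective_iff_isUnit.2 hP⟩
  refine ⟨
    { toFun := fun v => P.mulVec (h ∘ v)
      map_add' := fun v w => by
        rw [← Matrix.mulVec_add]
        congr 1
        ext
        simp
      map_smul' := fun k v => by
        rw [RingHom.id_apply, ← Matrix.mulVec_smul]
        congr 1
        ext
        simp }, ?_, ?_, ?_⟩
  · exact hPb.comp ⟨h.injective.comp_left, h.surjective.comp_left⟩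
  · intro m v
    change P.mulVec _ = h m • P.mulVec _
    rw [← Matrix.mulVec_smul]
    congr 1
    ext
    simp
  · intro a v
    change P.mulVec _ = (j a).mulVec (P.mulVec _)
    rw [Matrix.mulVec_mulVec, ← hPj', ← Matrix.mulVec_mulVec]
    congr 1
    ext s
    simp [Matrix.mulVec, dotProduct]

end IsSemiCommuting

/-- A form on `Mⁿ` that is `θ`-semilinear in the first variable and linear in the second one, for
which `j (τ a)` is adjoint to `j a`. -/
structure IsInvariantForm {F K M A : Type*} [Field F] [Field K] [Field M] [Algebra F M]
    [Algebra K M] [Ring A] [Algebra K A] {n : ℕ} (θ : M ≃ₐ[F] M)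
    (j : A →ₐ[K] Matrix (Fin n) (Fin n) M) (τ : A → A) (b : (Fin n → M) → (Fin n → M) → M) :
    Prop where
  add_left : ∀ v v' w, b (v + v') w = b v w + b v' w
  add_right : ∀ v w w', b v (w + w') = b v w + b v w'
  smul_left : ∀ (m : M) v w, b (m • v) w = θ m * b v w
  smul_right : ∀ (m : M) v w, b v (m • w) = m * b v w
  adjoint : ∀ a v w, b ((j (τ a)).mulVec v) w = b v ((j a).mulVec w)

theorem IsInvariantForm.eq_dotProduct {A : Type*} [Ring A] [Algebra K A] {n : ℕ} {θ : M ≃ₐ[F] M}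
    {j : A →ₐ[K] Matrix (Fin n) (Fin n) M} {τ : A → A} {b : (Fin n → M) → (Fin n → M) → M}
    (hb : IsInvariantForm θ j τ b) (v w : Fin n → M) :
    b v w = (θ ∘ v) ⬝ᵥ (Matrix.of fun s t => b (Pi.single s 1) (Pi.single t 1)).mulVec w := by
  have hsum : ∀ v : Fin n → M, v = ∑ s, v s • Pi.single s (1 : M) := fun v => by
    conv_lhs => rw [← Finset.univ_sum_single v]
    refine Finset.sum_congr rfl fun s _ => ?_
    rw [← Pi.single_smul, smul_eq_mul, mul_one]
  let L (w) : (Fin n → M) →+ M := AddMonoidHom.mk' (fun v => b v w) fun v v' => hb.add_left v v' w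
  let R (v) : (Fin n → M) →+ M := AddMonoidHom.mk' (fun w => b v w) fun w w' => hb.add_right v w w'
  have h1 : b v w = ∑ s, θ (v s) * b (Pi.single s 1) w := by
    conv_lhs => rw [hsum v]
    exact (map_sum (L w) _ _).trans (Finset.sum_congr rfl fun s _ => hb.smul_left _ _ _)
  have h2 : ∀ v, b v w = ∑ s, w s * b v (Pi.single s 1) := fun v => by
    conv_lhs => rw [hsum w]
    exact (map_sum (R v) _ _).trans (Finset.sum_congr rfl fun s _ => hb.smul_right _ _ _)
  rw [h1, dotProduct]
  refine Finset.sum_congr rfl fun s _ => ?_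
  rw [h2, Matrix.mulVec, dotProduct]
  simp only [Matrix.of_apply, mul_comm (w _)]
  rfl

theorem IsInvariantForm.apply_swap {A : Type*} [Ring A] [Algebra K A] {n : ℕ} {θ : M ≃ₐ[F] M}
    {j : A →ₐ[K] Matrix (Fin n) (Fin n) M} {τ : A → A} {b : (Fin n → M) → (Fin n → M) → M}
    (hb : IsInvariantForm θ j τ b) (hθ : ∀ m, θ (θ m) = m) (hτ : ∀ a, τ (τ a) = a) :
    IsInvariantForm θ j τ fun v w => θ (b w v) where
  add_left v v' w := by simp [hb.add_right]
  add_right v w w' := by simp [hb.add_left]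
  smul_left m v w := by simp [hb.smul_right]
  smul_right m v w := by simp [hb.smul_left, hθ]
  adjoint a v w := by rw [← hb.adjoint, hτ]

theorem IsInvariantForm.const_mul {A : Type*} [Ring A] [Algebra K A] {n : ℕ} {θ : M ≃ₐ[F] M}
    {j : A →ₐ[K] Matrix (Fin n) (Fin n) M} {τ : A → A} {b : (Fin n → M) → (Fin n → M) → M}
    (hb : IsInvariantForm θ j τ b) (r : M) : IsInvariantForm θ j τ fun v w => r * b v w where
  add_left v v' w := by rw [hb.add_left, mul_add]
  add_right v w w' := by rw [hb.add_right, mul_add]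
  smul_left m v w := by rw [hb.smul_left, mul_left_comm]
  smul_right m v w := by rw [hb.smul_right, mul_left_comm]
  adjoint a v w := by rw [hb.adjoint]

section Form

variable {A : Type u} [Ring A] [Algebra K A] [Algebra.IsCentral K A] [IsSimpleRing A]
  [FiniteDimensional K A] {n : ℕ} {σ ρ : M ≃ₐ[K] M} {θ : M ≃ₐ[F] M}

/-- $a\mapsto{}^t\theta(j(\tau a))$ is again a $K$-algebra representation: $\tau$ and transposition
both reverse products, and $\tau$ and $\theta$ agree on $K$. Gram matrices of invariant forms are
the intertwiners from $j$ to it, so an invertible one exists and all others are its multiples. -/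
theorem exists_isInvariantForm [Algebra F K] [Algebra.IsQuadraticExtension F K] [IsGalois F K]
    (hn : n ≠ 0)
    (hA : Module.finrank K A = n ^ 2)
    (j : A →ₐ[K] Matrix (Fin n) (Fin n) M) (hG : IsDihedralGal σ ρ θ) {τ : A → A}
    (hτ : IsUnitaryInvolution F K τ) :
    ∃ b, IsInvariantForm θ j τ b ∧ (∀ w, (∀ v, b v w = 0) → w = 0) ∧
      ∀ b', IsInvariantForm θ j τ b' → ∃ m : M, ∀ v w, b' v w = m * b v w := by
  obtain ⟨s, hs1, hs⟩ := hG.restrict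
  obtain ⟨s', -, hs'⟩ := IsUnitaryInvolution.exists_conj F K
  obtain rfl := hs' s hs1
  have hτK := hτ.apply_algebraMap hs'
  have hτ1 : τ 1 = 1 := by simpa using hτK 1
  have hτ0 : τ 0 = 0 := by simpa using hτK 0
  let j' : A →ₐ[K] Matrix (Fin n) (Fin n) M :=
    { toFun := fun a => ((j (τ a)).map θ).transpose
      map_one' := by simp [hτ1]
      map_mul' := fun a b => by simp [hτ.map_mul, Matrix.map_mul]
      map_zero' := by simp [hτ0]
      map_add' := fun a b => by simp [hτ.map_add, Matrix.map_add]
      commutes' := fun k => by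
        rw [hτK, AlgHom.commutes, Matrix.algebraMap_eq_diagonal, Matrix.algebraMap_eq_diagonal,
          Matrix.diagonal_map (map_zero θ), Matrix.diagonal_transpose]
        congr 1
        funext t
        change θ (algebraMap K M (s k)) = algebraMap K M k
        rw [← hs, hG.involutive] }
  obtain ⟨Q, hQ, hQj⟩ := exists_conj_matrix hn hA j j'
  have hj' : ∀ a, j' a = ((j (τ a)).map θ).transpose := fun _ => rfl
  have hdot : ∀ a v w, (θ ∘ (j (τ a)).mulVec v) ⬝ᵥ w = (θ ∘ v) ⬝ᵥ (j' a).mulVec w := by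
    intro a v w
    rw [hj', Matrix.dotProduct_mulVec, Matrix.vecMul_transpose]
    congr 1
    ext t
    simp [Matrix.mulVec, dotProduct]
  refine ⟨fun v w => (θ ∘ v) ⬝ᵥ Q.mulVec w, ⟨?_, ?_, ?_, ?_, ?_⟩, ?_, ?_⟩
  · intro v v' w
    rw [← add_dotProduct]
    congr 1
    ext
    simp
  · intro v w w'
    rw [Matrix.mulVec_add, dotProduct_add]
  · intro m v w
    rw [← smul_eq_mul, ← smul_dotProduct]
    congr 1
    ext
    simp
  · intro m v w
    rw [Matrix.mulVec_smul, dotProduct_smul, smul_eq_mul]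
  · intro a v w
    rw [hdot, Matrix.mulVec_mulVec, Matrix.mulVec_mulVec, hQj]
  · intro w hw
    refine Matrix.mulVec_injective_iff_isUnit.2 hQ ?_
    rw [Matrix.mulVec_zero]
    ext t
    have : (θ ∘ (Pi.single t 1 : Fin n → M)) ⬝ᵥ Q.mulVec w = 0 := hw (Pi.single t 1)
    have h1 : θ ∘ (Pi.single t 1 : Fin n → M) = Pi.single t 1 := by
      ext r
      by_cases hr : r = t
      · subst hr; simp
      · simp [hr]
    rwa [h1, single_one_dotProduct] at this
  · intro b' hb'
    let Q' : Matrix (Fin n) (Fin n) M := Matrix.of fun s t => b' (Pi.single s 1) (Pi.single t 1)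
    have hQ' : ∀ v w, b' v w = (θ ∘ v) ⬝ᵥ Q'.mulVec w := hb'.eq_dotProduct
    have hQj' : ∀ a, Q' * j a = j' a * Q' := by
      intro a
      refine Matrix.toLin'.injective (LinearMap.ext fun w => ?_)
      rw [Matrix.toLin'_apply, Matrix.toLin'_apply]
      refine dotProduct_eq _ _ fun v => ?_
      obtain ⟨v, rfl⟩ := θ.surjective.comp_left v
      rw [dotProduct_comm, dotProduct_comm _ (θ ∘ v), ← Matrix.mulVec_mulVec,
        ← Matrix.mulVec_mulVec, ← hdot, ← hQ', ← hQ', hb'.adjoint]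
    obtain ⟨Q, rfl⟩ := hQ
    obtain ⟨m, hm⟩ := exists_eq_smul_one hn hA j
      (S := (↑Q⁻¹ : Matrix (Fin n) (Fin n) M) * Q') fun a => by
      rw [mul_assoc, hQj', ← mul_assoc, ← mul_assoc]
      congr 1
      rw [Units.inv_mul_eq_iff_eq_mul, ← mul_assoc, hQj, mul_assoc, Units.mul_inv, mul_one]
    refine ⟨m, fun v w => ?_⟩
    have : Q' = m • (Q : Matrix (Fin n) (Fin n) M) := by
      rw [Units.inv_mul_eq_iff_eq_mul] at hm
      rw [hm, mul_smul_comm, mul_one]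
    rw [hQ', this, Matrix.smul_mulVec, dotProduct_smul, smul_eq_mul]

end Form

end Dihedral

/-! ### From a unitary involution to admissible parameters. -/

section UnitaryCrossed

variable {F K M : Type u} [Field F] [Field K] [Field M] [Algebra F K] [Algebra K M] [Algebra F M]
  {σ ρ : M ≃ₐ[K] M} {θ : M ≃ₐ[F] M}

/-- The conditions on `(u, b₁, b₂)`, in terms of `σ`, `ρ` and `θ` only. -/
structure UnitaryCocycle (σ ρ : M ≃ₐ[K] M) (θ : M ≃ₐ[F] M) (u b₁ b₂ : Mˣ) : Prop extends
    BicyclicCocycle σ ρ u b₁ b₂ where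
  fixed₁ : θ b₁ = b₁
  fixed₂ : θ b₂ = b₂
  mul_eq_one : (u : M) * ρ (σ (θ u)) = 1

section Form

variable {A : Type u} [Ring A] [Algebra K A] {n : ℕ} {j : A →ₐ[K] Matrix (Fin n) (Fin n) M}

/-- The swapped form is $m$ times the original one. Swapping twice gives $m\theta(m)=1$, so Hilbert
90 provides a scalar that makes the form hermitian. -/
theorem exists_isInvariantForm_hermitian [Algebra.IsCentral K A] [IsSimpleRing A]
    [FiniteDimensional K A] [Algebra.IsQuadraticExtension F K] [IsGalois F K]
    (hn : n ≠ 0) (hA : Module.finrank K A = n ^ 2) (j : A →ₐ[K] Matrix (Fin n) (Fin n) M)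
    (hG : IsDihedralGal σ ρ θ) {τ : A → A} (hτ : IsUnitaryInvolution F K τ) :
    ∃ b, IsInvariantForm θ j τ b ∧ (∀ w, (∀ v, b v w = 0) → w = 0) ∧
      (∀ b', IsInvariantForm θ j τ b' → ∃ m : M, ∀ v w, b' v w = m * b v w) ∧
      ∀ v w, θ (b v w) = b w v := by
  obtain ⟨b, hb, hnd, huniq⟩ := exists_isInvariantForm hn hA j hG hτ
  obtain ⟨m, hm⟩ := huniq _ (hb.apply_swap hG.involutive hτ.involutive)
  have : NeZero n := ⟨hn⟩
  obtain ⟨w, hw⟩ := exists_ne (0 : Fin n → M)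
  obtain ⟨v, hv⟩ : ∃ v, b v w ≠ 0 := by
    by_contra! hcon
    exact hw (hnd w hcon)
  have hm1 : m * θ m = 1 := by
    have h1 := congrArg θ (hm w v)
    rw [hG.involutive, map_mul, hm] at h1
    refine mul_right_cancel₀ hv ?_
    linear_combination -h1
  obtain ⟨r, hr0, hr, -⟩ := hG.exists_mul_apply_eq_of_commutes 1 (fun _ => rfl) (m := m) hm1
  refine ⟨fun v w => r * b v w, hb.const_mul r, fun w hw => hnd w fun v =>
    (mul_eq_zero.1 (hw v)).resolve_left hr0, fun b' hb' => ?_, fun v w => ?_⟩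
  · obtain ⟨c, hc⟩ := huniq b' hb'
    exact ⟨c * r⁻¹, fun v w => by rw [hc, mul_assoc, inv_mul_cancel_left₀ hr0]⟩
  · have hr' : m * θ r = r := hr
    rw [map_mul, hm w v, ← mul_assoc, mul_comm (θ r), hr']

/-- Since $h\theta h=\theta$, the form $h(b(Xv,X^{-1}w))$ is again invariant, so it equals $m\,b$.
Hermitian symmetry gives $m\cdot h\theta(m)=1$, and Hilbert 90 for $h\theta$ yields the multiple of
$X$ to take. -/
theorem IsSemiCommuting.exists_selfAdjoint (hG : IsDihedralGal σ ρ θ) {τ : A → A}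
    {b : (Fin n → M) → (Fin n → M) → M} (hn : n ≠ 0) (hb : IsInvariantForm θ j τ b)
    (hnd : ∀ w, (∀ v, b v w = 0) → w = 0)
    (huniq : ∀ b', IsInvariantForm θ j τ b' → ∃ m : M, ∀ v w, b' v w = m * b v w)
    (hherm : ∀ v w, θ (b v w) = b w v) {h : M ≃ₐ[K] M} (hh : ∀ m, h (θ (h m)) = θ m)
    {X : Module.End K (Fin n → M)} (hX : IsSemiCommuting j h X) :
    ∃ Y, IsSemiCommuting j h Y ∧ ∀ v w, h (b (Y v) w) = b v (Y w) := by
  let e := LinearEquiv.ofBijective X hX.bijective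
  have he : ∀ v, e.symm (X v) = v := fun v => e.symm_apply_apply v
  have he_smul : ∀ m w, e.symm (m • w) = h.symm m • e.symm w := fun m w => by
    obtain ⟨w, rfl⟩ := hX.bijective.2 w
    obtain ⟨m, rfl⟩ := h.surjective m
    rw [← hX.smul, he, he, h.symm_apply_apply]
  have he_mulVec : ∀ a w, e.symm ((j a).mulVec w) = (j a).mulVec (e.symm w) := fun a w => by
    obtain ⟨w, rfl⟩ := hX.bijective.2 w
    rw [← hX.mulVec, he, he]
  obtain ⟨m, hm⟩ := huniq (fun v w => h (b (X v) (e.symm w)))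
    { add_left := fun v v' w => by rw [map_add, hb.add_left, map_add]
      add_right := fun v w w' => by rw [map_add, hb.add_right, map_add]
      smul_left := fun m v w => by rw [hX.smul, hb.smul_left, map_mul, hh]
      smul_right := fun m v w => by rw [he_smul, hb.smul_right, map_mul, h.apply_symm_apply]
      adjoint := fun a v w => by rw [hX.mulVec, hb.adjoint, he_mulVec] }
  have hm' : ∀ v w, h (b (X v) w) = m * b v (X w) := fun v w => by
    rw [← hm]
    simp only [he]
  have : NeZero n := ⟨hn⟩
  obtain ⟨v, hv⟩ := exists_ne (0 : Fin n → M)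
  obtain ⟨w, hw⟩ : ∃ w, b w (X v) ≠ 0 := by
    by_contra! hcon
    exact hv (hX.bijective.1 (by rw [hnd _ hcon, map_zero]))
  have hm1 : m * h (θ m) = 1 := by
    have h1 := congrArg (fun t => h (θ t)) (hm' v w)
    simp only [hh, hherm, map_mul] at h1
    rw [hm'] at h1
    refine mul_right_cancel₀ hw ?_
    rw [one_mul]
    linear_combination -h1
  obtain ⟨r, hr0, hr, -⟩ := hG.exists_mul_apply_eq_of_commutes h hh hm1
  refine ⟨_, hX.smul_mul hr0, fun v w => ?_⟩
  change h (b (r • X v) w) = b v (r • X w)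
  rw [hb.smul_left, map_mul, hm', hb.smul_right, ← mul_assoc, mul_comm (h _), hr]

end Form

/-- The class found is the inverse of $[A]$, because the crossed product acts on $M^n$ by operators
that commute with $A$. -/
theorem IsDihedralGal.exists_unitaryCocycle [Algebra.IsQuadraticExtension F K] [IsGalois F K]
    (hG : IsDihedralGal σ ρ θ) {A : CSA.{u, u} K} (hA : IsSplitBy K M A) {τ : A → A}
    (hτ : IsUnitaryInvolution F K τ) :
    ∃ (u b₁ b₂ : Mˣ) (B : CSA.{u, u} K), UnitaryCocycle σ ρ θ u b₁ b₂ ∧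
      IsAbelianCrossedProduct σ ρ u b₁ b₂ B ∧ (⟦B⟧ * ⟦A⟧ : BrauerGroup.{u, u} K) = 1 := by
  have := hG.finiteDimensional
  obtain ⟨n, ⟨e⟩⟩ := hA
  have hAn : Module.finrank K A = n ^ 2 := by
    have h1 := e.toLinearEquiv.finrank_eq
    rw [Module.finrank_baseChange, Module.finrank_matrix] at h1
    simpa [sq] using h1
  have hn : n ≠ 0 := by
    rintro rfl
    exact Module.finrank_pos.ne' (hAn.trans (by simp))
  have : NeZero n := ⟨hn⟩
  let j : A →ₐ[K] Matrix (Fin n) (Fin n) M :=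
    (e.toAlgHom.restrictScalars K).comp Algebra.TensorProduct.includeRight
  let V := Fin n → M
  let I : M →ₐ[K] Module.End K V := Algebra.lsmul K K V
  obtain ⟨b, hb, hnd, huniq, hherm⟩ := exists_isInvariantForm_hermitian hn hAn j hG hτ
  obtain ⟨X, hX⟩ := IsSemiCommuting.exists_isSemiCommuting hn hAn j σ
  obtain ⟨X, hX, hXb⟩ := hX.exists_selfAdjoint hG hn hb hnd huniq hherm hG.conj_σ
  obtain ⟨Y, hY⟩ := IsSemiCommuting.exists_isSemiCommuting hn hAn j ρ
  obtain ⟨Y, hY, hYb⟩ := hY.exists_selfAdjoint hG hn hb hnd huniq hherm hG.conj_ρ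
  obtain ⟨b₁, hb₁⟩ := IsSemiCommuting.exists_eq hn hAn (pow_orderOf_eq_one σ ▸ hX.pow (orderOf σ))
    IsSemiCommuting.one
  obtain ⟨b₂, hb₂⟩ := IsSemiCommuting.exists_eq hn hAn (pow_orderOf_eq_one ρ ▸ hY.pow (orderOf ρ))
    IsSemiCommuting.one
  obtain ⟨u, hu⟩ := IsSemiCommuting.exists_eq hn hAn (hX.mul hY)
    (hG.commute.eq ▸ hY.mul hX)
  have hrel : BicyclicRelations σ ρ u b₁ b₂ (I : M →+* Module.End K V) X Y :=
    { x_mul c := LinearMap.ext fun v => hX.smul c v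
      y_mul c := LinearMap.ext fun v => hY.smul c v
      x_pow := LinearMap.ext hb₁
      y_pow := LinearMap.ext hb₂
      x_mul_y := LinearMap.ext hu }
  have hpow : ∀ {h : M ≃ₐ[K] M} {Z : Module.End K V}, (∀ v w, h (b (Z v) w) = b v (Z w)) →
      ∀ (k : ℕ) v w, (h ^ k) (b ((Z ^ k) v) w) = b v ((Z ^ k) w) := by
    intro h Z hZ k
    induction k with
    | zero => intros; rfl
    | succ k ih =>
      intro v w
      rw [pow_succ', AlgEquiv.mul_apply, pow_succ, Module.End.mul_apply, ih, hZ, ← pow_succ,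
        pow_succ', Module.End.mul_apply]
  obtain ⟨w, hw⟩ := exists_ne (0 : V)
  obtain ⟨v, hv⟩ : ∃ v, b v w ≠ 0 := by
    by_contra! hcon
    exact hw (hnd w hcon)
  -- Moving the scalar $Z^{\operatorname{ord}(h)}=c$ across the form gives $\theta(c)=c$.
  have hfix : ∀ {h : M ≃ₐ[K] M} {Z : Module.End K V} {c : Mˣ},
      (∀ v w, h (b (Z v) w) = b v (Z w)) → (∀ v, (Z ^ orderOf h) v = (c : M) • v) →
      θ c = c := by
    intro h Z c hZ hc
    have h1 := hpow hZ (orderOf h) v w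
    rw [pow_orderOf_eq_one, AlgEquiv.one_apply, hc, hc, hb.smul_left, hb.smul_right] at h1
    exact mul_right_cancel₀ hv h1
  obtain ⟨B, hB⟩ := hG.exists_isAbelianCrossedProduct_of_relations hrel
  refine ⟨u, b₁, b₂, B, ⟨hrel.cocycle, hfix hXb hb₁, hfix hYb hb₂, ?_⟩, hB, ?_⟩
  · obtain ⟨w', rfl⟩ := (hY.bijective.comp hX.bijective).2 w
    -- Moving $XY$ and $YX$ across the form reverses them; comparing the two results through
    -- $XY=u\,YX$ gives $u\cdot\rho\sigma\theta(u)=1$.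
    have hu' : ∀ v, X (Y v) = (u : M) • Y (X v) := hu
    have h1 : ρ (σ (b (X (Y v)) w')) = b v (Y (X w')) := by rw [hXb, hYb]
    have h2 : σ (ρ (b (Y (X v)) w')) = b v (X (Y w')) := by rw [hYb, hXb]
    rw [hu', hb.smul_left, map_mul, map_mul] at h1
    have hc : ∀ m, σ (ρ m) = ρ (σ m) := fun m => DFunLike.congr_fun hG.commute.eq m
    rw [hc, hu', hb.smul_right] at h2
    rw [h2] at h1
    refine mul_right_cancel₀ hv ?_
    rw [one_mul]
    change (u : M) * ρ (σ (θ u)) * b v (Y (X w')) = b v (Y (X w'))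
    linear_combination h1
  · rw [isAbelianCrossedProduct_iff] at hB
    obtain ⟨hBdim, i, x, y, h⟩ := hB
    obtain ⟨f, hfi, hfx, hfy⟩ := hG.exists_algHom hBdim h hrel
    let g : A →ₐ[K] Module.End K V :=
      { toFun := fun a => ((j a).mulVecLin).restrictScalars K
        map_one' := LinearMap.ext fun v => by simp
        map_mul' := fun a b => LinearMap.ext fun v => by simp
        map_zero' := LinearMap.ext fun v => by simp
        map_add' := fun a b => LinearMap.ext fun v => by simp
        commutes' := fun k => LinearMap.ext fun v => by
          change (j (algebraMap K A k)).mulVec v = k • v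
          rw [j.commutes, Algebra.algebraMap_eq_smul_one, Matrix.smul_mulVec, Matrix.one_mulVec] }
    refine CSA.mk_mul_mk_eq_one f g (fun s a => ?_) ?_
    · refine BicyclicRelations.commute_of_surjective (hG.surjective h hBdim) f.toRingHom ?_ ?_ ?_ s
      · intro c
        change Commute (f (i c)) _
        rw [hfi]
        exact LinearMap.ext fun v => (Matrix.mulVec_smul (j a) c v).symm
      · change Commute (f x) _
        rw [hfx]
        exact LinearMap.ext fun v => hX.mulVec a v
      · change Commute (f y) _
        rw [hfy]
        exact LinearMap.ext fun v => hY.mulVec a v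
    · rw [hBdim, hAn, Module.finrank_pi_fintype]
      simp
      ring

end UnitaryCrossed

/-! ### The unitary involution of an admissible crossed product. -/

section Involution

variable {F K M : Type u} [Field F] [Field K] [Field M] [Algebra F K] [Algebra K M] [Algebra F M]
  {σ ρ : M ≃ₐ[K] M} {θ : M ≃ₐ[F] M} {u b₁ b₂ : Mˣ}

/-- In the opposite ring, with $M$ embedded through $\theta$, the old generators satisfy the same
relations. The conditions involving $\theta$ are what this requires. -/
theorem UnitaryCocycle.relations_op (h : UnitaryCocycle σ ρ θ u b₁ b₂)
    (hG : IsDihedralGal σ ρ θ) {A : Type*} [Ring A] {i : M →+* A} {x y : A}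
    (hr : BicyclicRelations σ ρ u b₁ b₂ i x y) (i' : M →+* Aᵐᵒᵖ)
    (hi' : ∀ m, i' m = MulOpposite.op (i (θ m))) :
    BicyclicRelations σ ρ u b₁ b₂ i' (MulOpposite.op x) (MulOpposite.op y) where
  x_mul c := by
    rw [hi', hi', ← MulOpposite.op_mul, ← MulOpposite.op_mul, hr.x_mul, hG.conj_σ]
  y_mul c := by
    rw [hi', hi', ← MulOpposite.op_mul, ← MulOpposite.op_mul, hr.y_mul, hG.conj_ρ]
  x_pow := by rw [hi', ← MulOpposite.op_pow, hr.x_pow, h.fixed₁]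
  y_pow := by rw [hi', ← MulOpposite.op_pow, hr.y_pow, h.fixed₂]
  x_mul_y := by
    rw [hi', ← MulOpposite.op_mul, ← MulOpposite.op_mul, ← MulOpposite.op_mul]
    congr 1
    have h1 : ρ (σ (θ u)) = σ (ρ (θ u)) := (DFunLike.congr_fun hG.commute.eq (θ u)).symm
    rw [hr.x_mul_y, mul_assoc, mul_assoc, hr.x_mul, ← mul_assoc y, hr.y_mul, mul_assoc,
      ← mul_assoc, ← map_mul, h.mul_eq_one, map_one, one_mul]

/-- The universal property turns `relations_op` into a homomorphism $A\to A^{\mathrm{op}}$. Its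
square is the identity on $M$, $x$ and $y$, hence everywhere. -/
theorem UnitaryCocycle.exists_isUnitaryInvolution [Algebra.IsQuadraticExtension F K] [IsGalois F K]
    (h : UnitaryCocycle σ ρ θ u b₁ b₂) (hG : IsDihedralGal σ ρ θ) {A : CSA.{u, u} K}
    (hA : IsAbelianCrossedProduct σ ρ u b₁ b₂ A) : ∃ τ : A → A, IsUnitaryInvolution F K τ := by
  have := hG.finiteDimensional
  have := hG.isGalois
  rw [isAbelianCrossedProduct_iff] at hA
  obtain ⟨hA, i, x, y, hr⟩ := hA
  have hs := hG.surjective hr hA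
  let i' : M →+* (A : Type u)ᵐᵒᵖ :=
    ((i : M →+* A).comp (θ : M →+* M)).toOpposite fun a b => by
      simp [Commute, SemiconjBy, ← map_mul, mul_comm]
  obtain ⟨f, hfi, hfx, hfy⟩ := hr.exists_lift (h.relations_op hG hr i' fun _ => rfl)
    hG.independent hs
  let τ : A → A := fun a => (f a).unop
  have hτi : ∀ m, τ (i m) = i (θ m) := fun m => congrArg MulOpposite.unop (hfi m)
  let τ₂ : A →+* A :=
    { toFun := fun a => τ (τ a)
      map_one' := by simp [τ]
      map_mul' := fun a b => by simp [τ]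
      map_zero' := by simp [τ]
      map_add' := fun a b => by simp [τ] }
  have hττ : τ₂ = RingHom.id A := by
    refine ringHom_ext_of_bicyclicSum_surjective hs (fun c => ?_) ?_ ?_
    · change τ (τ (i c)) = i c
      rw [hτi, hτi, hG.involutive]
    · change τ (τ x) = x
      rw [show τ x = x from congrArg MulOpposite.unop hfx,
        show τ x = x from congrArg MulOpposite.unop hfx]
    · change τ (τ y) = y
      rw [show τ y = y from congrArg MulOpposite.unop hfy,
        show τ y = y from congrArg MulOpposite.unop hfy]
  obtain ⟨s, hs1, hsθ⟩ := hG.restrict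
  obtain ⟨s', -, hs'⟩ := IsUnitaryInvolution.exists_conj F K
  obtain rfl := hs' s hs1
  have hτK : ∀ k, τ (algebraMap K A k) = algebraMap K A (s k) := fun k => by
    rw [← i.commutes, hτi, hsθ, i.commutes]
  have hinj : Function.Injective (algebraMap K A) := FaithfulSMul.algebraMap_injective K A
  refine ⟨τ, fun a b => by simp [τ], fun a b => by simp [τ], fun a => DFunLike.congr_fun hττ a,
    ?_, fun c => ?_⟩
  · by_contra! hcon
    exact hs1 (AlgEquiv.ext fun c => hinj ((hτK c).symm.trans (hcon c)))
  · rw [hτK, hinj.eq_iff, IsUnitaryInvolution.conj_fixed hs']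

theorem UnitaryCocycle.mk_mem_unitaryRelBrauer [Algebra.IsQuadraticExtension F K] [IsGalois F K]
    (h : UnitaryCocycle σ ρ θ u b₁ b₂) (hG : IsDihedralGal σ ρ θ) {A : CSA.{u, u} K}
    (hA : IsAbelianCrossedProduct σ ρ u b₁ b₂ A) :
    (⟦A⟧ : BrauerGroup.{u, u} K) ∈ unitaryRelBrauer F K M :=
  ⟨A, rfl, hG.isSplitBy hA, h.exists_isUnitaryInvolution hG hA⟩

end Involution

/-! ### Cyclic algebras. -/

section Cyclic

variable {K L : Type u} [Field K] [Field L] [Algebra K L]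

/-- Lets cyclic algebras be treated as abelian crossed products with $\rho=1$, $\ell=1$ and
$u=b_2=1$. -/
theorem isBicyclicGal_one [FiniteDimensional K L] [IsGalois K L] {s : L ≃ₐ[K] L}
    (hs : orderOf s = Module.finrank K L) : IsBicyclicGal s 1 where
  finiteDimensional := inferInstance
  isGalois := inferInstance
  commute := Commute.one_right s
  independent := by
    rintro ⟨a, a'⟩ ⟨b, b'⟩ h
    have : Subsingleton (Fin (orderOf (1 : L ≃ₐ[K] L))) := by rw [orderOf_one]; infer_instance
    simp only [one_pow, mul_one] at h
    exact Prod.ext (Fin.ext (pow_injOn_Iio_orderOf a.2 b.2 h)) (Subsingleton.elim _ _)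
  card := by rw [orderOf_one, mul_one, hs]

theorem exists_isCyclicAlgebra [FiniteDimensional K L] [IsGalois K L] {s : L ≃ₐ[K] L}
    (hs : orderOf s = Module.finrank K L) {b : K} (hb : b ≠ 0) :
    ∃ A : CSA.{u, u} K, IsCyclicAlgebra K L s b A := by
  have hb' : algebraMap K L b ≠ 0 := (map_ne_zero _).2 hb
  obtain ⟨A, hA, i, x, y, hx, -, hxn, -⟩ := (isBicyclicGal_one hs).exists_isAbelianCrossedProduct
    (u := 1) (b₁ := Units.mk0 _ hb') (b₂ := 1)
    ⟨s.commutes b, rfl, by simp [partialNorm_one], by simp [partialNorm_one]⟩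
  exact ⟨A, hA, i, x, hx, by rw [← hs, hxn, Units.val_mk0, i.commutes]⟩

end Cyclic

/-! ### The fields $L_1,L_2$ as fixed fields, and tensor products of cyclic algebras. -/

section Pair

variable {K M : Type u} [Field K] [Field M] [Algebra K M]

/-- `L₁` and `L₂` are the fixed fields of `ρ` and `σ`. -/
structure IsFixedFieldPair (L₁ L₂ : IntermediateField K M) (σ ρ : M ≃ₐ[K] M) : Prop where
  mem₁ : ∀ m, m ∈ L₁ ↔ ρ m = m
  mem₂ : ∀ m, m ∈ L₂ ↔ σ m = m
  finrank₁ : orderOf σ = Module.finrank K L₁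
  finrank₂ : orderOf ρ = Module.finrank K L₂
  norm₁ : ∀ m, algebraMap L₁ M (Algebra.norm L₁ m) = partialNorm ρ (orderOf ρ) m
  norm₂ : ∀ m, algebraMap L₂ M (Algebra.norm L₂ m) = partialNorm σ (orderOf σ) m
  ext : ∀ g g' : M ≃ₐ[K] M, (∀ m ∈ L₁, g m = g' m) → (∀ m ∈ L₂, g m = g' m) → g = g'

theorem norm_eq_partialNorm [FiniteDimensional K M] [IsGalois K M] (L : IntermediateField K M)
    {σ : M ≃ₐ[K] M} (hσ : Subgroup.zpowers σ = L.fixingSubgroup) (m : M) :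
    algebraMap L M (Algebra.norm L m) = partialNorm σ (orderOf σ) m := by
  rw [Algebra.norm_eq_prod_automorphisms, partialNorm, Finset.prod_range]
  let e : Fin (orderOf σ) ≃ (M ≃ₐ[L] M) := (finEquivZPowers (isOfFinOrder_of_finite σ)).trans
    ((MulEquiv.subgroupCongr hσ).trans L.fixingSubgroupEquiv).toEquiv
  exact (Fintype.prod_equiv e _ _ fun a => rfl).symm

theorem mem_iff_of_zpowers_eq [FiniteDimensional K M] [IsGalois K M] (L : IntermediateField K M)
    {σ : M ≃ₐ[K] M} (hσ : Subgroup.zpowers σ = L.fixingSubgroup) (m : M) : m ∈ L ↔ σ m = m := by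
  rw [← IsGalois.fixedField_fixingSubgroup L, ← hσ, IntermediateField.mem_fixedField_iff]
  constructor
  · exact fun h => h σ (Subgroup.mem_zpowers σ)
  · intro h g hg
    obtain ⟨k, rfl⟩ := (isOfFinOrder_of_finite σ).mem_powers_iff_mem_zpowers.2 hg
    exact pow_apply_of_apply_eq h k

theorem orderOf_eq_of_zpowers_eq [FiniteDimensional K M] [IsGalois K M] (L : IntermediateField K M)
    {σ : M ≃ₐ[K] M} (hσ : Subgroup.zpowers σ = L.fixingSubgroup) :
    orderOf σ = Module.finrank L M := by
  rw [← Nat.card_zpowers, hσ, IsGalois.card_fixingSubgroup_eq_finrank]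

theorem finrank_mul_finrank_of_bijective {L₁ L₂ : IntermediateField K M}
    (hL : Function.Bijective (Algebra.TensorProduct.productMap L₁.val L₂.val)) :
    Module.finrank K L₁ * Module.finrank K L₂ = Module.finrank K M := by
  rw [← Module.finrank_tensorProduct]
  exact (AlgEquiv.ofBijective _ hL).toLinearEquiv.finrank_eq

theorem algEquiv_ext_of_bijective {L₁ L₂ : IntermediateField K M}
    (hL : Function.Bijective (Algebra.TensorProduct.productMap L₁.val L₂.val)) {g g' : M ≃ₐ[K] M}
    (h1 : ∀ m ∈ L₁, g m = g' m) (h2 : ∀ m ∈ L₂, g m = g' m) : g = g' := by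
  refine AlgEquiv.ext fun m => ?_
  obtain ⟨t, rfl⟩ := hL.2 m
  induction t using TensorProduct.induction_on with
  | zero => simp
  | add t t' ht ht' => rw [map_add, map_add, map_add, ht, ht']
  | tmul a b =>
    rw [Algebra.TensorProduct.productMap_apply_tmul, map_mul, map_mul]
    exact congrArg₂ _ (h1 _ a.2) (h2 _ b.2)

theorem isFixedFieldPair [FiniteDimensional K M] [IsGalois K M] {L₁ L₂ : IntermediateField K M}
    (hL : Function.Bijective (Algebra.TensorProduct.productMap L₁.val L₂.val))
    {σ ρ : M ≃ₐ[K] M} (hσ : Subgroup.zpowers σ = L₂.fixingSubgroup)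
    (hρ : Subgroup.zpowers ρ = L₁.fixingSubgroup) : IsFixedFieldPair L₁ L₂ σ ρ where
  mem₁ := mem_iff_of_zpowers_eq L₁ hρ
  mem₂ := mem_iff_of_zpowers_eq L₂ hσ
  norm₁ := norm_eq_partialNorm L₁ hρ
  norm₂ := norm_eq_partialNorm L₂ hσ
  ext _ _ := algEquiv_ext_of_bijective hL
  finrank₁ := by
    rw [orderOf_eq_of_zpowers_eq L₂ hσ]
    have h1 := finrank_mul_finrank_of_bijective hL
    rw [← Module.finrank_mul_finrank K L₂ M, mul_comm] at h1
    exact (Nat.eq_of_mul_eq_mul_left Module.finrank_pos h1).symm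
  finrank₂ := by
    rw [orderOf_eq_of_zpowers_eq L₁ hρ]
    have h1 := finrank_mul_finrank_of_bijective hL
    rw [← Module.finrank_mul_finrank K L₁ M] at h1
    exact (Nat.eq_of_mul_eq_mul_left Module.finrank_pos h1).symm

theorem isBicyclicGal_of_bijective [FiniteDimensional K M] [IsGalois K M]
    {L₁ L₂ : IntermediateField K M}
    (hL : Function.Bijective (Algebra.TensorProduct.productMap L₁.val L₂.val))
    {σ ρ : M ≃ₐ[K] M} (hσ : Subgroup.zpowers σ = L₂.fixingSubgroup)
    (hρ : Subgroup.zpowers ρ = L₁.fixingSubgroup) (hc : Commute σ ρ) : IsBicyclicGal σ ρ where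
  finiteDimensional := inferInstance
  isGalois := inferInstance
  commute := hc
  card := by
    have h := isFixedFieldPair hL hσ hρ
    rw [h.finrank₁, h.finrank₂, finrank_mul_finrank_of_bijective hL]
  independent := by
    have h := isFixedFieldPair hL hσ hρ
    -- An element of $\langle\sigma\rangle\cap\langle\rho\rangle$ fixes $L_1$ and $L_2$, hence $M$.
    have hz : ∀ a b : ℤ, σ ^ a * ρ ^ b = 1 → σ ^ a = 1 ∧ ρ ^ b = 1 := by
      intro a b hab
      have hσa : σ ^ a ∈ L₂.fixingSubgroup := hσ ▸ Subgroup.zpow_mem_zpowers σ a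
      have hρb : ρ ^ b ∈ L₁.fixingSubgroup := hρ ▸ Subgroup.zpow_mem_zpowers ρ b
      have hσa' : σ ^ a ∈ L₁.fixingSubgroup := by
        rw [eq_inv_of_mul_eq_one_left hab]
        exact inv_mem hρb
      have h1 : σ ^ a = 1 := h.ext _ 1 ((mem_fixingSubgroup_iff _).1 hσa')
        ((mem_fixingSubgroup_iff _).1 hσa)
      exact ⟨h1, by rwa [h1, one_mul] at hab⟩
    rintro ⟨a, a'⟩ ⟨b, b'⟩ hab
    have h1 : σ ^ ((a : ℤ) - b) * ρ ^ ((a' : ℤ) - b') = 1 := by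
      have hab' : σ ^ (a : ℕ) * ρ ^ (a' : ℕ) = σ ^ (b : ℕ) * ρ ^ (b' : ℕ) := hab
      rw [zpow_sub, zpow_sub]
      simp only [zpow_natCast]
      have h2 : Commute (σ ^ (b : ℕ))⁻¹ (ρ ^ (a' : ℕ)) := (hc.pow_pow _ _).inv_left
      rw [mul_assoc, ← mul_assoc _ (ρ ^ _), h2.eq, mul_assoc, ← mul_inv_rev,
        ((hc.pow_pow _ _).symm).eq, ← mul_assoc, hab', mul_inv_cancel]
    obtain ⟨h2, h3⟩ := hz _ _ h1
    rw [zpow_sub, mul_inv_eq_one, zpow_natCast, zpow_natCast] at h2 h3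
    exact Prod.ext (Fin.ext (pow_injOn_Iio_orderOf a.2 b.2 h2))
      (Fin.ext (pow_injOn_Iio_orderOf a'.2 b'.2 h3))

/-- Take $x=z_1\otimes1$ and $y=1\otimes z_2$. They commute, so $u=1$, and they induce $\sigma$ and
$\rho$ because $\sigma$ is trivial on $L_2$ and $\rho$ on $L_1$. -/
theorem isAbelianCrossedProduct_tensor [FiniteDimensional K M] {L₁ L₂ : IntermediateField K M}
    [Normal K L₁] [Normal K L₂]
    (hL : Function.Bijective (Algebra.TensorProduct.productMap L₁.val L₂.val))
    {σ ρ : M ≃ₐ[K] M} (h : IsFixedFieldPair L₁ L₂ σ ρ) {c₁ c₂ : K} {A₁ A₂ : CSA.{u, u} K}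
    (h₁ : IsCyclicAlgebra K L₁ (σ.restrictNormal L₁) c₁ A₁)
    (h₂ : IsCyclicAlgebra K L₂ (ρ.restrictNormal L₂) c₂ A₂) {b₁ b₂ : Mˣ}
    (hb₁ : (b₁ : M) = algebraMap K M c₁) (hb₂ : (b₂ : M) = algebraMap K M c₂) :
    IsAbelianCrossedProduct σ ρ 1 b₁ b₂ (A₁.tensor A₂) := by
  obtain ⟨hd₁, i₁, z₁, hz₁, hp₁⟩ := h₁
  obtain ⟨hd₂, i₂, z₂, hz₂, hp₂⟩ := h₂
  let e : L₁ ⊗[K] L₂ ≃ₐ[K] M := AlgEquiv.ofBijective _ hL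
  have he : ∀ a b, e (a ⊗ₜ b) = a * b := fun _ _ => rfl
  let i : M →ₐ[K] A₁ ⊗[K] A₂ := (Algebra.TensorProduct.map i₁ i₂).comp e.symm.toAlgHom
  have hi : ∀ (a : L₁) (b : L₂), i (a * b) = i₁ a ⊗ₜ i₂ b := fun a b => by
    change Algebra.TensorProduct.map i₁ i₂ (e.symm _) = _
    rw [← he, e.symm_apply_apply, Algebra.TensorProduct.map_tmul]
  have ext : ∀ {f g : M →+ A₁ ⊗[K] A₂},
      (∀ (a : L₁) (b : L₂), f (a * b) = g (a * b)) → ∀ c, f c = g c := by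
    intro f g hfg c
    obtain ⟨t, rfl⟩ := e.surjective c
    induction t using TensorProduct.induction_on with
    | zero => simp
    | add t t' ht ht' => rw [map_add, map_add, map_add, ht, ht']
    | tmul a b => exact hfg a b
  have hrel : BicyclicRelations σ ρ 1 b₁ b₂ (i : M →+* A₁ ⊗[K] A₂) ((z₁ : A₁) ⊗ₜ 1)
      (1 ⊗ₜ (z₂ : A₂)) :=
    { x_mul := ext (f := (AddMonoidHom.mulLeft _).comp (i : M →+ A₁ ⊗[K] A₂))
        (g := ((AddMonoidHom.mulRight _).comp (i : M →+ A₁ ⊗[K] A₂)).comp (σ : M →+ M))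
        fun a b => by
          change _ * i (a * b) = i (σ (a * b)) * _
          have hσ : σ (a : M) = (σ.restrictNormal L₁ a : L₁) :=
            (σ.restrictNormal_commutes L₁ a).symm
          rw [map_mul σ, (h.mem₂ b).1 b.2, hσ, hi, hi, Algebra.TensorProduct.tmul_mul_tmul,
            Algebra.TensorProduct.tmul_mul_tmul, hz₁, one_mul, mul_one]
      y_mul := ext (f := (AddMonoidHom.mulLeft _).comp (i : M →+ A₁ ⊗[K] A₂))
        (g := ((AddMonoidHom.mulRight _).comp (i : M →+ A₁ ⊗[K] A₂)).comp (ρ : M →+ M))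
        fun a b => by
          change _ * i (a * b) = i (ρ (a * b)) * _
          have hρ : ρ (b : M) = (ρ.restrictNormal L₂ b : L₂) :=
            (ρ.restrictNormal_commutes L₂ b).symm
          rw [map_mul ρ, (h.mem₁ a).1 a.2, hρ, hi, hi, Algebra.TensorProduct.tmul_mul_tmul,
            Algebra.TensorProduct.tmul_mul_tmul, hz₂, one_mul, mul_one]
      x_pow := by
        rw [h.finrank₁, Algebra.TensorProduct.tmul_pow, hp₁, one_pow, hb₁]
        exact (i.commutes c₁).symm
      y_pow := by
        rw [h.finrank₂, Algebra.TensorProduct.tmul_pow, hp₂, one_pow, hb₂]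
        refine Eq.trans ?_ (i.commutes c₂).symm
        rw [Algebra.TensorProduct.algebraMap_apply, Algebra.algebraMap_eq_smul_one,
          Algebra.algebraMap_eq_smul_one, TensorProduct.smul_tmul]
      x_mul_y := by simp }
  refine isAbelianCrossedProduct_iff.2 ⟨?_, i, _, _, hrel⟩
  change Module.finrank K (A₁ ⊗[K] A₂) = _
  rw [Module.finrank_tensorProduct, hd₁, hd₂, ← mul_pow, finrank_mul_finrank_of_bijective hL]

end Pair

/-! ### Hilbert 90 for cyclic groups. -/

section HilbertNinety

variable {K M : Type*} [Field K] [Field M] [Algebra K M]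

/-- Hilbert's Theorem 90 for a cyclic group of automorphisms of a subfield `E`. -/
theorem exists_mul_apply_eq_of_partialNorm_eq_one (E : IntermediateField K M) {s : M ≃ₐ[K] M}
    {n : ℕ} (hn : 0 < n) (hsE : ∀ m ∈ E, s m ∈ E) (hsn : ∀ m ∈ E, (s ^ n) m = m)
    (hinj : ∀ a < n, ∀ b < n, (∀ m ∈ E, (s ^ a) m = (s ^ b) m) → a = b) {v : M}
    (hv : partialNorm s n v = 1) : ∃ b : M, b ≠ 0 ∧ v * s b = b ∧ (v ∈ E → b ∈ E) := by
  let f (a : Fin n) : E →* M := ((s ^ (a : ℕ) : M ≃ₐ[K] M) : M →* M).comp (E.val : E →* M)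
  have hf : Function.Injective f := fun a b hab =>
    Fin.ext (hinj a a.2 b b.2 fun m hm => DFunLike.congr_fun hab ⟨m, hm⟩)
  have hli := (linearIndependent_monoidHom E M).comp f hf
  -- By independence of characters some Lagrange resolvent is nonzero; $v\cdot s$ shifts its terms
  -- cyclically.
  obtain ⟨a, ha⟩ : ∃ a : E, ∑ j ∈ Finset.range n, partialNorm s j v * (s ^ j) a ≠ 0 := by
    by_contra! hcon
    have h1 := Fintype.linearIndependent_iff.1 hli (fun j => partialNorm s j v) (by
      funext a
      have := hcon a
      rw [Finset.sum_range] at this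
      simpa [f, Finset.sum_apply] using this) ⟨0, hn⟩
    simp [partialNorm] at h1
  have hpow : ∀ (j : ℕ) m, m ∈ E → (s ^ j) m ∈ E := by
    intro j
    induction j with
    | zero => exact fun m hm => hm
    | succ j ih => exact fun m hm => by rw [pow_succ]; exact ih _ (hsE m hm)
  refine ⟨_, ha, ?_, fun hvE => E.sum_mem fun j _ => E.mul_mem ?_ (hpow j _ a.2)⟩
  · rw [map_sum, Finset.mul_sum]
    have h1 : ∀ j, v * s (partialNorm s j v * (s ^ j) a) =
        partialNorm s (j + 1) v * (s ^ (j + 1)) a := fun j => by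
      rw [partialNorm_succ', map_mul, pow_succ', AlgEquiv.mul_apply, mul_assoc]
    simp only [h1]
    have h2 := Finset.sum_range_succ (fun j => partialNorm s j v * (s ^ j) (a : M)) n
    rw [Finset.sum_range_succ', hv, hsn _ a.2] at h2
    have h3 : partialNorm s 0 v * (s ^ 0) (a : M) = 1 * a := by simp [partialNorm]
    rw [h3] at h2
    exact add_right_cancel h2
  · exact E.prod_mem fun j _ => hpow j v hvE

end HilbertNinety

/-! ### Partial norms and conjugation by $\theta$. -/

section Conj

variable {F K M : Type u} [Field F] [Field K] [Field M] [Algebra K M] [Algebra F M]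
  {σ : M ≃ₐ[K] M} {θ : M ≃ₐ[F] M}

theorem pow_conj_of_conj (h : ∀ m, σ (θ (σ m)) = θ m) (k : ℕ) (m : M) :
    (σ ^ k) (θ ((σ ^ k) m)) = θ m := by
  induction k generalizing m with
  | zero => rfl
  | succ k ih =>
    have h1 : ∀ x, (σ ^ (k + 1)) x = σ ((σ ^ k) x) := fun x => by rw [pow_succ']; rfl
    have h2 : ∀ x, (σ ^ (k + 1)) x = (σ ^ k) (σ x) := fun x => by rw [pow_succ]; rfl
    rw [h1 (θ _), h2, ih, h]

theorem partialNorm_pow_apply [FiniteDimensional K M] (σ : M ≃ₐ[K] M) (k : ℕ) (m : M) :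
    partialNorm σ (orderOf σ) ((σ ^ k) m) = partialNorm σ (orderOf σ) m := by
  by_cases hm : m = 0
  · rw [hm, map_zero]
  rw [partialNorm_apply (g := σ ^ k) fun m => by
    rw [← AlgEquiv.mul_apply, ← AlgEquiv.mul_apply, ← pow_succ, ← pow_succ']]
  exact pow_apply_of_apply_eq (apply_partialNorm_orderOf σ hm) k

theorem partialNorm_conj [FiniteDimensional K M] (h : ∀ m, σ (θ (σ m)) = θ m) (m : M) :
    partialNorm σ (orderOf σ) (θ m) = θ (partialNorm σ (orderOf σ) m) := by
  -- $m$ is replaced by $\sigma(m)$ so that, with $\sigma^k\theta\sigma^k=\theta$, the factor $j$ on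
  -- one side matches the factor $n-1-j$ on the other.
  have h1 := partialNorm_pow_apply σ 1 m
  rw [← h1, pow_one, partialNorm, partialNorm, map_prod, ← Finset.prod_range_reflect]
  refine Finset.prod_congr rfl fun j hj => ?_
  have hj := Finset.mem_range.1 hj
  have h2 := pow_conj_of_conj h (orderOf σ - 1 - j) ((σ ^ j) (σ m))
  rw [← h2, ← AlgEquiv.mul_apply (σ ^ _) (σ ^ j), ← pow_add, ← AlgEquiv.mul_apply _ σ, ← pow_succ,
    show orderOf σ - 1 - j + j + 1 = orderOf σ by lia, pow_orderOf_eq_one, AlgEquiv.one_apply]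

end Conj

/-! ### Symmetry in $\sigma,\rho$, and norms as products over powers. -/

section Norms

variable {F K M : Type u} [Field F] [Field K] [Field M] [Algebra F K] [Algebra K M] [Algebra F M]
  {σ ρ : M ≃ₐ[K] M} {θ : M ≃ₐ[F] M}

theorem IndependentAuts.symm (h : IndependentAuts σ ρ) (hc : Commute σ ρ) :
    IndependentAuts ρ σ := by
  intro p q hpq
  have := @h p.swap q.swap (by
    change σ ^ _ * ρ ^ _ = σ ^ _ * ρ ^ _
    rw [(hc.pow_pow _ _).eq, (hc.pow_pow _ _).eq]
    exact hpq)
  exact Prod.swap_injective this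

theorem IsDihedralGal.symm (hG : IsDihedralGal σ ρ θ) : IsDihedralGal ρ σ θ where
  finiteDimensional := hG.finiteDimensional
  isGalois := hG.isGalois
  commute := hG.commute.symm
  independent := hG.independent.symm hG.commute
  card := by rw [mul_comm, hG.card]
  involutive := hG.involutive
  conj_σ := hG.conj_ρ
  conj_ρ := hG.conj_σ
  restrict := hG.restrict

theorem IsFixedFieldPair.symm {L₁ L₂ : IntermediateField K M} (h : IsFixedFieldPair L₁ L₂ σ ρ) :
    IsFixedFieldPair L₂ L₁ ρ σ where
  mem₁ := h.mem₂
  mem₂ := h.mem₁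
  finrank₁ := h.finrank₂
  finrank₂ := h.finrank₁
  norm₁ := h.norm₂
  norm₂ := h.norm₁
  ext g g' h1 h2 := h.ext g g' h2 h1

/-- Hilbert's Theorem 90 for `σ` on `L₁`. -/
theorem IsFixedFieldPair.hilbert90 [FiniteDimensional K M] {L₁ L₂ : IntermediateField K M}
    (h : IsFixedFieldPair L₁ L₂ σ ρ)
    (hc : Commute σ ρ) {v : M} (hv : partialNorm σ (orderOf σ) v = 1) (hρ : ρ v = v) :
    ∃ b : M, b ≠ 0 ∧ v * σ b = b ∧ ρ b = b := by
  have hc' : ∀ m, ρ (σ m) = σ (ρ m) := fun m => (DFunLike.congr_fun hc.eq m).symm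
  obtain ⟨b, hb, h1, h2⟩ := exists_mul_apply_eq_of_partialNorm_eq_one L₁ (orderOf_pos σ)
    (fun m hm => (h.mem₁ _).2 (by rw [hc', (h.mem₁ m).1 hm]))
    (fun m _ => by rw [pow_orderOf_eq_one, AlgEquiv.one_apply]) (fun a ha b hb hab =>
      pow_injOn_Iio_orderOf ha hb (h.ext _ _ hab fun m hm => by
        rw [pow_apply_of_apply_eq ((h.mem₂ m).1 hm), pow_apply_of_apply_eq ((h.mem₂ m).1 hm)])) hv
  exact ⟨b, hb, h1, (h.mem₁ b).1 (h2 ((h.mem₁ v).2 hρ))⟩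

theorem hilbert90_orderOf [FiniteDimensional K M] {v : M}
    (hv : partialNorm σ (orderOf σ) v = 1) : ∃ b : M, b ≠ 0 ∧ v * σ b = b := by
  obtain ⟨b, hb, h1, -⟩ := exists_mul_apply_eq_of_partialNorm_eq_one (⊤ : IntermediateField K M)
    (orderOf_pos σ) (fun _ _ => IntermediateField.mem_top)
    (fun m _ => by rw [pow_orderOf_eq_one, AlgEquiv.one_apply]) (fun a ha b hb hab =>
      pow_injOn_Iio_orderOf ha hb (AlgEquiv.ext fun m => hab m IntermediateField.mem_top)) hv
  exact ⟨b, hb, h1⟩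

theorem IsBicyclicGal.algebraMap_norm (hG : IsBicyclicGal σ ρ) (m : M) :
    algebraMap K M (Algebra.norm K m) =
      partialNorm σ (orderOf σ) (partialNorm ρ (orderOf ρ) m) := by
  have := hG.finiteDimensional
  have := hG.isGalois
  have hb : Function.Bijective fun p : Fin (orderOf σ) × Fin (orderOf ρ) =>
      σ ^ (p.1 : ℕ) * ρ ^ (p.2 : ℕ) := by
    rw [Nat.bijective_iff_injective_and_card]
    exact ⟨hG.independent, by rw [IsGalois.card_aut_eq_finrank, ← hG.card]; simp⟩
  rw [Algebra.norm_eq_prod_automorphisms, ← Fintype.prod_bijective _ hb _ _ fun _ => rfl,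
    Fintype.prod_prod_type, partialNorm, Finset.prod_range]
  refine Finset.prod_congr rfl fun a _ => ?_
  rw [partialNorm, map_prod, Finset.prod_range]
  rfl

theorem IsBicyclicGal.partialNorm_comm (hG : IsBicyclicGal σ ρ) (k : ℕ) (l : ℕ) (m : M) :
    partialNorm σ k (partialNorm ρ l m) = partialNorm ρ l (partialNorm σ k m) := by
  simp only [partialNorm, map_prod]
  rw [Finset.prod_comm]
  simp only [pow_apply_comm hG.commute]

theorem IsDihedralGal.algebraMap_norm_apply (hG : IsDihedralGal σ ρ θ) (m : M) :
    algebraMap K M (Algebra.norm K (θ m)) = θ (algebraMap K M (Algebra.norm K m)) := by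
  have := hG.finiteDimensional
  rw [hG.algebraMap_norm, hG.algebraMap_norm, partialNorm_conj hG.conj_ρ,
    partialNorm_conj hG.conj_σ]

end Norms

/-! ### Solving for $b_1,b_2$ and $q$ by Hilbert 90. -/

section DihedralArithmetic

variable {F K M : Type u} [Field F] [Field K] [Field M] [Algebra F K] [Algebra K M] [Algebra F M]
  {σ ρ : M ≃ₐ[K] M} {θ : M ≃ₐ[F] M} {L₁ L₂ : IntermediateField K M}

namespace IsDihedralGal

theorem apply_comm (hG : IsDihedralGal σ ρ θ) (m : M) : ρ (σ m) = σ (ρ m) :=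
  (DFunLike.congr_fun hG.commute.eq m).symm

theorem apply_apply_apply (hG : IsDihedralGal σ ρ θ) (m : M) :
    ρ (σ (θ (ρ (σ m)))) = θ m := by
  rw [hG.apply_comm m, hG.conj_σ, hG.conj_ρ]

/-- $l/\theta(l)$ lies in $L_1\cap L_2$, and Hilbert 90 for $\theta$ can be solved inside that
intersection. -/
theorem exists_div_fixed (hG : IsDihedralGal σ ρ θ) (hP : IsFixedFieldPair L₁ L₂ σ ρ) {l : M}
    (hl : l ≠ 0) (hσ : σ (l / θ l) = l / θ l) (hρ : ρ (l / θ l) = l / θ l) :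
    ∃ r : M, r ≠ 0 ∧ σ r = r ∧ ρ r = r ∧ θ (l / r) = l / r := by
  have hl' : θ l ≠ 0 := (map_ne_zero _).2 hl
  obtain ⟨r, hr, h1, hE⟩ := hG.exists_mul_apply_eq_of_commutes 1 (fun _ => rfl) (m := l / θ l) (by
    change l / θ l * θ (l / θ l) = 1
    rw [map_div₀, hG.involutive]
    field_simp)
  replace h1 : l / θ l * θ r = r := h1
  have hr' : θ r ≠ 0 := (map_ne_zero _).2 hr
  refine ⟨r, hr, (hP.mem₂ r).1 (hE _ ((hP.mem₂ _).2 hσ)), (hP.mem₁ r).1 (hE _ ((hP.mem₁ _).2 hρ)),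
    ?_⟩
  rw [map_div₀]
  field_simp at h1 ⊢
  exact h1.symm

/-- Hilbert 90 over $L_2$ gives a solution $b$. By the last hypothesis $\theta(b)$ is another, so
$b/\theta(b)$ is fixed by $\sigma$ and $\rho$, and `exists_div_fixed` corrects $b$. -/
theorem exists_fixed_mul_apply_eq (hG : IsDihedralGal σ ρ θ) (hP : IsFixedFieldPair L₁ L₂ σ ρ)
    {v : M} (hv : v ≠ 0) (hσ : σ v = v) (hN : partialNorm ρ (orderOf ρ) v = 1)
    (hθ : v * ρ (θ v) = 1) : ∃ b : M, b ≠ 0 ∧ σ b = b ∧ v * ρ b = b ∧ θ b = b := by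
  have := hG.finiteDimensional
  obtain ⟨b, hb, h1, h2⟩ := hP.symm.hilbert90 hG.commute.symm hN hσ
  have hb' : θ b ≠ 0 := (map_ne_zero _).2 hb
  have h3 : σ (θ b) = θ b := by
    have := hG.conj_σ b
    rwa [h2] at this
  have h4 : v * ρ (θ b) = θ b := by
    have h5 := congrArg (fun m => ρ (θ m)) h1
    simp only [map_mul, hG.conj_ρ] at h5
    rw [← h5, ← mul_assoc, hθ, one_mul]
  obtain ⟨r, hr, hr1, hr2, hr3⟩ := hG.exists_div_fixed hP hb (by rw [map_div₀, h2, h3]) (by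
    rw [map_div₀, ← mul_div_mul_left _ _ hv, h1, h4])
  exact ⟨b / r, div_ne_zero hb hr, by rw [map_div₀, h2, hr1],
    by rw [map_div₀, hr2, ← mul_div_assoc, h1], hr3⟩

theorem exists_fixed_norm_mul_apply_eq (hG : IsDihedralGal σ ρ θ)
    (hP : IsFixedFieldPair L₁ L₂ σ ρ) {u : M} (hu : u * ρ (σ (θ u)) = 1)
    (hN : Algebra.norm K u = 1) :
    ∃ b : M, b ≠ 0 ∧ σ b = b ∧ partialNorm σ (orderOf σ) u * ρ b = b ∧ θ b = b := by
  have := hG.finiteDimensional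
  have hu0 : u ≠ 0 := left_ne_zero_of_mul_eq_one hu
  refine hG.exists_fixed_mul_apply_eq hP (partialNorm_ne_zero _ _ hu0)
    (apply_partialNorm_orderOf σ hu0) ?_ ?_
  · rw [← hG.partialNorm_comm, ← hG.algebraMap_norm, hN, map_one]
  · have h1 := partialNorm_pow_apply σ 1 (ρ (θ u))
    rw [pow_one, ← hG.apply_comm] at h1
    rw [← partialNorm_conj hG.conj_σ,
      ← partialNorm_apply (g := ρ) (fun m => (hG.apply_comm m).symm),
      ← h1, ← partialNorm_mul, hu, partialNorm_one]

theorem exists_unitaryCocycle_of_norm_eq_one (hG : IsDihedralGal σ ρ θ)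
    (hP : IsFixedFieldPair L₁ L₂ σ ρ) {u : Mˣ} (hu : (u : M) * ρ (σ (θ u)) = 1)
    (hN : Algebra.norm K (u : M) = 1) : ∃ b₁ b₂ : Mˣ, UnitaryCocycle σ ρ θ u b₁ b₂ := by
  obtain ⟨b₁, hb₁, h1, h2, h3⟩ := hG.exists_fixed_norm_mul_apply_eq hP hu hN
  -- Exchanging $x$ and $y$ inverts their commutator, so $b_2$ is found from $u^{-1}$ with
  -- $\sigma,\rho$ swapped.
  obtain ⟨b₂, hb₂, h4, h5, h6⟩ := hG.symm.exists_fixed_norm_mul_apply_eq hP.symm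
    (u := (u : M)⁻¹) (by rw [map_inv₀, map_inv₀, map_inv₀, ← hG.apply_comm, ← mul_inv, hu, inv_one])
    (by
      have h := map_mul (Algebra.norm K) (u : M)⁻¹ u
      rw [inv_mul_cancel₀ u.ne_zero, map_one, hN, mul_one] at h
      exact h.symm)
  refine ⟨Units.mk0 b₁ hb₁, Units.mk0 b₂ hb₂, ⟨h1, h4, h2, ?_⟩, h3, h6, hu⟩
  rw [partialNorm_inv] at h5
  have h7 := partialNorm_ne_zero ρ (orderOf ρ) u.ne_zero
  rw [Units.val_mk0]
  nth_rewrite 1 [← h5]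
  rw [mul_inv_cancel_left₀ h7]

/-- Taking the $\rho$-norm of `norm₁` cancels $b_1$, since $b_1$ and $\rho(b_1)$ have the same
$\rho$-norm. -/
theorem norm_eq_one_of_unitaryCocycle (hG : IsDihedralGal σ ρ θ) {u b₁ b₂ : Mˣ}
    (h : UnitaryCocycle σ ρ θ u b₁ b₂) : Algebra.norm K (u : M) = 1 := by
  have := hG.finiteDimensional
  have h1 := congrArg (partialNorm ρ (orderOf ρ)) h.norm₁
  have h2 := partialNorm_pow_apply ρ 1 (b₁ : M)
  rw [pow_one] at h2
  rw [partialNorm_mul, h2] at h1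
  refine (algebraMap K M).injective ?_
  rw [hG.algebraMap_norm, hG.partialNorm_comm, map_one]
  exact mul_eq_right₀ (partialNorm_ne_zero ρ _ b₁.ne_zero) |>.1 h1

theorem exists_eq_div (hG : IsDihedralGal σ ρ θ) {u : M} (hu : u * ρ (σ (θ u)) = 1) :
    ∃ q : Mˣ, u = q / ρ (σ (θ q)) := by
  obtain ⟨r, hr, h1, -⟩ := hG.exists_mul_apply_eq_of_commutes (ρ * σ)
    (fun m => hG.apply_apply_apply m) (m := u) hu
  refine ⟨Units.mk0 r hr, ?_⟩
  rw [eq_div_iff (by simpa using hr)]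
  exact h1

theorem norm_div (hG : IsDihedralGal σ ρ θ) (q : Mˣ) :
    Algebra.norm K ((q : M) / ρ (σ (θ q))) = 1 ↔ Algebra.norm K (θ q) = Algebra.norm K (q : M) := by
  have := hG.finiteDimensional
  have hθq : θ q ≠ 0 := by simp
  have h0 : Algebra.norm K (θ q) ≠ 0 := fun h => hθq (Algebra.norm_eq_zero_iff.1 h)
  have h1 : Algebra.norm K ((q : M) / ρ (σ (θ q))) * Algebra.norm K (θ q) =
      Algebra.norm K (q : M) := by
    rw [← Algebra.norm_eq_of_algEquiv σ (θ q), ← Algebra.norm_eq_of_algEquiv ρ (σ (θ q)), ← map_mul,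
      div_mul_cancel₀ _ (by simp)]
  rw [← h1]
  exact (right_eq_mul₀ h0).symm

theorem div_mul_apply_div (hG : IsDihedralGal σ ρ θ) (q : Mˣ) :
    (q : M) / ρ (σ (θ q)) * ρ (σ (θ (q / ρ (σ (θ q))))) = 1 := by
  rw [map_div₀, map_div₀, map_div₀, hG.apply_apply_apply, hG.involutive]
  have := q.ne_zero
  have : ρ (σ (θ q)) ≠ 0 := by simp
  field_simp

/-- $N_{M/K}(\theta(q))$ is the $K/F$-conjugate of $N_{M/K}(q)$. -/
theorem mem_kerNormTilde_iff [IsScalarTower F K M] [Algebra.IsQuadraticExtension F K]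
    [IsGalois F K] (hG : IsDihedralGal σ ρ θ) (q : Mˣ) :
    q ∈ kerNormTilde F K M ↔ Algebra.norm K (θ q) = Algebra.norm K (q : M) := by
  have := hG.finiteDimensional
  obtain ⟨s, hs1, hs⟩ := hG.restrict
  obtain ⟨s', -, hs'⟩ := IsUnitaryInvolution.exists_conj F K
  obtain rfl := hs' s hs1
  rw [← (algebraMap K M).injective.eq_iff, hG.algebraMap_norm_apply, hs,
    (algebraMap K M).injective.eq_iff, IsUnitaryInvolution.conj_fixed hs']
  constructor
  · rintro ⟨a, ha⟩
    exact ⟨a, congrArg Units.val ha⟩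
  · rintro ⟨a, ha⟩
    have ha0 : a ≠ 0 := by
      rintro rfl
      rw [map_zero] at ha
      exact q.ne_zero (Algebra.norm_eq_zero_iff.1 ha.symm)
    exact ⟨Units.mk0 a ha0, Units.ext ha⟩

theorem fixedProduct_le [IsScalarTower F K M] [Algebra.IsQuadraticExtension F K]
    [IsGalois F K] (hG : IsDihedralGal σ ρ θ) : fixedProduct K θ ≤ kerNormTilde F K M := by
  refine iSup_le fun h q hq => (hG.mem_kerNormTilde_iff q).2 ?_
  have hq' : h (θ q) = q := hq
  rw [← Algebra.norm_eq_of_algEquiv h, hq']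

/-- An element whose norm under `σ` is fixed by `θ` is the product of an element fixed by `θ` and
an element fixed by `θσ`. -/
theorem exists_eq_mul_of_norm_fixed (hG : IsDihedralGal σ ρ θ) (hP : IsFixedFieldPair L₁ L₂ σ ρ)
    {c : M} (hc : c ≠ 0) (h : θ (partialNorm σ (orderOf σ) c) = partialNorm σ (orderOf σ) c) :
    ∃ e t : M, e ≠ 0 ∧ t ≠ 0 ∧ c = e * t ∧ θ t = t ∧ θ e = σ e := by
  have := hG.finiteDimensional
  have hc' : θ c ≠ 0 := (map_ne_zero _).2 hc
  -- $c/\theta(c)=e/\sigma(e)$. Here $e$ may still be multiplied by an element of $L_2$, a freedom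
  -- used below to get $\theta(e)=\sigma(e)$.
  obtain ⟨e, he, h1⟩ := hilbert90_orderOf (σ := σ) (v := c / θ c) (by
    rw [div_eq_mul_inv, partialNorm_mul, partialNorm_inv, partialNorm_conj hG.conj_σ, h,
      mul_inv_cancel₀ (partialNorm_ne_zero _ _ hc)])
  have hσe : σ e ≠ 0 := (map_ne_zero _).2 he
  have hθe : θ e ≠ 0 := (map_ne_zero _).2 he
  have h2 : c * σ e = e * θ c := by field_simp at h1; rw [h1, mul_comm]
  have h3 : θ c * θ (σ e) = θ e * c := by
    have := congrArg θ h2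
    rwa [map_mul, map_mul, hG.involutive] at this
  have h4 : σ (θ c) * θ e = σ (θ e) * σ c := by
    have := congrArg σ h3
    rwa [map_mul, map_mul, hG.conj_σ] at this
  have h5 : σ c * σ (σ e) = σ e * σ (θ c) := by
    have := congrArg σ h2
    rwa [map_mul, map_mul] at this
  have hσc : σ c ≠ 0 := (map_ne_zero _).2 hc
  have hσσe : σ (σ e) ≠ 0 := (map_ne_zero _).2 hσe
  have hθσe : θ (σ e) ≠ 0 := (map_ne_zero _).2 hσe
  -- The defect $m=\theta(e)/\sigma(e)$ satisfies $m\theta(m)=1$ and is fixed by $\sigma$, so the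
  -- $r$ that absorbs it can be taken in $L_2$.
  obtain ⟨r, hr, hr1, hrE⟩ := hG.exists_mul_apply_eq_of_commutes 1 (fun _ => rfl)
    (m := θ e / σ e) (by
    change θ e / σ e * θ (θ e / σ e) = 1
    rw [map_div₀, hG.involutive]
    field_simp
    refine mul_right_cancel₀ (mul_ne_zero hc hc') ?_
    linear_combination -(θ c * θ (σ e)) * h2 - e * θ c * h3)
  have hr2 : σ r = r := (hP.mem₂ r).1 (hrE _ ((hP.mem₂ _).2 (by
    rw [map_div₀, div_eq_div_iff hσσe hσe]
    refine mul_right_cancel₀ hσc ?_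
    linear_combination -σ e * h4 - θ e * h5)))
  replace hr1 : θ e / σ e * θ r = r := hr1
  have hr1' : θ e * θ r = r * σ e := by field_simp at hr1; linear_combination hr1
  refine ⟨e * r, c / (e * r), mul_ne_zero he hr, div_ne_zero hc (mul_ne_zero he hr),
    by field_simp, ?_, ?_⟩
  · rw [map_div₀, map_mul, hr1']
    field_simp
    linear_combination -h2
  · rw [map_mul, map_mul, hr1', hr2, mul_comm]

end IsDihedralGal

end DihedralArithmetic

/-! ### The kernel: split classes give elements of $\Pi$, and elements of $\Pi$ give $u=1$. -/

section Kernel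

variable {F K M : Type u} [Field F] [Field K] [Field M] [Algebra F K] [Algebra K M] [Algebra F M]
  {σ ρ : M ≃ₐ[K] M} {θ : M ≃ₐ[F] M} {L₁ L₂ : IntermediateField K M}

theorem mem_fixedProduct_of_apply_eq [IsScalarTower F K M] (h h' : M ≃ₐ[K] M) {m : Mˣ}
    (hm : h (θ m) = h' m) : m ∈ fixedProduct K θ := by
  refine Subgroup.mem_iSup_of_mem (h'⁻¹ * h) ?_
  change h'.symm (h (θ m)) = m
  rw [hm, h'.symm_apply_apply]

namespace IsDihedralGal

/-- Hilbert's Theorem 90 for `σ` on the elements fixed by `ρ` and `θ`. -/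
theorem exists_fixed_div_mul_apply_eq (hG : IsDihedralGal σ ρ θ)
    (hP : IsFixedFieldPair L₁ L₂ σ ρ) {w : M} (hw0 : w ≠ 0) (hw : θ w = w)
    (hρσ : w * ρ (σ w) = ρ w * σ w) :
    ∃ l : M, l ≠ 0 ∧ w * σ l = l * σ w ∧ ρ l = l ∧ θ l = l := by
  have := hG.finiteDimensional
  have hσw : σ w ≠ 0 := (map_ne_zero _).2 hw0
  have hρσw : ρ (σ w) ≠ 0 := (map_ne_zero _).2 hσw
  obtain ⟨l, hl, h1, h2⟩ := hP.hilbert90 hG.commute (v := w / σ w) (by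
    have h := partialNorm_pow_apply σ 1 w
    rw [pow_one] at h
    rw [div_eq_mul_inv, partialNorm_mul, partialNorm_inv, h,
      mul_inv_cancel₀ (partialNorm_ne_zero _ _ hw0)]) (by
    rw [map_div₀, div_eq_div_iff hρσw hσw]
    exact hρσ.symm)
  have h3 : w * σ l = l * σ w := by field_simp at h1; linear_combination h1
  have h4 : w * σ (θ l) = θ l * σ w := by
    have h := congrArg (fun m => σ (θ m)) h3
    simp only [map_mul, hG.conj_σ, hw] at h
    linear_combination -h
  have hθl : θ l ≠ 0 := (map_ne_zero _).2 hl
  -- $\theta(l)$ solves the same equation, so `exists_div_fixed` replaces $l$ by a $\theta$-fixed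
  -- solution.
  obtain ⟨r, hr, hr1, hr2, hr3⟩ := hG.exists_div_fixed hP hl (by
      rw [map_div₀, div_eq_div_iff (by simpa) hθl]
      refine mul_left_cancel₀ hw0 ?_
      linear_combination θ l * h3 - l * h4) (by
      have h := hG.conj_ρ l
      rw [h2] at h
      rw [map_div₀, h2, h])
  refine ⟨l / r, div_ne_zero hl hr, ?_, by rw [map_div₀, h2, hr2], hr3⟩
  rw [map_div₀, hr1, mul_div_assoc', h3]
  ring

/-- The goal is some $p\in\Pi$ with $p/\rho\sigma\theta(p)=u$; then $q/p$ is fixed by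
$\rho\sigma\theta$. The splitting data give $u=d\rho(c)/(c\sigma(d))$, and $c=et$, $d=fs$ are
factored according to the action of $\theta$. -/
theorem mem_fixedProduct_of_mk_eq_one [IsScalarTower F K M] (hG : IsDihedralGal σ ρ θ)
    (hP : IsFixedFieldPair L₁ L₂ σ ρ) {u b₁ b₂ q : Mˣ} (h : UnitaryCocycle σ ρ θ u b₁ b₂)
    {A : CSA.{u, u} K} (hA : IsAbelianCrossedProduct σ ρ u b₁ b₂ A)
    (h1 : (⟦A⟧ : BrauerGroup.{u, u} K) = 1) (hq : (u : M) = q / ρ (σ (θ q))) :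
    q ∈ fixedProduct K θ := by
  obtain ⟨c, d, hc, hd, hcd, hc', hd'⟩ := hG.exists_of_mk_eq_one hA h1
  obtain ⟨e, t, he, ht, rfl, hθt, hθe⟩ := hG.exists_eq_mul_of_norm_fixed hP hc (by
    rw [eq_inv_of_mul_eq_one_left hc', map_inv₀, h.fixed₁])
  obtain ⟨f, s, hf, hs, rfl, hθs, hθf⟩ := hG.symm.exists_eq_mul_of_norm_fixed hP.symm hd (by
    rw [eq_inv_of_mul_eq_one_left hd', map_inv₀, h.fixed₂])
  have hcomm := hG.apply_comm
  have hθσe : θ (σ e) = e := by rw [← hθe, hG.involutive]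
  have hθρf : θ (ρ f) = f := by rw [← hθf, hG.involutive]
  have hgρ : ∀ m, σ (ρ (θ (ρ m))) = σ (θ m) := fun m => by rw [hG.conj_ρ]
  have hgσ : ∀ m, σ (ρ (θ (σ m))) = ρ (θ m) := fun m => by rw [← hcomm, hG.conj_σ]
  have hu := h.mul_eq_one
  simp only [map_mul, hcomm] at hcd hu
  have hu' := congrArg (fun m => σ (ρ (θ m))) hcd
  simp only [map_mul, hgρ, hgσ, hθe, hθt, hθf, hθs, hcomm] at hu'
  -- $u$ is eliminated between the formula for it, the image of that formula under
  -- $\rho\sigma\theta$, and $u\cdot\rho\sigma\theta(u)=1$.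
  have key : f * s * (ρ e * ρ t) * (σ (ρ (ρ f)) * σ (ρ s) * (σ (σ e) * σ t)) =
      e * t * (σ f * σ s) * (σ (σ (ρ e)) * σ (ρ t) * (ρ (ρ f) * ρ s)) := by
    linear_combination -(σ (ρ (ρ f)) * σ (ρ s) * (σ (σ e) * σ t)) * hcd -
      e * t * (σ f * σ s) * u * hu' +
      e * t * (σ f * σ s) * (σ (σ (ρ e)) * σ (ρ t) * (ρ (ρ f) * ρ s)) * hu
  have hσ0 : ∀ {m : M}, m ≠ 0 → σ m ≠ 0 := fun hm => (map_ne_zero σ).2 hm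
  have hρ0 : ∀ {m : M}, m ≠ 0 → ρ m ≠ 0 := fun hm => (map_ne_zero ρ).2 hm
  have hσe := hσ0 he
  have hσσe := hσ0 hσe
  have hσf := hσ0 hf
  have hσs := hσ0 hs
  have hσt := hσ0 ht
  have hρe := hρ0 he
  have hρf := hρ0 hf
  have hρs := hρ0 hs
  have hρt := hρ0 ht
  have hρρf := hρ0 hρf
  have hσρe := hσ0 hρe
  have hσσρe := hσ0 hσρe
  have hσρf := hσ0 hρf
  have hσρs := hσ0 hρs
  have hσρt := hσ0 hρt
  have hσρρf := hσ0 hρρf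
  -- $w$ is $\theta$-fixed because $\theta$ swaps $f$ with $\rho(f)$ and $e$ with $\sigma(e)$; `key`
  -- says that $w/\sigma(w)$ is $\rho$-fixed.
  obtain ⟨l, hl, hl1, hl2, hl3⟩ := hG.exists_fixed_div_mul_apply_eq hP
    (w := s * ρ f * f / (t * e * σ e)) (by positivity) (by
      simp only [map_mul, map_div₀, hθe, hθt, hθf, hθs, hθσe, hθρf]
      ring) (by
      simp only [map_mul, map_div₀, hcomm]
      rw [div_mul_div_comm, div_mul_div_comm, div_eq_div_iff (by positivity) (by positivity)]
      linear_combination ρ f * σ (ρ f) * σ e * σ (ρ e) * key)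
  have hl4 : s * ρ f * f * σ l * (σ t * σ (σ e)) = l * (σ s * σ (ρ f) * σ f) * (t * e) := by
    simp only [map_mul, map_div₀] at hl1
    field_simp at hl1
    linear_combination hl1
  -- This is $p=u\cdot\rho\sigma\theta(p)$ for $p=\rho(t)\rho(e)\,\sigma\rho(f)\,l$, whose four
  -- factors each lie in $\Pi$.
  have hp : ρ t * ρ e * σ (ρ f) * l = u * (σ t * σ (σ e) * ρ f * σ l) := by
    refine mul_left_cancel₀ (show e * t * σ f * σ s ≠ 0 by positivity) ?_
    linear_combination -(ρ t * ρ e) * hl4 - σ t * σ (σ e) * ρ f * σ l * hcd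
  let t' := Units.mk0 _ hρt
  let e' := Units.mk0 _ hρe
  let f' := Units.mk0 _ hσρf
  let l' := Units.mk0 _ hl
  have ht' : t' ∈ fixedProduct K θ := mem_fixedProduct_of_apply_eq (ρ * ρ) 1 (by
    change ρ (ρ (θ (ρ t))) = ρ t
    rw [hG.conj_ρ, hθt])
  have he' : e' ∈ fixedProduct K θ := mem_fixedProduct_of_apply_eq (ρ * ρ) σ (by
    change ρ (ρ (θ (ρ e))) = σ (ρ e)
    rw [hG.conj_ρ, hθe, hcomm])
  have hf' : f' ∈ fixedProduct K θ := mem_fixedProduct_of_apply_eq (σ * σ * ρ) 1 (by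
    change σ (σ (ρ (θ (σ (ρ f))))) = σ (ρ f)
    rw [hgσ, hθρf])
  have hl' : l' ∈ fixedProduct K θ := mem_fixedProduct_of_apply_eq 1 1 hl3
  have hq' : q * (t' * e' * f' * l')⁻¹ ∈ fixedProduct K θ := by
    refine mem_fixedProduct_of_apply_eq (ρ * σ) 1 ?_
    change ρ (σ (θ ((q : M) * ((t' * e' * f' * l' : Mˣ)⁻¹ : Mˣ)))) =
      (q : M) * ((t' * e' * f' * l' : Mˣ)⁻¹ : Mˣ)
    rw [Units.val_inv_eq_inv_val]
    have hp' : ((t' * e' * f' * l' : Mˣ) : M) = ρ t * ρ e * σ (ρ f) * l := rfl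
    have hgp : ρ (σ (θ (ρ t * ρ e * σ (ρ f) * l))) = σ t * σ (σ e) * ρ f * σ l := by
      simp only [map_mul, hcomm, hgρ, hgσ, hθe, hθt, hθρf, hl2, hl3]
    have hgq : ρ (σ (θ q)) ≠ 0 := by simp
    rw [hp', map_mul, map_mul, map_mul, map_inv₀, map_inv₀, map_inv₀, hgp, hp, hq]
    have : q.val ≠ 0 := q.ne_zero
    have : σ l ≠ 0 := hσ0 hl
    field_simp
  have := mul_mem hq' (mul_mem (mul_mem (mul_mem ht' he') hf') hl')
  rwa [inv_mul_cancel_right] at this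

/-- Since $\rho^j\theta\rho^j=\theta$, the hypothesis gives
$\sigma\theta(\rho^jq)=\sigma^a\rho^{b-1-j}(q)$ for $j<b$. Multiply over $j$ and take
$\sigma$-norms, which ignore powers of $\sigma$. -/
theorem norm_partialNorm_fixed (hG : IsDihedralGal σ ρ θ) {q : M} {a b : ℕ}
    (h : (σ ^ a) ((ρ ^ b) q) = ρ (σ (θ q))) :
    θ (partialNorm σ (orderOf σ) (partialNorm ρ b q)) =
      partialNorm σ (orderOf σ) (partialNorm ρ b q) := by
  have := hG.finiteDimensional
  have h1 : ∀ j < b, σ (θ ((ρ ^ j) q)) = (σ ^ a) ((ρ ^ (b - 1 - j)) q) := by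
    intro j hj
    refine (ρ ^ (j + 1)).injective ?_
    have h2 : (ρ ^ (j + 1)) (σ (θ ((ρ ^ j) q))) = ρ (σ (θ q)) := by
      have h3 := (pow_apply_comm hG.commute 1 (j + 1) (θ ((ρ ^ j) q))).symm
      rw [pow_one] at h3
      rw [h3, pow_succ', AlgEquiv.mul_apply, pow_conj_of_conj hG.conj_ρ, hG.apply_comm]
    rw [h2, ← pow_apply_comm hG.commute, ← AlgEquiv.mul_apply (ρ ^ _), ← pow_add,
      show j + 1 + (b - 1 - j) = b by lia, h]
  have h2 : σ (θ (partialNorm ρ b q)) = (σ ^ a) (partialNorm ρ b q) := by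
    rw [partialNorm, map_prod, map_prod, map_prod, ← Finset.prod_range_reflect]
    refine Finset.prod_congr rfl fun j hj => ?_
    have hj := Finset.mem_range.1 hj
    rw [h1 _ (by lia), show b - 1 - (b - 1 - j) = j by lia]
  have h3 := partialNorm_pow_apply σ 1 (θ (partialNorm ρ b q))
  rw [pow_one, h2, partialNorm_pow_apply, partialNorm_conj hG.conj_σ] at h3
  exact h3.symm

/-- With $\rho\sigma g^{-1}=\sigma^a\rho^b$ one has $u=q/\sigma^a\rho^b(q)$, the product of
$q/\rho^b(q)$ and $\rho^b(q)/\sigma^a\rho^b(q)$. Both telescope: scale $x$ by the inverse of the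
partial $\rho$-norm of $q$, and $y$ by the partial $\sigma$-norm of $\rho^b(q)$. By
`norm_partialNorm_fixed` the new parameters stay $\theta$-fixed. -/
theorem exists_rescale_one (hG : IsDihedralGal σ ρ θ) {u b₁ b₂ q : Mˣ}
    (h : UnitaryCocycle σ ρ θ u b₁ b₂) {A : CSA.{u, u} K}
    (hA : IsAbelianCrossedProduct σ ρ u b₁ b₂ A) (hq : (u : M) = q / ρ (σ (θ q)))
    {g : M ≃ₐ[K] M} (hgq : g (θ q) = q) :
    ∃ b₁' b₂' : Mˣ, UnitaryCocycle σ ρ θ 1 b₁' b₂' ∧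
      IsAbelianCrossedProduct σ ρ 1 b₁' b₂' A := by
  have := hG.finiteDimensional
  obtain ⟨a, b, hab⟩ := hG.exists_pow (ρ * σ * g⁻¹)
  have h1 : (σ ^ a) ((ρ ^ b) (q : M)) = ρ (σ (θ q)) := by
    rw [← AlgEquiv.mul_apply, ← hab]
    nth_rewrite 1 [← hgq]
    change ρ (σ (g.symm (g (θ q)))) = _
    rw [g.symm_apply_apply]
  have hc0 := partialNorm_ne_zero ρ b q.ne_zero
  have hd0 := partialNorm_ne_zero σ a ((map_ne_zero (ρ ^ b)).2 q.ne_zero)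
  let c : Mˣ := Units.mk0 _ (inv_ne_zero hc0)
  let d : Mˣ := Units.mk0 _ hd0
  let b₁' : Mˣ := Units.mk0 _ (partialNorm_ne_zero σ (orderOf σ) c.ne_zero) * b₁
  let b₂' : Mˣ := Units.mk0 _ (partialNorm_ne_zero ρ (orderOf ρ) d.ne_zero) * b₂
  have hA' : IsAbelianCrossedProduct σ ρ 1 b₁' b₂' A := by
    refine hG.isAbelianCrossedProduct_rescale hA c d ?_ (by rfl) (by rfl)
    have h2 := (partialNorm_succ' ρ b (q : M)).symm.trans (partialNorm_succ ρ b q)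
    have h3 := (partialNorm_succ' σ a ((ρ ^ b) (q : M))).symm.trans
      (partialNorm_succ σ a ((ρ ^ b) q))
    rw [h1] at h3
    have hρc : ρ (partialNorm ρ b (q : M)) ≠ 0 := by simpa
    have hgq0 : ρ (σ (θ q)) ≠ 0 := by simp
    have hq0 : (ρ ^ b) (q : M) ≠ 0 := (map_ne_zero _).2 q.ne_zero
    rw [hq]
    change partialNorm σ a ((ρ ^ b) (q : M)) * ρ (partialNorm ρ b (q : M))⁻¹ * 1 =
      (partialNorm ρ b (q : M))⁻¹ * σ (partialNorm σ a ((ρ ^ b) (q : M))) * _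
    rw [map_inv₀]
    field_simp
    refine mul_right_cancel₀ hq0 ?_
    linear_combination -(partialNorm σ a ((ρ ^ b) (q : M)) * ρ (σ (θ q))) * h2 -
      q * ρ (partialNorm ρ b (q : M)) * h3
  refine ⟨b₁', b₂', ⟨?_, ?_, ?_, by simp⟩, hA'⟩
  · obtain ⟨-, i, x, y, hr⟩ := isAbelianCrossedProduct_iff.1 hA'
    exact hr.cocycle
  · change θ (partialNorm σ (orderOf σ) (partialNorm ρ b (q : M))⁻¹ * b₁) =
      partialNorm σ (orderOf σ) (partialNorm ρ b (q : M))⁻¹ * b₁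
    rw [partialNorm_inv, map_mul, map_inv₀, hG.norm_partialNorm_fixed h1, h.fixed₁]
  · change θ (partialNorm ρ (orderOf ρ) (partialNorm σ a ((ρ ^ b) (q : M))) * b₂) =
      partialNorm ρ (orderOf ρ) (partialNorm σ a ((ρ ^ b) (q : M))) * b₂
    have h2 : partialNorm σ a ((ρ ^ b) (q : M)) = (ρ ^ b) (partialNorm σ a (q : M)) :=
      partialNorm_apply (g := ρ ^ b) (fun m => by
        simpa using pow_apply_comm hG.commute 1 b m) a _
    rw [h2, partialNorm_pow_apply, map_mul, h.fixed₂,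
      hG.symm.norm_partialNorm_fixed (b := a) (a := b)
        (by rw [← pow_apply_comm hG.commute, h1, hG.apply_comm])]

end IsDihedralGal

end Kernel

/-! ### Generalized dihedral groups. -/

section Group

/-- Inversion on $H$ is a conjugation, hence multiplicative, so $H$ is abelian. -/
theorem IsGeneralizedDihedral.mul_comm_of_mem {G : Type u} [Group G] {H : Subgroup G}
    (h : IsGeneralizedDihedral H) {a b : G} (ha : a ∈ H) (hb : b ∈ H) : a * b = b * a := by
  obtain ⟨-, t, -, -, ht⟩ := h
  have h1 := ht _ (mul_mem ha hb)
  rw [show t * (a * b) * t⁻¹ = t * a * t⁻¹ * (t * b * t⁻¹) by group, ht a ha, ht b hb] at h1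
  rw [← inv_inj, ← h1]
  group

/-- With $t=ks$ for $k\in H$ and $s$ the given involution, $a\,ks\,a=aka^{-1}s=ks$. Thus every
element outside $H$ inverts $H$, not only $s$. -/
theorem IsGeneralizedDihedral.mul_mul_of_notMem {G : Type u} [Group G] {H : Subgroup G}
    (h : IsGeneralizedDihedral H) {a t : G} (ha : a ∈ H) (ht : t ∉ H) : a * t * a = t := by
  obtain ⟨hi, s, hs, -, hs'⟩ := id h
  have hk : t * s⁻¹ ∈ H := by
    rw [Subgroup.mul_mem_iff_of_index_two hi]
    simp [ht, hs]
  have h1 := hs' a ha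
  have h2 : s * a = a⁻¹ * s := by rw [← h1]; group
  have h3 := h.mul_comm_of_mem ha hk
  calc a * t * a = a * (t * s⁻¹) * (s * a) := by group
    _ = t := by rw [h3, h2]; group

theorem IsGeneralizedDihedral.mul_self_of_notMem {G : Type u} [Group G] {H : Subgroup G}
    (h : IsGeneralizedDihedral H) {t : G} (ht : t ∉ H) : t * t = 1 := by
  obtain ⟨hi, s, hs, hs2, hs'⟩ := id h
  have hk : s⁻¹ * t ∈ H := by
    rw [Subgroup.mul_mem_iff_of_index_two hi]
    simp [ht, hs]
  have h1 := h.mul_mul_of_notMem hk hs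
  have h2 : t * t = s * (s⁻¹ * t * s * (s⁻¹ * t)) := by group
  rw [h2, h1, ← sq, hs2]

end Group

/-! ### Translation of the hypotheses into conditions on $\sigma,\rho,\theta$. -/

section Pair

variable {F K M : Type u} [Field F] [Field K] [Field M] [Algebra K M] [Algebra F M]
  {σ ρ : M ≃ₐ[K] M} {θ : M ≃ₐ[F] M} {L₁ L₂ : IntermediateField K M}

theorem isUnitaryData_iff (hP : IsFixedFieldPair L₁ L₂ σ ρ) {u b₁ b₂ : Mˣ} :
    IsUnitaryData L₁ L₂ σ ρ θ u b₁ b₂ ↔ UnitaryCocycle σ ρ θ u b₁ b₂ := by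
  have h1 : ρ b₁ ≠ 0 := by simp
  have h2 := b₂.ne_zero
  constructor
  · intro h
    refine ⟨⟨(hP.mem₂ _).1 h.mem₁, (hP.mem₁ _).1 h.mem₂, ?_, ?_⟩, h.fixed₁, h.fixed₂, h.mul_eq_one⟩
    · rw [← hP.norm₂, h.norm₁, div_mul_cancel₀ _ h1]
    · rw [← hP.norm₁, h.norm₂, div_mul_cancel₀ _ h2]
  · intro h
    refine ⟨(hP.mem₂ _).2 h.apply₁, (hP.mem₁ _).2 h.apply₂, ?_, ?_, h.fixed₁, h.fixed₂,
      h.mul_eq_one⟩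
    · rw [hP.norm₂, eq_div_iff h1, h.norm₁]
    · rw [hP.norm₁, eq_div_iff h2, h.norm₂]

theorem IsFixedFieldPair.orderOf_restrictNormal [Normal K L₁] (hP : IsFixedFieldPair L₁ L₂ σ ρ) :
    orderOf (σ.restrictNormal L₁) = Module.finrank K L₁ := by
  rw [← hP.finrank₁, orderOf_eq_orderOf_iff]
  intro k
  constructor
  · intro h
    refine hP.ext _ _ (fun m hm => ?_) fun m hm => pow_apply_of_apply_eq ((hP.mem₂ m).1 hm) k
    have h1 : (AlgEquiv.restrictNormalHom L₁ σ) ^ k = 1 := h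
    rw [← map_pow] at h1
    have h2 := (σ ^ k).restrictNormal_commutes L₁ ⟨m, hm⟩
    rw [show (σ ^ k).restrictNormal L₁ = 1 from h1] at h2
    exact h2.symm
  · intro h
    change (AlgEquiv.restrictNormalHom L₁ σ) ^ k = 1
    rw [← map_pow, h, map_one]

end Pair

section Tower

variable {F K M : Type u} [Field F] [Field K] [Field M] [Algebra F K] [Algebra K M] [Algebra F M]
  [IsScalarTower F K M] [IsGalois F K] {σ ρ : M ≃ₐ[K] M} {θ : M ≃ₐ[F] M}
  {L₁ L₂ : IntermediateField K M}

theorem isDihedralGal_of_bijective (hM : IsGeneralizedDihedralExtension F K M)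
    (hL : Function.Bijective (Algebra.TensorProduct.productMap L₁.val L₂.val))
    (hσ : Subgroup.zpowers σ = L₂.fixingSubgroup)
    (hρ : Subgroup.zpowers ρ = L₁.fixingSubgroup)
    (hθ : θ ∉ galSubgroup F K M) : IsDihedralGal σ ρ θ := by
  have := hM.finiteDimensional
  have := hM.isGalois
  have : FiniteDimensional K M := FiniteDimensional.right F K M
  have : IsGalois K M := IsGalois.tower_top_of_isGalois F K M
  have hmem : ∀ g : M ≃ₐ[K] M, g.restrictScalars F ∈ galSubgroup F K M := fun g => ⟨g, rfl⟩
  have hD := hM.isGeneralizedDihedral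
  have hc : Commute σ ρ := by
    refine AlgEquiv.ext fun m => ?_
    exact DFunLike.congr_fun (hD.mul_comm_of_mem (hmem σ) (hmem ρ)) m
  exact
    { isBicyclicGal_of_bijective hL hσ hρ hc with
      involutive := fun m => DFunLike.congr_fun (hD.mul_self_of_notMem hθ) m
      conj_σ := fun m => DFunLike.congr_fun (hD.mul_mul_of_notMem (hmem σ) hθ) m
      conj_ρ := fun m => DFunLike.congr_fun (hD.mul_mul_of_notMem (hmem ρ) hθ) m
      restrict := by
        -- If $\theta$ were trivial on $K$ it would be $K$-linear and belong to
        -- $\operatorname{Gal}(M/K)$.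
        refine ⟨θ.restrictNormal K, fun h => hθ ?_, fun k => (θ.restrictNormal_commutes K k).symm⟩
        refine ⟨AlgEquiv.ofRingEquiv (f := (θ : M ≃+* M)) fun k => ?_, rfl⟩
        have h1 := θ.restrictNormal_commutes K k
        rw [h] at h1
        exact h1.symm }

end Tower

/-! ### The group of admissible triples and its Brauer classes. -/

section CocycleGroup

variable {F K M : Type u} [Field F] [Field K] [Field M] [Algebra F K] [Algebra K M] [Algebra F M]

/-- The group of all `(u, b₁, b₂)` for which `A(u, b₁, b₂)` exists and has a unitary involution
that extends `θ` and fixes the standard generators. -/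
def unitaryCocycles (σ ρ : M ≃ₐ[K] M) (θ : M ≃ₐ[F] M) : Subgroup (Mˣ × Mˣ × Mˣ) where
  carrier := {p | UnitaryCocycle σ ρ θ p.1 p.2.1 p.2.2}
  mul_mem' {p p'} h h' :=
    { apply₁ := by simp [h.apply₁, h'.apply₁]
      apply₂ := by simp [h.apply₂, h'.apply₂]
      norm₁ := by
        simp only [Prod.fst_mul, Prod.snd_mul, Units.val_mul, partialNorm_mul, map_mul]
        rw [mul_mul_mul_comm, h.norm₁, h'.norm₁]
      norm₂ := by
        simp only [Prod.fst_mul, Prod.snd_mul, Units.val_mul, partialNorm_mul, map_mul]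
        rw [mul_mul_mul_comm, h.norm₂, h'.norm₂]
      fixed₁ := by simp [h.fixed₁, h'.fixed₁]
      fixed₂ := by simp [h.fixed₂, h'.fixed₂]
      mul_eq_one := by
        simp only [Prod.fst_mul, Units.val_mul, map_mul]
        rw [mul_mul_mul_comm, h.mul_eq_one, h'.mul_eq_one, one_mul] }
  one_mem' :=
    { apply₁ := by simp
      apply₂ := by simp
      norm₁ := by simp [partialNorm_one]
      norm₂ := by simp [partialNorm_one]
      fixed₁ := by simp
      fixed₂ := by simp
      mul_eq_one := by simp }
  inv_mem' {p} h :=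
    { apply₁ := by simp [h.apply₁]
      apply₂ := by simp [h.apply₂]
      norm₁ := by
        simp only [Prod.fst_inv, Prod.snd_inv, Units.val_inv_eq_inv_val, partialNorm_inv, map_inv₀]
        rw [← mul_inv, h.norm₁]
      norm₂ := by
        simp only [Prod.fst_inv, Prod.snd_inv, Units.val_inv_eq_inv_val, partialNorm_inv, map_inv₀]
        rw [← mul_inv, h.norm₂]
      fixed₁ := by simp [h.fixed₁]
      fixed₂ := by simp [h.fixed₂]
      mul_eq_one := by
        simp only [Prod.fst_inv, Units.val_inv_eq_inv_val, map_inv₀]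
        rw [← mul_inv, h.mul_eq_one, inv_one] }

variable {σ ρ : M ≃ₐ[K] M} {θ : M ≃ₐ[F] M} {L₁ L₂ : IntermediateField K M}

namespace IsDihedralGal

/-- The Brauer class of `A(u, b₁, b₂)` as a homomorphism. -/
noncomputable def brauerClass (hG : IsDihedralGal σ ρ θ) :
    unitaryCocycles σ ρ θ →* BrauerGroup.{u, u} K :=
  MonoidHom.mk' (fun p => ⟦(hG.exists_isAbelianCrossedProduct p.2.toBicyclicCocycle).choose⟧)
    fun p p' => (hG.mk_mul_mk
      (hG.exists_isAbelianCrossedProduct p.2.toBicyclicCocycle).choose_spec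
      (hG.exists_isAbelianCrossedProduct p'.2.toBicyclicCocycle).choose_spec
      (hG.exists_isAbelianCrossedProduct (p * p').2.toBicyclicCocycle).choose_spec).symm

theorem brauerClass_apply (hG : IsDihedralGal σ ρ θ) {u b₁ b₂ : Mˣ}
    (h : UnitaryCocycle σ ρ θ u b₁ b₂) {A : CSA.{u, u} K}
    (hA : IsAbelianCrossedProduct σ ρ u b₁ b₂ A) : hG.brauerClass ⟨(u, b₁, b₂), h⟩ = ⟦A⟧ :=
  hG.mk_eq_of_isAbelianCrossedProduct
    (hG.exists_isAbelianCrossedProduct h.toBicyclicCocycle).choose_spec hA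

theorem exists_brauerClass_eq (hG : IsDihedralGal σ ρ θ) (p : unitaryCocycles σ ρ θ) :
    ∃ A : CSA.{u, u} K, IsAbelianCrossedProduct σ ρ p.1.1 p.1.2.1 p.1.2.2 A ∧
      hG.brauerClass p = ⟦A⟧ :=
  ⟨_, (hG.exists_isAbelianCrossedProduct p.2.toBicyclicCocycle).choose_spec, rfl⟩

theorem mem_fixedProduct_of_brauerClass_eq_one [IsScalarTower F K M] (hG : IsDihedralGal σ ρ θ)
    (hP : IsFixedFieldPair L₁ L₂ σ ρ) {p : unitaryCocycles σ ρ θ} (hp : hG.brauerClass p = 1)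
    {q : Mˣ} (hq : (p.1.1 : M) = q / ρ (σ (θ q))) : q ∈ fixedProduct K θ := by
  obtain ⟨A, hA, hA'⟩ := hG.exists_brauerClass_eq p
  exact hG.mem_fixedProduct_of_mk_eq_one hP p.2 hA (hA'.symm.trans hp) hq

variable [Algebra.IsQuadraticExtension F K] [IsGalois F K]

theorem brauerClass_mem (hG : IsDihedralGal σ ρ θ) (p : unitaryCocycles σ ρ θ) :
    hG.brauerClass p ∈ unitaryRelBrauer F K M := by
  obtain ⟨A, hA, hA'⟩ := hG.exists_brauerClass_eq p
  rw [hA']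
  exact p.2.mk_mem_unitaryRelBrauer hG hA

/-- Since `exists_unitaryCocycle` yields the inverse class, it is applied to a representative of
$z^{-1}$. -/
theorem exists_brauerClass_eq_of_mem (hG : IsDihedralGal σ ρ θ) {z : BrauerGroup.{u, u} K}
    (hz : z ∈ unitaryRelBrauer F K M) : ∃ p, hG.brauerClass p = z := by
  obtain ⟨A, hA, hs, τ, hτ⟩ := inv_mem hz
  obtain ⟨u, b₁, b₂, B, h, hB, hBA⟩ := hG.exists_unitaryCocycle hs hτ
  refine ⟨⟨(u, b₁, b₂), h⟩, ?_⟩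
  rw [hG.brauerClass_apply h hB, eq_inv_of_mul_eq_one_left hBA, hA, inv_inv]

/-- The classes of the algebras `A(1, b₁, b₂)`. -/
noncomputable def decomposable (hG : IsDihedralGal σ ρ θ) : Subgroup (BrauerGroup.{u, u} K) :=
  ((MonoidHom.fst Mˣ (Mˣ × Mˣ)).comp (unitaryCocycles σ ρ θ).subtype).ker.map hG.brauerClass

theorem exists_algebraMap_eq (hG : IsDihedralGal σ ρ θ) {m : Mˣ} (hσ : σ m = m) (hρ : ρ m = m)
    (hθ : θ m = m) : ∃ a : Fˣ, (m : M) = algebraMap K M (algebraMap F K a) := by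
  obtain ⟨s, hs1, hs⟩ := hG.restrict
  obtain ⟨s', -, hs'⟩ := IsUnitaryInvolution.exists_conj F K
  obtain rfl := hs' s hs1
  obtain ⟨k, hk⟩ := hG.mem_range_of_apply_eq hσ hρ
  rw [← hk, hs, (algebraMap K M).injective.eq_iff, IsUnitaryInvolution.conj_fixed hs'] at hθ
  obtain ⟨a, ha⟩ := hθ
  have ha0 : a ≠ 0 := by
    rintro rfl
    rw [map_zero] at ha
    rw [← ha, map_zero] at hk
    exact m.ne_zero hk.symm
  exact ⟨Units.mk0 a ha0, by rw [Units.val_mk0, ← hk, ← ha]⟩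

/-- For $u=1$ the norm conditions read $\rho(b_1)=b_1$ and $\sigma(b_2)=b_2$, so $b_1,b_2$ are fixed
by $\sigma,\rho,\theta$ and lie in $F$. This also shows that the decomposable classes form a
subgroup. -/
theorem coe_decomposable [IsScalarTower F K M] [IsGalois K L₁] [IsGalois K L₂]
    (hG : IsDihedralGal σ ρ θ) (hP : IsFixedFieldPair L₁ L₂ σ ρ)
    (hL : Function.Bijective (Algebra.TensorProduct.productMap L₁.val L₂.val)) :
    (hG.decomposable : Set (BrauerGroup.{u, u} K)) = decSet F L₁ L₂ σ ρ := by
  have := hG.finiteDimensional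
  ext z
  constructor
  · rintro ⟨⟨⟨u, b₁, b₂⟩, hp⟩, hu, rfl⟩
    obtain rfl : u = 1 := hu
    have hp : UnitaryCocycle σ ρ θ 1 b₁ b₂ := hp
    have h1 := hp.norm₁
    have h2 := hp.norm₂
    rw [Units.val_one, partialNorm_one, one_mul] at h1 h2
    obtain ⟨a₁, ha₁⟩ := hG.exists_algebraMap_eq hp.apply₁ h1 hp.fixed₁
    obtain ⟨a₂, ha₂⟩ := hG.exists_algebraMap_eq h2.symm hp.apply₂ hp.fixed₂
    obtain ⟨A₁, hA₁⟩ := exists_isCyclicAlgebra (s := σ.restrictNormal L₁)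
      (b := algebraMap F K a₁) (hP.orderOf_restrictNormal) (by simp)
    obtain ⟨A₂, hA₂⟩ := exists_isCyclicAlgebra (s := ρ.restrictNormal L₂)
      (b := algebraMap F K a₂) (hP.symm.orderOf_restrictNormal) (by simp)
    exact ⟨a₁, a₂, A₁, A₂, hA₁, hA₂, hG.brauerClass_apply hp
      (isAbelianCrossedProduct_tensor hL hP hA₁ hA₂ ha₁ ha₂)⟩
  · rintro ⟨a₁, a₂, A₁, A₂, hA₁, hA₂, rfl⟩
    let b (a : Fˣ) : Mˣ := Units.map (algebraMap F M : F →* M) a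
    have hb : ∀ a, (b a : M) = algebraMap K M (algebraMap F K a) := fun a =>
      IsScalarTower.algebraMap_apply F K M a
    have hp : UnitaryCocycle σ ρ θ 1 (b a₁) (b a₂) :=
      { apply₁ := by rw [hb, σ.commutes]
        apply₂ := by rw [hb, ρ.commutes]
        norm₁ := by rw [hb, ρ.commutes, Units.val_one, partialNorm_one, one_mul]
        norm₂ := by rw [hb, σ.commutes, Units.val_one, partialNorm_one, one_mul]
        fixed₁ := θ.commutes _
        fixed₂ := θ.commutes _
        mul_eq_one := by simp }
    exact ⟨⟨(1, b a₁, b a₂), hp⟩, rfl, hG.brauerClass_apply hp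
      (isAbelianCrossedProduct_tensor hL hP hA₁ hA₂ (hb a₁) (hb a₂))⟩

end IsDihedralGal

end CocycleGroup

/-! ### The isomorphism modulo decomposable classes. -/

section Quotient

variable {F K M : Type u} [Field F] [Field K] [Field M] [Algebra F K] [Algebra K M] [Algebra F M]
  [Algebra.IsQuadraticExtension F K] [IsGalois F K]
  {σ ρ : M ≃ₐ[K] M} {θ : M ≃ₐ[F] M} {L₁ L₂ : IntermediateField K M}

namespace IsDihedralGal

/-- The quotient of `Br(M/K; F)` by the decomposable classes. -/
abbrev DecQuotient (hG : IsDihedralGal σ ρ θ) : Type (u + 1) :=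
  unitaryRelBrauer F K M ⧸ hG.decomposable.subgroupOf (unitaryRelBrauer F K M)

/-- `brauerClass` modulo the decomposable classes. -/
noncomputable def decClass (hG : IsDihedralGal σ ρ θ) : unitaryCocycles σ ρ θ →* hG.DecQuotient :=
  (QuotientGroup.mk' _).comp (hG.brauerClass.codRestrict _ hG.brauerClass_mem)

theorem decClass_eq_one_iff (hG : IsDihedralGal σ ρ θ) (p : unitaryCocycles σ ρ θ) :
    hG.decClass p = 1 ↔ ∃ p' : unitaryCocycles σ ρ θ, p'.1.1 = p.1.1 ∧ hG.brauerClass p' = 1 := by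
  -- Multiplying by a triple with first entry $1$ keeps $u$, so triviality modulo decomposable
  -- classes means that $b_1,b_2$ can be changed to make the algebra split.
  refine (QuotientGroup.eq_one_iff _).trans (Subgroup.mem_subgroupOf.trans ?_)
  constructor
  · rintro ⟨p', hp', h⟩
    have hp' : p'.1.1 = 1 := hp'
    have h : hG.brauerClass p' = hG.brauerClass p := h
    refine ⟨p * p'⁻¹, ?_, by rw [map_mul, map_inv, h, mul_inv_cancel]⟩
    change p.1.1 * p'.1.1⁻¹ = _
    rw [hp', inv_one, mul_one]
  · rintro ⟨p', hp', h⟩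
    refine ⟨p * p'⁻¹, ?_, ?_⟩
    · change p.1.1 * p'.1.1⁻¹ = 1
      rw [hp', mul_inv_cancel]
    · rw [map_mul, map_inv, h, inv_one, mul_one]
      rfl

theorem decClass_eq (hG : IsDihedralGal σ ρ θ) {p p' : unitaryCocycles σ ρ θ}
    (h : p.1.1 = p'.1.1) : hG.decClass p = hG.decClass p' := by
  rw [← mul_inv_eq_one, ← map_inv, ← map_mul, decClass_eq_one_iff]
  refine ⟨1, ?_, map_one _⟩
  change 1 = p.1.1 * p'.1.1⁻¹
  rw [h, mul_inv_cancel]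

variable [IsScalarTower F K M]

theorem exists_unitaryCocycle_of_mem (hG : IsDihedralGal σ ρ θ) (hP : IsFixedFieldPair L₁ L₂ σ ρ)
    (q : kerNormTilde F K M) :
    ∃ p : unitaryCocycles σ ρ θ, (p.1.1 : M) = q.1 / ρ (σ (θ q.1)) := by
  have h0 : (q.1 : M) / ρ (σ (θ q.1)) ≠ 0 := by simp
  obtain ⟨b₁, b₂, h⟩ := hG.exists_unitaryCocycle_of_norm_eq_one hP (u := Units.mk0 _ h0)
    (hG.div_mul_apply_div q.1) ((hG.norm_div q.1).2 ((hG.mem_kerNormTilde_iff q.1).1 q.2))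
  exact ⟨⟨(_, b₁, b₂), h⟩, rfl⟩

/-- The homomorphism that sends `q` to the class of `A(q / ρσθ(q), b₁, b₂)` modulo the
decomposable classes. -/
noncomputable def kerNormTildeHom (hG : IsDihedralGal σ ρ θ) (hP : IsFixedFieldPair L₁ L₂ σ ρ) :
    kerNormTilde F K M →* hG.DecQuotient :=
  MonoidHom.mk' (fun q => hG.decClass (hG.exists_unitaryCocycle_of_mem hP q).choose)
    fun q q' => by
      rw [← map_mul]
      refine hG.decClass_eq (Units.ext ?_)
      have h1 := (hG.exists_unitaryCocycle_of_mem hP q).choose_spec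
      have h2 := (hG.exists_unitaryCocycle_of_mem hP q').choose_spec
      have h3 := (hG.exists_unitaryCocycle_of_mem hP (q * q')).choose_spec
      refine h3.trans (Eq.trans ?_ (congrArg₂ (· * ·) h1 h2).symm)
      change ((q.1 * q'.1 : Mˣ) : M) / ρ (σ (θ (q.1 * q'.1 : Mˣ))) = _
      simp only [Units.val_mul, map_mul, mul_div_mul_comm]

theorem kerNormTildeHom_apply (hG : IsDihedralGal σ ρ θ) (hP : IsFixedFieldPair L₁ L₂ σ ρ)
    {q : kerNormTilde F K M} {p : unitaryCocycles σ ρ θ}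
    (h : (p.1.1 : M) = q.1 / ρ (σ (θ q.1))) : hG.kerNormTildeHom hP q = hG.decClass p :=
  hG.decClass_eq (Units.ext ((hG.exists_unitaryCocycle_of_mem hP q).choose_spec.trans h.symm))

theorem mem_kerNormTilde_of_eq_div (hG : IsDihedralGal σ ρ θ) {u b₁ b₂ q : Mˣ}
    (h : UnitaryCocycle σ ρ θ u b₁ b₂) (hq : (u : M) = q / ρ (σ (θ q))) :
    q ∈ kerNormTilde F K M := by
  rw [hG.mem_kerNormTilde_iff, ← hG.norm_div, ← hq]
  exact hG.norm_eq_one_of_unitaryCocycle h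

theorem kerNormTildeHom_surjective (hG : IsDihedralGal σ ρ θ) (hP : IsFixedFieldPair L₁ L₂ σ ρ) :
    Function.Surjective (hG.kerNormTildeHom hP) := by
  intro z
  obtain ⟨⟨z, hz⟩, rfl⟩ := QuotientGroup.mk_surjective z
  obtain ⟨p, rfl⟩ := hG.exists_brauerClass_eq_of_mem hz
  obtain ⟨q, hq⟩ := hG.exists_eq_div p.2.mul_eq_one
  exact ⟨⟨q, hG.mem_kerNormTilde_of_eq_div p.2 hq⟩, hG.kerNormTildeHom_apply hP hq⟩

theorem ker_kerNormTildeHom (hG : IsDihedralGal σ ρ θ) (hP : IsFixedFieldPair L₁ L₂ σ ρ) :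
    (hG.kerNormTildeHom hP).ker = (fixedProduct K θ).subgroupOf (kerNormTilde F K M) := by
  refine le_antisymm (fun q hq => ?_) ?_
  · obtain ⟨p, hp⟩ := hG.exists_unitaryCocycle_of_mem hP q
    rw [MonoidHom.mem_ker, hG.kerNormTildeHom_apply hP hp, hG.decClass_eq_one_iff] at hq
    obtain ⟨p', hp', h⟩ := hq
    exact hG.mem_fixedProduct_of_brauerClass_eq_one hP h (by rw [hp', hp]; rfl)
  -- Viewing the kernel as a subgroup of $M^*$ reduces the inclusion to the generators of $\Pi$,
  -- each fixed by a single $g\theta$.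
  · have h : fixedProduct K θ ≤ (hG.kerNormTildeHom hP).ker.map (kerNormTilde F K M).subtype := by
      refine iSup_le fun g q hq => ?_
      have hgq : g (θ q) = q := hq
      have hq' : q ∈ kerNormTilde F K M :=
        hG.fixedProduct_le (Subgroup.mem_iSup_of_mem g hq)
      refine ⟨⟨q, hq'⟩, ?_, rfl⟩
      obtain ⟨p, hp⟩ := hG.exists_unitaryCocycle_of_mem hP ⟨q, hq'⟩
      obtain ⟨A, hA, hpA⟩ := hG.exists_brauerClass_eq p
      obtain ⟨b₁, b₂, h1, hA'⟩ := hG.exists_rescale_one p.2 hA hp hgq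
      refine MonoidHom.mem_ker.2 ?_
      rw [hG.kerNormTildeHom_apply hP hp, hG.decClass_eq_one_iff]
      -- The same algebra is also $A(1,b_1,b_2)$, so dividing by that triple keeps $u$ and makes the
      -- class trivial.
      refine ⟨p * ⟨(1, b₁, b₂), h1⟩⁻¹, ?_, ?_⟩
      · change p.1.1 * 1⁻¹ = p.1.1
        rw [inv_one, mul_one]
      · rw [map_mul, map_inv, hG.brauerClass_apply h1 hA', hpA, mul_inv_cancel]
    rintro q hq
    obtain ⟨q', hq', h2⟩ := h (Subgroup.mem_subgroupOf.1 hq)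
    rwa [← Subtype.ext h2]

/-- The isomorphism induced by `kerNormTildeHom`. -/
noncomputable def decQuotientEquiv (hG : IsDihedralGal σ ρ θ) (hP : IsFixedFieldPair L₁ L₂ σ ρ) :
    hG.DecQuotient ≃*
      kerNormTilde F K M ⧸ (fixedProduct K θ).subgroupOf (kerNormTilde F K M) :=
  (QuotientGroup.quotientKerEquivOfSurjective _ (hG.kerNormTildeHom_surjective hP)).symm.trans
    (QuotientGroup.quotientMulEquivOfEq (hG.ker_kerNormTildeHom hP))

theorem decQuotientEquiv_decClass (hG : IsDihedralGal σ ρ θ) (hP : IsFixedFieldPair L₁ L₂ σ ρ)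
    {q : kerNormTilde F K M} {p : unitaryCocycles σ ρ θ}
    (h : (p.1.1 : M) = q.1 / ρ (σ (θ q.1))) :
    hG.decQuotientEquiv hP (hG.decClass p) = QuotientGroup.mk q := by
  have h1 : (QuotientGroup.quotientKerEquivOfSurjective _
      (hG.kerNormTildeHom_surjective hP)).symm (hG.decClass p) = QuotientGroup.mk q := by
    rw [MulEquiv.symm_apply_eq]
    exact (hG.kerNormTildeHom_apply hP h).symm
  rw [decQuotientEquiv, MulEquiv.trans_apply, h1]
  rfl

end IsDihedralGal

end Quotient

/-! ### Assembly of the theorem. -/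

theorem mainTheorem4 {F K M : Type u} [Field F] [Field K] [Field M] [Algebra F K] [Algebra K M]
    [Algebra F M] [IsScalarTower F K M] [Algebra.IsQuadraticExtension F K] [IsGalois F K]
    (hM : IsGeneralizedDihedralExtension F K M)
    (L₁ L₂ : IntermediateField K M) [IsGalois K L₁] [IsGalois K L₂]
    [IsCyclic (L₁ ≃ₐ[K] L₁)] [IsCyclic (L₂ ≃ₐ[K] L₂)]
    (hL : Function.Bijective (Algebra.TensorProduct.productMap L₁.val L₂.val))
    (σ ρ : M ≃ₐ[K] M) (hσ : Subgroup.zpowers σ = L₂.fixingSubgroup)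
    (hρ : Subgroup.zpowers ρ = L₁.fixingSubgroup)
    (θ : M ≃ₐ[F] M) (hθ : θ ∉ galSubgroup F K M) :
    (unitaryDec F L₁ L₂ σ ρ : Set (BrauerGroup.{u, u} K)) = decSet F L₁ L₂ σ ρ ∧
    unitaryDec F L₁ L₂ σ ρ ≤ unitaryRelBrauer F K M ∧
    fixedProduct K θ ≤ kerNormTilde F K M ∧
    (∀ z ∈ unitaryRelBrauer F K M, ∃ (u b₁ b₂ : Mˣ) (A : CSA.{u, u} K),
      IsUnitaryData L₁ L₂ σ ρ θ u b₁ b₂ ∧ IsAbelianCrossedProduct σ ρ u b₁ b₂ A ∧ z = ⟦A⟧) ∧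
    ∃ Φ : (unitaryRelBrauer F K M ⧸
          (unitaryDec F L₁ L₂ σ ρ).subgroupOf (unitaryRelBrauer F K M)) ≃*
        (kerNormTilde F K M ⧸ (fixedProduct K θ).subgroupOf (kerNormTilde F K M)),
      ∀ u b₁ b₂ : Mˣ, IsUnitaryData L₁ L₂ σ ρ θ u b₁ b₂ →
        (∃ A : CSA.{u, u} K, IsAbelianCrossedProduct σ ρ u b₁ b₂ A) ∧
        (∃ q : Mˣ, (u : M) = q / ρ (σ (θ q))) ∧
        ∀ A : CSA.{u, u} K, IsAbelianCrossedProduct σ ρ u b₁ b₂ A →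
          ∀ q : Mˣ, (u : M) = q / ρ (σ (θ q)) →
            ∃ (hA : (⟦A⟧ : BrauerGroup.{u, u} K) ∈ unitaryRelBrauer F K M)
              (hq : q ∈ kerNormTilde F K M),
              Φ (QuotientGroup.mk ⟨⟦A⟧, hA⟩) = QuotientGroup.mk ⟨q, hq⟩ := by
  have := hM.finiteDimensional
  have := hM.isGalois
  have : FiniteDimensional K M := FiniteDimensional.right F K M
  have : IsGalois K M := IsGalois.tower_top_of_isGalois F K M
  have hG : IsDihedralGal σ ρ θ := isDihedralGal_of_bijective hM hL hσ hρ hθ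
  have hP : IsFixedFieldPair L₁ L₂ σ ρ := isFixedFieldPair hL hσ hρ
  have hdec := hG.coe_decomposable hP hL
  -- The decomposable classes are already a subgroup, so the closure adds nothing.
  have hdec' : unitaryDec F L₁ L₂ σ ρ = hG.decomposable := by
    rw [unitaryDec, ← hdec, Subgroup.closure_eq]
  refine ⟨by rw [hdec', hdec], ?_, hG.fixedProduct_le, fun z hz => ?_, ?_⟩
  · rw [hdec']
    rintro _ ⟨p, -, rfl⟩
    exact hG.brauerClass_mem p
  · obtain ⟨p, rfl⟩ := hG.exists_brauerClass_eq_of_mem hz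
    obtain ⟨A, hA, hpA⟩ := hG.exists_brauerClass_eq p
    exact ⟨_, _, _, A, (isUnitaryData_iff hP).2 p.2, hA, hpA⟩
  · rw [hdec']
    refine ⟨hG.decQuotientEquiv hP, fun u b₁ b₂ h => ?_⟩
    rw [isUnitaryData_iff hP] at h
    refine ⟨hG.exists_isAbelianCrossedProduct h.toBicyclicCocycle, hG.exists_eq_div h.mul_eq_one,
      fun A hA q hq => ⟨h.mk_mem_unitaryRelBrauer hG hA, hG.mem_kerNormTilde_of_eq_div h hq, ?_⟩⟩
    rw [← hG.decQuotientEquiv_decClass hP (q := ⟨q, hG.mem_kerNormTilde_of_eq_div h hq⟩)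
      (p := ⟨(u, b₁, b₂), h⟩) hq]
    congr 2
    exact Subtype.ext (hG.brauerClass_apply h hA).symm
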